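/- **Theorem (Convergence of Battling-NGD for $\beta$-smooth convex functions).** Setting. Let $m\ge 2$ and $\ell_m=\lfloor\log_2 m\rfloor\le d$. Let $\mathcal D\subseteq\mathbb R^d$ be closed and convex, and let $f:\mathbb R^d\to\mathbb R$ be convex and $\beta$-smooth ($f$ is differentiable and $\nabla f$ is $\beta$-Lipschitz, $\beta>0$). Put $\operatorname{sign}(x)=+1$ for $x\ge 0$ and $-1$ for $x<0$. Battling-NGD with parameters $w_1\in\mathcal D$, $\eta$, $\gamma$, $T$ sets $\mathbf m_1=w_1$ and in each round $t=1,\dots,T$ does the following. (1) It samples $u_t^1,\dots,u_t^{\ell_m}$ i.i.d. uniformly on the sphere of radius $1/\sqrt{\ell_m}$, independently of the past, and puts $U_t=[u_t^1,\dots,u_t^{\ell_m}]$. (2) It makes one multiwise query of the points $w_t+\gamma U_t v$, $v\in\{\pm1\}^{\ell_m}$, and receives a winner, i.e. a $v=v_t$ for which $f(w_t+\gamma U_tv)$ is smallest (ties are broken by an arbitrary fixed measurable rule). (3) With the unit-normalised estimates $g_t^i=-v_i\,\sqrt{\ell_m}\,u_t^i$ and $g_t=\frac1{\ell_m}\sum_i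 g_t^i$ it sets $w_{t+1}=\Pi_{\mathcal D}(w_t-\eta g_t)$, where $\Pi_{\mathcal D}$ is the metric projection onto $\mathcal D$. (4) It makes one pairwise query $\operatorname{sign}(f(\mathbf m_t)-f(w_{t+1}))$ and sets $\mathbf m_{t+1}=\mathbf m_t$ if the answer is $-1$, and $\mathbf m_{t+1}=w_{t+1}$ otherwise. It returns $\mathbf m_{T+1}$. There are a universal constant $C>0$ and constants $c_d\in[\frac1{20},1]$ depending only on $d$ such that in this setting the following hold. (a) Each multiwise query consists of $2^{\ell_m}\le m$ points (indexed by $\{\pm1\}^{\ell_m}$). (b) For every centre $w$, every $\gamma$, every matrix $U=[u^1,\dots,u^{\ell_m}]$ and the corresponding winner $v$, let $v^{(i)}$ be $v$ with its $i$-th sign flipped, $x=w+\gamma Uv$ and $y^i=w+\gamma Uv^{(i)}$. Then $x-y^i=2\gamma v_iu^i$ and $f(x)\le f(y^i)$ for all $i\in\{1,\dots,\ell_m\}$; so the winner gives $\ell_m$ sign comparisons, one along each sampled direction. (c) For every $\gamma>0$ and every point $w$ with $\nabla f(w)\ne0$, the estimates $g^1,\dots,g^{\ell_m}$ formed as in (1)–(3)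 at the point $w$ satisfy, for all unit vectors $b$ and all $i\ne j$, $$\Big|\mathbb E\langle g^i,b\rangle-\frac{c_d}{\sqrt d}\Big\langle\frac{\nabla f(w)}{\|\nabla f(w)\|},b\Big\rangle\Big|\le 2\lambda,\qquad \Big|\mathbb E\langle g^i,g^j\rangle-\frac{c_d^2}{d}\Big|\le 4\lambda,$$ where $\lambda=r\big(1+2\sqrt{\log(1/r)}\big)$, $r=\beta\gamma\sqrt{d\ell_m}/\|\nabla f(w)\|$ (the square root is read as $0$ when $r>1$). (d) Let $x^*\in\mathcal D$ be a minimiser of $f$ over $\mathbb R^d$, $w_1\in\mathcal D$, $\|w_1-x^*\|^2\le D$, $D>0$, $\epsilon>0$, and run Battling-NGD with $$\eta=\frac{\ell_m\sqrt\epsilon}{20\sqrt{d\beta}},\qquad 0<\gamma\le\frac{\epsilon^{3/2}}{960\,\beta d\,\ell_m\sqrt{d\ell_m}\;D\,\sqrt{\log480}}\sqrt{\frac2\beta}$$ for any number $T\ge T_\epsilon:=\big\lfloor C\,\frac{d\beta D}{\epsilon\,\ell_m}\big\rfloor$ of rounds. Then the algorithm makes exactly $2T$ queries ($T$ multiwise,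 $T$ pairwise), $f(\mathbf m_{T+1})$ is integrable, and $\mathbb E[f(\mathbf m_{T+1})]-f(x^*)\le\epsilon$. In particular $2T_\epsilon=O\big(\frac{d\beta D}{\epsilon\ell_m}\big)$ queries suffice. -/

import Mathlib

open MeasureTheory ProbabilityTheory

namespace BattlingNGD

/-- `d`-dimensional Euclidean space. -/
abbrev E (d : ℕ) : Type := EuclideanSpace ℝ (Fin d)

/-- `β`-smoothness: differentiable with `β`-Lipschitz gradient. -/
def IsSmooth {d : ℕ} (β : ℝ) (f : E d → ℝ) : Prop :=
  Differentiable ℝ f ∧ ∀ x y, ‖gradient f x - gradient f y‖ ≤ β * ‖x - y‖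

/-- The uniform probability distribution on the sphere of radius `r` centred at `0`
(normalised surface measure of the unit sphere, pushed forward by `x ↦ r • x`). -/
noncomputable def uniformSphere (d : ℕ) (r : ℝ) : Measure (E d) :=
  (((volume : Measure (E d)).toSphere Set.univ)⁻¹ • (volume : Measure (E d)).toSphere).map
    (fun x : Metric.sphere (0 : E d) 1 => r • (x : E d))

/-- The sign with the convention `sign 0 = +1`. -/
noncomputable def sgn (x : ℝ) : ℝ := if 0 ≤ x then 1 else -1

/-- The hypercube `{±1}^ℓ`. -/
abbrev Cube (ℓ : ℕ) : Type := Fin ℓ → ℤˣ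

/-- The `i`-th coordinate of a hypercube vertex as a real number `±1`. -/
def coord {ℓ : ℕ} (v : Cube ℓ) (i : Fin ℓ) : ℝ := ((v i : ℤ) : ℝ)

/-- The neighbour of a vertex across the `i`-th direction: the `i`-th sign is flipped. -/
def flipSign {ℓ : ℕ} (v : Cube ℓ) (i : Fin ℓ) : Cube ℓ := Function.update v i (-(v i))

/-- The structured query set `w + γ U v`, `v ∈ {±1}^ℓ`, where `U` has columns `u i`. -/
noncomputable def querySet {d ℓ : ℕ} (γ : ℝ) (w : E d) (u : Fin ℓ → E d) : Cube ℓ → E d :=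
  fun v => w + γ • ∑ i, coord v i • u i

/-- A (noiseless) winner oracle for `f`: shown a family of points indexed by the hypercube, it
returns the index of a point of smallest value. Ties are broken by any measurable rule. -/
structure IsWinnerOracle {d ℓ : ℕ} (f : E d → ℝ) (win : (Cube ℓ → E d) → Cube ℓ) : Prop where
  isMin : ∀ (X : Cube ℓ → E d) (v : Cube ℓ), f (X (win X)) ≤ f (X v)
  measurableSet : ∀ v : Cube ℓ, MeasurableSet {X | win X = v}

/-- The `i`-th normalised gradient estimate obtained from the winner `v`: the sampled directions
`u i` have length `1 / √ℓ`, so `√ℓ • u i` is the `i`-th unit direction. -/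
noncomputable def gradEst {d ℓ : ℕ} (u : Fin ℓ → E d) (v : Cube ℓ) (i : Fin ℓ) : E d :=
  -(coord v i • (√(ℓ : ℝ) • u i))

open Classical in
/-- Metric projection: a point of `K` closest to `x` (the unique one when `K` is nonempty, closed
and convex). -/
noncomputable def proj {d : ℕ} (K : Set (E d)) (x : E d) : E d :=
  if h : ∃ p ∈ K, ∀ y ∈ K, ‖p - x‖ ≤ ‖y - x‖ then h.choose else x

/-- State of the algorithm: current point, running minimum, number of oracle queries so far. -/
structure State (d : ℕ) where
  point : E d
  best : E d
  queries : ℕ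

/-- One round of Battling-NGD with sampled directions `u`: one multiwise query, an aggregated
normalised descent step followed by a projection, and one pairwise comparison that updates the
running minimum. -/
noncomputable def step {d ℓ : ℕ} (f : E d → ℝ) (win : (Cube ℓ → E d) → Cube ℓ) (K : Set (E d))
    (η γ : ℝ) (s : State d) (u : Fin ℓ → E d) : State d :=
  let v := win (querySet γ s.point u)
  let g := (1 / (ℓ : ℝ)) • ∑ i, gradEst u v i
  let w' := proj K (s.point - η • g)
  { point := w'
    best := if sgn (f s.best - f w') < 0 then s.best else w'
    queries := s.queries + 1 + 1 }

/-- The state after `T` rounds from the initial point `w₁`, where `u t` are the directions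
sampled in round `t` (rounds are counted from `0`); `(run … T).best` is the returned point. -/
noncomputable def run {d ℓ : ℕ} (f : E d → ℝ) (win : (Cube ℓ → E d) → Cube ℓ) (K : Set (E d))
    (η γ : ℝ) (w₁ : E d) (u : ℕ → Fin ℓ → E d) : ℕ → State d
  | 0 => { point := w₁, best := w₁, queries := 0 }
  | t + 1 => step f win K η γ (run f win K η γ w₁ u t) (u t)

/-- The error level `λ = r (1 + 2 √(log (1 / r)))`, `r = β γ √(d ℓ) / G`, of the gradient
direction estimates at a point whose gradient has norm `G`. -/
noncomputable def errLevel (β γ : ℝ) (d ℓ : ℕ) (G : ℝ) : ℝ :=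
  (β * γ * √((d : ℝ) * ℓ) / G) *
    (1 + 2 * √(Real.log (G / (β * γ * √((d : ℝ) * ℓ)))))

end BattlingNGD

/-!
Why Battling-NGD converges, and why `C = 400` suffices.

*One round.* Let `n` be the unit gradient at the centre `w`, `G` the norm of the gradient, and `uᵢ`
the `i`-th sampled unit direction. Flipping one sign of the winner cannot lower `f`, so the `i`-th
estimate `gᵢ` is `± uᵢ` with a sign chosen by a comparison of values of `f`. By smoothness this sign
is that of `⟨uᵢ, n⟩` unless `|⟨uᵢ, n⟩| ≤ r / √d` with `r = β γ √(d ℓ) / G`, and such directions have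
probability at most `r` (`sphereUnif_slab`): the cone over them lies in a slab of the unit ball, and
`2 ω_{d-1} ≤ √d ω_d` for the volumes `ω` of unit balls. Hence `gᵢ` is within `2 r` in mean of the
oriented direction `orient n uᵢ` (`integral_norm_est_sub_orient_le`). The oriented directions are
independent, and by rotation invariance their mean is `(c_d / √d) n` with
`c_d = √d ∫ |⟨x, n⟩|` (`integral_sgn_inner`). This gives the two bounds on the estimates, as
`r ≤ λ`; that `1 / 2 ≤ c_d ≤ 1` follows from the second and fourth moments of `⟨x, n⟩`.

*Drift.* Let `Δ = f w - f x*`. The sublevel set of `w` contains the ball of radius `√(2 Δ / β)`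
around `x*`, so `⟨n, w - x*⟩ ≥ √(2 Δ / β)`, and in mean one round decreases `‖w - x*‖²` by at least
`μ √Δ` with `μ = η / √(d β)`, up to a small relative error caused by wrong signs, provided
`Δ > ε / 2` (`Setting.integral_distChange_le`).

*From the drift to the gap.* Summing the drift only bounds the mean of `√Δ`, which does not bound
the mean of `Δ`. Therefore the second moment of the potential `Z_t = ‖w_t - x*‖² + μ ∑_{s < t} √Δ_s`
is followed, stopped as soon as a gap is at most `ε / 2`. Its growth in one round is governed by the
second moment of the change of the distance, hence by the fourth moment of the averaged estimate,
which is `O(1 / ℓ²)` as `ℓ ≤ d`, again up to wrong signs (`integral_norm_sum_orient_pow_four_le`).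
So after `T = ⌊400 d β D / (ε ℓ)⌋` rounds `𝔼 Z_T² ≤ 80 D²`, the expectation being restricted to the
event that all earlier gaps exceed `ε / 2` (`recursion_bound`). On this event
`μ T √Δ ≤ Z_T` for the smallest gap `Δ`, so the gap of the returned point is at most `ε / 2` off the
event and at most `Z_T² / (μ T)²` on it (`Setting.gap_best_le`), and `(μ T)² ≥ 324 D² / ε` once
`ε < β D / 2`. For larger `ε` the initial point is good enough already.

The expectations in these recursions are taken one round at a time, by integrating out the
directions of the current round with the earlier ones frozen (`integral_past_present`). The given
directions are only almost everywhere measurable and almost surely on their sphere; they agree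
almost surely with rescaled points of the unit sphere that are measurable (`exists_sph_lift`), so
that all pathwise estimates hold everywhere.
-/

namespace BattlingNGD

/-! ### The uniform measure on the sphere -/

/-- The unit sphere of `E d`, as a type. -/
abbrev Sph (d : ℕ) : Type := Metric.sphere (0 : E d) 1

/-- The uniform probability measure on the unit sphere, as a measure on the sphere itself. -/
noncomputable def sphereUnif (d : ℕ) : Measure (Sph d) :=
  ((volume : Measure (E d)).toSphere Set.univ)⁻¹ • (volume : Measure (E d)).toSphere

theorem uniformSphere_eq_map (d : ℕ) (r : ℝ) :
    uniformSphere d r = (sphereUnif d).map (fun x : Sph d => r • (x : E d)) := rfl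

theorem Sph.norm_eq {d : ℕ} (x : Sph d) : ‖(x : E d)‖ = 1 := by simp

theorem Sph.abs_inner_le {d : ℕ} (x : Sph d) (b : E d) : |inner ℝ (x : E d) b| ≤ ‖b‖ := by
  simpa using abs_real_inner_le_norm (x : E d) b

instance (d : ℕ) [NeZero d] : Nontrivial (E d) := by
  have : Nonempty (Fin d) := ⟨0⟩
  infer_instance

instance (d : ℕ) [NeZero d] : Nonempty (Sph d) :=
  (NormedSpace.sphere_nonempty.2 zero_le_one).to_subtype

instance (d : ℕ) [NeZero d] : IsProbabilityMeasure (sphereUnif d) := by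
  constructor
  rw [sphereUnif, Measure.smul_apply, smul_eq_mul]
  exact ENNReal.inv_mul_cancel
    (by rw [Ne, Measure.measure_univ_eq_zero]; exact Measure.toSphere_ne_zero _)
    (measure_ne_top _ _)

/-- The action of a linear isometry on the unit sphere. -/
noncomputable def sphIsometry {d : ℕ} (L : E d ≃ₗᵢ[ℝ] E d) (x : Sph d) : Sph d :=
  ⟨L x, by simp⟩

theorem measurable_sphIsometry {d : ℕ} (L : E d ≃ₗᵢ[ℝ] E d) : Measurable (sphIsometry L) :=
  (L.continuous.measurable.comp measurable_subtype_coe).subtype_mk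

open scoped Pointwise in
theorem map_sphIsometry {d : ℕ} (L : E d ≃ₗᵢ[ℝ] E d) :
    (sphereUnif d).map (sphIsometry L) = sphereUnif d := by
  rw [sphereUnif, Measure.map_smul]
  congr 1
  ext s hs
  rw [Measure.map_apply (measurable_sphIsometry L) hs, Measure.toSphere_apply' _ hs,
    Measure.toSphere_apply' _ (measurable_sphIsometry L hs)]
  congr 1
  have h : Set.Ioo (0 : ℝ) 1 • ((fun x : Sph d => (x : E d)) '' (sphIsometry L ⁻¹' s))
      = L ⁻¹' (Set.Ioo (0 : ℝ) 1 • ((fun x : Sph d => (x : E d)) '' s)) := by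
    ext y
    simp only [Set.mem_smul, Set.mem_image, Set.mem_preimage]
    constructor
    · rintro ⟨a, ha, -, ⟨x, hx, rfl⟩, rfl⟩
      exact ⟨a, ha, _, ⟨_, hx, rfl⟩, by simp [sphIsometry]⟩
    · rintro ⟨a, ha, -, ⟨x, hx, rfl⟩, h⟩
      refine ⟨a, ha, _, ⟨sphIsometry L.symm x, ?_, rfl⟩, ?_⟩
      · simpa [sphIsometry] using hx
      · apply L.injective
        simp [sphIsometry, ← h]
  rw [h]
  exact L.measurePreserving.measure_preimage_emb L.toHomeomorph.measurableEmbedding _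

theorem integral_comp_isometry {d : ℕ} (L : E d ≃ₗᵢ[ℝ] E d) {F : E d → ℝ} (hF : Measurable F) :
    ∫ x, F (L (x : E d)) ∂sphereUnif d = ∫ x, F (x : E d) ∂sphereUnif d := by
  conv_rhs => rw [← map_sphIsometry L]
  exact (integral_map (f := fun x : Sph d => F (x : E d)) (measurable_sphIsometry L).aemeasurable
    (hF.comp measurable_subtype_coe).aestronglyMeasurable).symm

theorem exists_isometry_map_eq {d : ℕ} {v w : E d} (h : ‖v‖ = ‖w‖) :
    ∃ L : E d ≃ₗᵢ[ℝ] E d, L v = w :=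
  ⟨_, Submodule.reflection_sub h⟩

/-- The law of `⟨x, v⟩` under the uniform measure depends on `v` through its norm only. -/
theorem integral_inner_congr {d : ℕ} {φ : ℝ → ℝ} (hφ : Measurable φ) {v w : E d}
    (h : ‖v‖ = ‖w‖) :
    ∫ x, φ (inner ℝ (x : E d) v) ∂sphereUnif d = ∫ x, φ (inner ℝ (x : E d) w) ∂sphereUnif d := by
  obtain ⟨L, hL⟩ := exists_isometry_map_eq h
  rw [← integral_comp_isometry L (F := fun x => φ (inner ℝ x w)) (by fun_prop)]
  simp [← hL]

/-- A bounded measurable function is integrable for a finite measure. -/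
theorem integrable_of_bdd {α : Type*} [MeasurableSpace α] {μ : Measure α} [IsFiniteMeasure μ]
    {F : α → ℝ} (hF : Measurable F) (C : ℝ) (hC : ∀ x, |F x| ≤ C) : Integrable F μ :=
  Integrable.of_bound hF.aestronglyMeasurable C (Filter.Eventually.of_forall hC)

theorem integrable_inner_pow {d : ℕ} [NeZero d] (v : E d) (k : ℕ) :
    Integrable (fun x : Sph d => (inner ℝ (x : E d) v) ^ k) (sphereUnif d) := by
  refine integrable_of_bdd (by fun_prop) (‖v‖ ^ k) fun x => ?_
  rw [abs_pow]
  exact pow_le_pow_left₀ (abs_nonneg _) (x.abs_inner_le v) k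

theorem sum_inner_single_sq {d : ℕ} (x : Sph d) :
    ∑ i, (inner ℝ (x : E d) (EuclideanSpace.single i 1)) ^ 2 = 1 := by
  have h := EuclideanSpace.norm_sq_eq (x : E d)
  simp only [Sph.norm_eq, Real.norm_eq_abs, sq_abs] at h
  simp [EuclideanSpace.inner_single_right, ← h]

theorem integral_inner_sq_of_norm_eq_one {d : ℕ} [NeZero d] {n : E d} (hn : ‖n‖ = 1) :
    ∫ x, (inner ℝ (x : E d) n) ^ 2 ∂sphereUnif d = 1 / d := by
  have h1 : ∫ x : Sph d, ∑ i, (inner ℝ (x : E d) (EuclideanSpace.single i 1)) ^ 2 ∂sphereUnif d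
      = 1 := by simp only [sum_inner_single_sq]; simp
  rw [integral_finsetSum _ fun i _ => integrable_inner_pow _ 2] at h1
  have h2 : ∀ i : Fin d, ∫ x : Sph d, (inner ℝ (x : E d) (EuclideanSpace.single i (1 : ℝ))) ^ 2
      ∂sphereUnif d = ∫ x, (inner ℝ (x : E d) n) ^ 2 ∂sphereUnif d := fun i =>
    integral_inner_congr (φ := fun t => t ^ 2) (by fun_prop) (by simp [hn])
  simp only [h2, Finset.sum_const, Finset.card_univ, Fintype.card_fin, nsmul_eq_mul] at h1
  rw [eq_div_iff (by simp [NeZero.ne d]), mul_comm]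
  exact h1

theorem integral_inner_sq {d : ℕ} [NeZero d] (b : E d) :
    ∫ x, (inner ℝ (x : E d) b) ^ 2 ∂sphereUnif d = ‖b‖ ^ 2 / d := by
  rcases eq_or_ne b 0 with rfl | hb
  · simp
  have hn : ‖(‖b‖⁻¹ • b)‖ = 1 := by simp [norm_smul, hb]
  have h := integral_inner_sq_of_norm_eq_one hn
  simp only [inner_smul_right, mul_pow] at h
  rw [integral_const_mul] at h
  have : ‖b‖ ≠ 0 := by simpa using hb
  have hd : (d : ℝ) ≠ 0 := by simp [NeZero.ne d]
  field_simp at h ⊢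
  linarith

/-- The polarisation identity for fourth powers and rotation invariance turn the mixed moments
`∫ xᵢ² xⱼ²` into multiples of `∫ xᵢ⁴`; summing them gives `1 = ∫ ‖x‖⁴`. -/
theorem integral_inner_pow_four_le {d : ℕ} [NeZero d] {n : E d} (hn : ‖n‖ = 1) :
    ∫ x, (inner ℝ (x : E d) n) ^ 4 ∂sphereUnif d ≤ 3 / (d : ℝ) ^ 2 := by
  set M := ∫ x : Sph d, (inner ℝ (x : E d) n) ^ 4 ∂sphereUnif d with hM
  have hM0 : 0 ≤ M := integral_nonneg fun x => by positivity
  let e : Fin d → E d := fun i => EuclideanSpace.single i (1 : ℝ)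
  have hI : ∀ i j : Fin d, Integrable
      (fun x : Sph d => (inner ℝ (x : E d) (e i)) ^ 2 * (inner ℝ (x : E d) (e j)) ^ 2)
      (sphereUnif d) := fun i j => by
    refine integrable_of_bdd (by fun_prop) 1 fun x => ?_
    rw [abs_mul, abs_pow, abs_pow]
    have h1 := x.abs_inner_le (e i)
    have h2 := x.abs_inner_le (e j)
    simp only [e, PiLp.norm_single, norm_one] at h1 h2
    exact mul_le_one₀ (pow_le_one₀ (abs_nonneg _) h1) (by positivity)
      (pow_le_one₀ (abs_nonneg _) h2)
  have h4 : ∀ i, ∫ x : Sph d, (inner ℝ (x : E d) (e i)) ^ 4 ∂sphereUnif d = M := fun i =>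
    integral_inner_congr (φ := fun t => t ^ 4) (by fun_prop) (by simp [hn, e])
  have hij : ∀ i j, M / 3 ≤ ∫ x : Sph d,
      (inner ℝ (x : E d) (e i)) ^ 2 * (inner ℝ (x : E d) (e j)) ^ 2 ∂sphereUnif d := by
    intro i j
    rcases eq_or_ne i j with rfl | hne
    · have : ∫ x : Sph d,
        (inner ℝ (x : E d) (e i)) ^ 2 * (inner ℝ (x : E d) (e i)) ^ 2 ∂sphereUnif d = M := by
        rw [← h4 i]; congr 1; ext x; ring
      linarith
    · have horth : inner ℝ (e i) (e j) = 0 := by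
        simp [e, EuclideanSpace.inner_single_left, hne]
      have hei : ∀ i, ‖e i‖ = 1 := fun i => by simp [e]
      have hp : ‖e i + e j‖ = ‖√2 • n‖ := by
        rw [norm_smul, hn, Real.norm_eq_abs, abs_of_nonneg (Real.sqrt_nonneg _), mul_one]
        rw [← Real.sqrt_sq (norm_nonneg (e i + e j)), norm_add_sq_real, horth, hei, hei]
        norm_num
      have hm : ‖e i - e j‖ = ‖√2 • n‖ := by
        rw [norm_smul, hn, Real.norm_eq_abs, abs_of_nonneg (Real.sqrt_nonneg _), mul_one]
        rw [← Real.sqrt_sq (norm_nonneg (e i - e j)), norm_sub_sq_real, horth, hei, hei]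
        norm_num
      have h2 : ∫ x : Sph d, (inner ℝ (x : E d) (√2 • n)) ^ 4 ∂sphereUnif d = 4 * M := by
        simp only [inner_smul_right, mul_pow]
        rw [integral_const_mul, show (√2 : ℝ) ^ 4 = (√2 ^ 2) ^ 2 by ring,
          Real.sq_sqrt zero_le_two]
        norm_num [hM]
      have hp' : ∫ x : Sph d, (inner ℝ (x : E d) (e i + e j)) ^ 4 ∂sphereUnif d = 4 * M := by
        rw [← h2]; exact integral_inner_congr (φ := fun t => t ^ 4) (by fun_prop) hp
      have hm' : ∫ x : Sph d, (inner ℝ (x : E d) (e i - e j)) ^ 4 ∂sphereUnif d = 4 * M := by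
        rw [← h2]; exact integral_inner_congr (φ := fun t => t ^ 4) (by fun_prop) hm
      have key : ∫ x : Sph d, ((inner ℝ (x : E d) (e i + e j)) ^ 4
          + (inner ℝ (x : E d) (e i - e j)) ^ 4) ∂sphereUnif d
          = ∫ x : Sph d, (2 * (inner ℝ (x : E d) (e i)) ^ 4
            + 12 * ((inner ℝ (x : E d) (e i)) ^ 2 * (inner ℝ (x : E d) (e j)) ^ 2)
            + 2 * (inner ℝ (x : E d) (e j)) ^ 4) ∂sphereUnif d := by
        congr 1; ext x
        rw [inner_add_right, inner_sub_right]; ring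
      rw [integral_add (integrable_inner_pow _ 4) (integrable_inner_pow _ 4), hp', hm',
        integral_add, integral_add, integral_const_mul, integral_const_mul, integral_const_mul,
        h4, h4] at key
      · linarith
      · exact (integrable_inner_pow _ 4).const_mul _
      · exact (hI i j).const_mul _
      · exact ((integrable_inner_pow _ 4).const_mul _).add ((hI i j).const_mul _)
      · exact (integrable_inner_pow _ 4).const_mul _
  have hsum : ∑ i : Fin d, ∑ j : Fin d, ∫ x : Sph d,
      (inner ℝ (x : E d) (e i)) ^ 2 * (inner ℝ (x : E d) (e j)) ^ 2 ∂sphereUnif d = 1 := by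
    simp_rw [← integral_finsetSum Finset.univ fun j _ => hI _ j]
    rw [← integral_finsetSum _ fun i _ => integrable_finsetSum _ fun j _ => hI i j]
    have : ∀ x : Sph d, ∑ i : Fin d, ∑ j : Fin d,
        (inner ℝ (x : E d) (e i)) ^ 2 * (inner ℝ (x : E d) (e j)) ^ 2 = 1 := fun x => by
      rw [← Finset.sum_mul_sum]; simp [e, sum_inner_single_sq]
    simp only [this]; simp
  have hle : ∑ i : Fin d, ∑ j : Fin d, M / 3 ≤ 1 := by
    rw [← hsum]; exact Finset.sum_le_sum fun i _ => Finset.sum_le_sum fun j _ => hij i j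
  simp only [Finset.sum_const, Finset.card_univ, Fintype.card_fin, nsmul_eq_mul] at hle
  have hd : (0 : ℝ) < d := by exact_mod_cast NeZero.pos d
  rw [le_div_iff₀ (by positivity)]
  linarith

/-- The constant `c_d = √d · ∫ |⟨x, n⟩|`, `n` any unit vector; the average over the coordinate
directions makes the definition independent of a choice of `n`. -/
noncomputable def cConst (d : ℕ) : ℝ :=
  √d * ((1 / d) * ∑ i : Fin d, ∫ x : Sph d, |inner ℝ (x : E d) (EuclideanSpace.single i (1 : ℝ))|
    ∂sphereUnif d)

theorem integral_abs_inner {d : ℕ} [NeZero d] {n : E d} (hn : ‖n‖ = 1) :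
    ∫ x, |inner ℝ (x : E d) n| ∂sphereUnif d = cConst d / √d := by
  have h2 : ∀ i : Fin d, ∫ x : Sph d, |inner ℝ (x : E d) (EuclideanSpace.single i (1 : ℝ))|
      ∂sphereUnif d = ∫ x, |inner ℝ (x : E d) n| ∂sphereUnif d := fun i =>
    integral_inner_congr (φ := fun t => |t|) (by fun_prop) (by simp [hn])
  have hd : (0 : ℝ) < d := by exact_mod_cast NeZero.pos d
  have hd' : √(d : ℝ) ≠ 0 := by positivity
  simp only [cConst, h2, Finset.sum_const, Finset.card_univ, Fintype.card_fin, nsmul_eq_mul]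
  field_simp

theorem integrable_abs_inner {d : ℕ} [NeZero d] (v : E d) :
    Integrable (fun x : Sph d => |inner ℝ (x : E d) v|) (sphereUnif d) :=
  integrable_of_bdd (by fun_prop) ‖v‖ fun x => by rw [abs_abs]; exact x.abs_inner_le v

theorem cConst_eq {d : ℕ} [NeZero d] {n : E d} (hn : ‖n‖ = 1) :
    cConst d = √d * ∫ x, |inner ℝ (x : E d) n| ∂sphereUnif d := by
  have hd : (0 : ℝ) < d := by exact_mod_cast NeZero.pos d
  have hd' : √(d : ℝ) ≠ 0 := by positivity
  rw [integral_abs_inner hn]; field_simp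

theorem exists_norm_eq_one (d : ℕ) [NeZero d] : ∃ n : E d, ‖n‖ = 1 :=
  ⟨EuclideanSpace.single 0 1, by simp⟩

theorem cConst_le_one (d : ℕ) [NeZero d] : cConst d ≤ 1 := by
  obtain ⟨n, hn⟩ := exists_norm_eq_one d
  have hd : (0 : ℝ) < d := by exact_mod_cast NeZero.pos d
  have hsq := Real.sq_sqrt hd.le
  rw [cConst_eq hn, ← integral_const_mul]
  calc ∫ x : Sph d, √d * |inner ℝ (x : E d) n| ∂sphereUnif d
      ≤ ∫ x : Sph d, (1 / 2 + d / 2 * (inner ℝ (x : E d) n) ^ 2) ∂sphereUnif d := by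
        refine integral_mono ((integrable_abs_inner n).const_mul _)
          ((integrable_const _).add ((integrable_inner_pow n 2).const_mul _)) fun x => ?_
        dsimp only
        have := sq_nonneg (√(d : ℝ) * |inner ℝ (x : E d) n| - 1)
        rw [sub_sq, mul_pow, hsq, sq_abs] at this
        linarith
    _ = 1 := by
        rw [integral_add (integrable_const _) ((integrable_inner_pow n 2).const_mul _),
          integral_const_mul, integral_inner_sq_of_norm_eq_one hn]
        simp; field_simp; norm_num

theorem half_le_cConst (d : ℕ) [NeZero d] : 1 / 2 ≤ cConst d := by
  obtain ⟨n, hn⟩ := exists_norm_eq_one d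
  have hd : (0 : ℝ) < d := by exact_mod_cast NeZero.pos d
  have hsq := Real.sq_sqrt hd.le
  rw [cConst_eq hn, ← integral_const_mul]
  have i2 := (integrable_inner_pow n 2).const_mul (3 / 4 * (d : ℝ))
  have i4 := (integrable_inner_pow n 4).const_mul ((d : ℝ) ^ 2 / 16)
  calc (1 : ℝ) / 2 ≤ 3 / 4 * d * (1 / d) - d ^ 2 / 16 * (3 / d ^ 2) := by
        field_simp; norm_num
    _ ≤ ∫ x : Sph d, (3 / 4 * d * (inner ℝ (x : E d) n) ^ 2
          - (d : ℝ) ^ 2 / 16 * (inner ℝ (x : E d) n) ^ 4) ∂sphereUnif d := by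
        rw [integral_sub i2 i4, integral_const_mul, integral_const_mul,
          integral_inner_sq_of_norm_eq_one hn]
        gcongr
        exact integral_inner_pow_four_le hn
    _ ≤ ∫ x : Sph d, √d * |inner ℝ (x : E d) n| ∂sphereUnif d := by
        refine integral_mono (i2.sub i4) ((integrable_abs_inner n).const_mul _) fun x => ?_
        dsimp only
        -- `y - 3/4 y² + y⁴/16 = y (y - 2)² (y + 4) / 16` is nonnegative for `y ≥ 0`
        set y := √(d : ℝ) * |inner ℝ (x : E d) n| with hy
        have hy0 : 0 ≤ y := by positivity
        have hy2 : y ^ 2 = d * (inner ℝ (x : E d) n) ^ 2 := by rw [hy, mul_pow, hsq, sq_abs]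
        have hy4 : y ^ 4 = d ^ 2 * (inner ℝ (x : E d) n) ^ 4 := by
          rw [show y ^ 4 = (y ^ 2) ^ 2 by ring, hy2]; ring
        have : 0 ≤ y * (y - 2) ^ 2 * (y + 4) := by positivity
        nlinarith

theorem sgn_mul_self (x : ℝ) : sgn x * x = |x| := by
  unfold sgn
  split_ifs with h
  · rw [abs_of_nonneg h, one_mul]
  · rw [abs_of_neg (not_le.1 h)]; ring

theorem abs_sgn (x : ℝ) : |sgn x| = 1 := by
  unfold sgn; split_ifs <;> simp

theorem measurable_sgn : Measurable sgn :=
  Measurable.ite measurableSet_Ici measurable_const measurable_const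

/-- A uniform direction, oriented so as to have a nonnegative inner product with `n`, points
along `n` on average: its component orthogonal to `n` cancels by reflection. -/
theorem integral_sgn_inner {d : ℕ} [NeZero d] {n : E d} (hn : ‖n‖ = 1) (b : E d) :
    ∫ x, sgn (inner ℝ (x : E d) n) * inner ℝ (x : E d) b ∂sphereUnif d
      = cConst d / √d * inner ℝ n b := by
  have hsgn := measurable_sgn
  have hint : ∀ v : E d, Integrable
      (fun x : Sph d => sgn (inner ℝ (x : E d) n) * inner ℝ (x : E d) v) (sphereUnif d) :=
    fun v => integrable_of_bdd (by fun_prop) ‖v‖ fun x => by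
      rw [abs_mul, abs_sgn, one_mul]; exact x.abs_inner_le v
  have horth : ∀ v : E d, inner ℝ n v = 0 →
      ∫ x, sgn (inner ℝ (x : E d) n) * inner ℝ (x : E d) v ∂sphereUnif d = 0 := by
    intro v hv
    let R : E d ≃ₗᵢ[ℝ] E d := (Submodule.span ℝ {n}).reflection
    have hRn : R n = n := Submodule.reflection_mem_subspace_eq_self
      (Submodule.mem_span_singleton_self n)
    have hRv : R v = -v := Submodule.reflection_mem_subspace_orthogonalComplement_eq_neg
      (Submodule.mem_orthogonal_singleton_iff_inner_right.2 hv)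
    have h := integral_comp_isometry R
      (F := fun x => sgn (inner ℝ x n) * inner ℝ x v) (by fun_prop)
    have hx : ∀ x : E d, sgn (inner ℝ (R x) n) * inner ℝ (R x) v
        = -(sgn (inner ℝ x n) * inner ℝ x v) := fun x => by
      have h1 : inner ℝ (R x) n = inner ℝ x n := by
        conv_lhs => rw [← hRn]
        exact R.inner_map_map _ _
      have h2 : inner ℝ (R x) v = -inner ℝ x v := by
        have : inner ℝ (R x) (R v) = inner ℝ x v := R.inner_map_map _ _
        rw [hRv, inner_neg_right] at this
        linarith
      rw [h1, h2]; ring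
    simp only [hx] at h
    rw [integral_neg] at h
    linarith
  have hb : b = (inner ℝ n b) • n + (b - (inner ℝ n b) • n) := by abel
  have hz : inner ℝ n (b - (inner ℝ n b) • n) = 0 := by
    rw [inner_sub_right, inner_smul_right, real_inner_self_eq_norm_sq, hn]; ring
  conv_lhs => rw [hb]
  simp only [inner_add_right, mul_add]
  rw [integral_add, horth _ hz, add_zero]
  · simp only [inner_smul_right]
    rw [← integral_abs_inner hn, mul_comm, ← integral_const_mul]
    congr 1; ext x
    rw [← sgn_mul_self]; ring
  · exact hint _
  · exact hint _

/-! ### Anti-concentration around hyperplanes -/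

/-- Log-convexity of the Gamma function at the midpoint of `[x, x + 1]`. -/
theorem Gamma_add_half_le {x : ℝ} (hx : 0 < x) : Real.Gamma (x + 1 / 2) ≤ √x * Real.Gamma x := by
  have hG := Real.Gamma_pos_of_pos hx
  have h := Real.Gamma_mul_add_mul_le_rpow_Gamma_mul_rpow_Gamma (s := x) (t := x + 1)
    (a := 1 / 2) (b := 1 / 2) hx (by linarith) (by norm_num) (by norm_num) (by norm_num)
  rw [show 1 / 2 * x + 1 / 2 * (x + 1) = x + 1 / 2 by ring, Real.Gamma_add_one hx.ne',
    Real.mul_rpow hx.le hG.le, ← Real.sqrt_eq_rpow, ← Real.sqrt_eq_rpow] at h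
  calc _ ≤ _ := h
    _ = √x * (√(Real.Gamma x)) ^ 2 := by ring
    _ = _ := by rw [Real.sq_sqrt hG.le]

/-- Consecutive unit balls satisfy `2 ω_k ≤ √(k + 1) ω_{k+1}`. -/
theorem two_mul_volume_ball_le (k : ℕ) [NeZero k] :
    2 * (volume : Measure (E k)).real (Metric.ball 0 1)
      ≤ √((k : ℝ) + 1) * (volume : Measure (E (k + 1))).real (Metric.ball 0 1) := by
  have : Nonempty (Fin k) := ⟨0⟩
  have hpos : ∀ m : ℕ, 0 ≤ √Real.pi ^ m / Real.Gamma ((m : ℝ) / 2 + 1) := fun m =>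
    div_nonneg (by positivity) (Real.Gamma_pos_of_pos (by positivity)).le
  simp only [measureReal_def, EuclideanSpace.volume_ball, Fintype.card_fin, ENNReal.ofReal_one,
    one_pow, one_mul, ENNReal.toReal_ofReal (hpos _)]
  have hk : (1 : ℝ) ≤ k := by exact_mod_cast NeZero.one_le
  have hx : (0 : ℝ) < (k : ℝ) / 2 + 1 := by positivity
  have h := Gamma_add_half_le hx
  have hG := Real.Gamma_pos_of_pos hx
  have hG' := Real.Gamma_pos_of_pos (show (0 : ℝ) < (k : ℝ) / 2 + 1 + 1 / 2 by positivity)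
  rw [show ((k + 1 : ℕ) : ℝ) / 2 + 1 = (k : ℝ) / 2 + 1 + 1 / 2 by push_cast; ring, pow_succ]
  have hs : 2 * √((k : ℝ) / 2 + 1) ≤ √((k : ℝ) + 1) * √Real.pi := by
    rw [← Real.sqrt_mul (by positivity)]
    apply Real.le_sqrt_of_sq_le
    rw [mul_pow, Real.sq_sqrt hx.le]
    nlinarith [Real.pi_gt_three]
  rw [← mul_div_assoc, ← mul_div_assoc, div_le_div_iff₀ hG hG']
  calc 2 * √Real.pi ^ k * Real.Gamma ((k : ℝ) / 2 + 1 + 1 / 2)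
      ≤ 2 * √Real.pi ^ k * (√((k : ℝ) / 2 + 1) * Real.Gamma ((k : ℝ) / 2 + 1)) := by gcongr
    _ = √Real.pi ^ k * Real.Gamma ((k : ℝ) / 2 + 1) * (2 * √((k : ℝ) / 2 + 1)) := by ring
    _ ≤ √Real.pi ^ k * Real.Gamma ((k : ℝ) / 2 + 1) * (√((k : ℝ) + 1) * √Real.pi) := by gcongr
    _ = _ := by ring

/-- The part of the unit ball between two parallel hyperplanes lies in a cylinder over the unit
ball of one dimension less. -/
theorem volume_slab_le (k : ℕ) {t : ℝ} (ht : 0 ≤ t) :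
    (volume : Measure (E (k + 1))).real {y | ‖y‖ < 1 ∧ |y 0| ≤ t}
      ≤ 2 * t * (volume : Measure (E k)).real (Metric.ball 0 1) := by
  let B : Set (Fin k → ℝ) := (WithLp.toLp 2) ⁻¹' (Metric.ball (0 : E k) 1)
  have hB : MeasurableSet B :=
    (PiLp.volume_preserving_toLp (Fin k)).measurable measurableSet_ball
  have hBv : volume B = volume (Metric.ball (0 : E k) 1) :=
    (PiLp.volume_preserving_toLp (Fin k)).measure_preimage measurableSet_ball.nullMeasurableSet
  have mp := (volume_preserving_piFinSuccAbove (fun _ : Fin (k + 1) => ℝ) 0).comp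
    (PiLp.volume_preserving_ofLp (Fin (k + 1)))
  have hsub : {y : E (k + 1) | ‖y‖ < 1 ∧ |y 0| ≤ t} ⊆
      ((MeasurableEquiv.piFinSuccAbove (fun _ : Fin (k + 1) => ℝ) 0) ∘ WithLp.ofLp) ⁻¹'
        (Set.Icc (-t) t ×ˢ B) := by
    rintro y ⟨hy1, hy2⟩
    refine ⟨abs_le.1 hy2, ?_⟩
    simp only [B, Set.mem_preimage, mem_ball_zero_iff]
    refine lt_of_le_of_lt ?_ hy1
    rw [EuclideanSpace.norm_eq, EuclideanSpace.norm_eq, Fin.sum_univ_succ]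
    apply Real.sqrt_le_sqrt
    have : 0 ≤ ‖y 0‖ ^ 2 := by positivity
    simpa [MeasurableEquiv.piFinSuccAbove, Fin.tail] using this
  have hvol : (volume : Measure (E (k + 1)))
      (((MeasurableEquiv.piFinSuccAbove (fun _ : Fin (k + 1) => ℝ) 0) ∘
        WithLp.ofLp) ⁻¹' (Set.Icc (-t) t ×ˢ B))
      = ENNReal.ofReal (2 * t) * volume (Metric.ball (0 : E k) 1) := by
    rw [mp.measure_preimage (measurableSet_Icc.prod hB).nullMeasurableSet,
      Measure.volume_eq_prod, Measure.prod_prod, hBv, Real.volume_Icc]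
    congr 2; ring
  have hle := measure_mono (μ := volume) hsub
  rw [hvol] at hle
  rw [measureReal_def, measureReal_def]
  refine (ENNReal.toReal_mono (by finiteness) hle).trans ?_
  rw [ENNReal.toReal_mul, ENNReal.toReal_ofReal (by positivity)]

open scoped Pointwise in
/-- Anti-concentration of one coordinate of a uniform point on the sphere. -/
theorem sphereUnif_slab_single {k : ℕ} {s : ℝ} (hs : 0 ≤ s) :
    (sphereUnif (k + 1)).real {x | |(x : E (k + 1)) 0| ≤ s / √((k + 1 : ℕ) : ℝ)} ≤ s := by
  rcases le_or_gt 1 s with h1 | h1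
  · exact measureReal_le_one.trans h1
  rcases Nat.eq_zero_or_pos k with rfl | hk
  · -- on the two-point sphere of the line the coordinate has absolute value `1`
    have : {x : Sph (0 + 1) | |(x : E (0 + 1)) 0| ≤ s / √((0 + 1 : ℕ) : ℝ)} = ∅ := by
      ext x
      have hx := x.norm_eq
      rw [EuclideanSpace.norm_eq] at hx
      simp [Real.sqrt_sq_eq_abs] at hx
      simp [hx, h1]
    rw [this]; simpa using hs
  have : NeZero k := ⟨hk.ne'⟩
  set t := s / √((k + 1 : ℕ) : ℝ) with ht
  have ht0 : 0 ≤ t := by positivity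
  have hA : MeasurableSet {x : Sph (k + 1) | |(x : E (k + 1)) 0| ≤ t} := by
    apply measurableSet_le _ measurable_const
    fun_prop
  have hB : 0 < (volume : Measure (E (k + 1))).real (Metric.ball 0 1) :=
    ENNReal.toReal_pos (Metric.measure_ball_pos _ _ one_pos).ne' measure_ball_lt_top.ne
  have hcone : Set.Ioo (0 : ℝ) 1 • ((fun x : Sph (k + 1) => (x : E (k + 1))) ''
      {x : Sph (k + 1) | |(x : E (k + 1)) 0| ≤ t}) ⊆ {y | ‖y‖ < 1 ∧ |y 0| ≤ t} := by
    rintro - ⟨a, ⟨ha0, ha1⟩, -, ⟨x, hx, rfl⟩, rfl⟩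
    refine ⟨?_, ?_⟩
    · simpa [norm_smul, abs_of_pos ha0] using ha1
    · have hx' : |(x : E (k + 1)) 0| ≤ t := hx
      simp only [PiLp.smul_apply, smul_eq_mul, abs_mul, abs_of_pos ha0]
      nlinarith [abs_nonneg ((x : E (k + 1)) 0)]
  have hfin : (volume : Measure (E (k + 1))) {y | ‖y‖ < 1 ∧ |y 0| ≤ t} ≠ ⊤ :=
    ((measure_mono fun y hy => mem_ball_zero_iff.2 hy.1).trans_lt
      (measure_ball_lt_top (x := (0 : E (k + 1))) (r := 1))).ne
  have h1 := (measureReal_mono hcone hfin).trans (volume_slab_le k ht0)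
  have h2 := two_mul_volume_ball_le k
  rw [sphereUnif, measureReal_def, Measure.smul_apply, Measure.toSphere_apply' _ hA,
    Measure.toSphere_apply_univ, smul_eq_mul, ENNReal.toReal_mul, ENNReal.toReal_inv,
    ENNReal.toReal_mul, ENNReal.toReal_mul, ← measureReal_def, ← measureReal_def]
  simp only [finrank_euclideanSpace, Fintype.card_fin, ENNReal.toReal_natCast]
  have hk1 : (0 : ℝ) < (k + 1 : ℕ) := by positivity
  rw [mul_inv, mul_mul_mul_comm, inv_mul_cancel₀ hk1.ne', one_mul, inv_mul_le_iff₀ hB]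
  refine h1.trans ?_
  calc 2 * t * (volume : Measure (E k)).real (Metric.ball 0 1)
      = t * (2 * (volume : Measure (E k)).real (Metric.ball 0 1)) := by ring
    _ ≤ t * (√((k : ℝ) + 1) * (volume : Measure (E (k + 1))).real (Metric.ball 0 1)) := by gcongr
    _ = _ := by
      rw [ht]; push_cast
      have : √((k : ℝ) + 1) ≠ 0 := by positivity
      field_simp

/-- Anti-concentration of the uniform distribution on the sphere around a hyperplane: the slab of
half-width `s / √d` has probability at most `s`. -/
theorem sphereUnif_slab {d : ℕ} [NeZero d] {n : E d} (hn : ‖n‖ = 1) {s : ℝ} (hs : 0 ≤ s) :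
    (sphereUnif d).real {x | |inner ℝ (x : E d) n| ≤ s / √(d : ℝ)} ≤ s := by
  obtain ⟨k, rfl⟩ := Nat.exists_eq_succ_of_ne_zero (NeZero.ne d)
  let I : Set ℝ := {y | |y| ≤ s / √((k + 1 : ℕ) : ℝ)}
  have hI : MeasurableSet I := measurableSet_le (by fun_prop) measurable_const
  have hφ : Measurable (I.indicator (1 : ℝ → ℝ)) := measurable_one.indicator hI
  have key : ∀ v : E (k + 1), ∫ x : Sph (k + 1), I.indicator (1 : ℝ → ℝ) (inner ℝ (x : E (k + 1)) v)
      ∂sphereUnif (k + 1)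
      = (sphereUnif (k + 1)).real {x | |inner ℝ (x : E (k + 1)) v| ≤ s / √((k + 1 : ℕ) : ℝ)} := by
    intro v
    have hm : MeasurableSet {x : Sph (k + 1) |
        |inner ℝ (x : E (k + 1)) v| ≤ s / √((k + 1 : ℕ) : ℝ)} :=
      measurableSet_le (by fun_prop) measurable_const
    rw [← integral_indicator_one hm]
    rfl
  have h := integral_inner_congr hφ (v := n) (w := EuclideanSpace.single 0 1) (by simp [hn])
  rw [key, key] at h
  refine h.le.trans ?_
  simpa [EuclideanSpace.inner_single_right] using sphereUnif_slab_single (k := k) hs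

/-! ### Smooth convex functions and metric projections -/

theorem hasDerivAt_comp_line {d : ℕ} {f : E d → ℝ} (hf : Differentiable ℝ f) (x v : E d) (t : ℝ) :
    HasDerivAt (fun t : ℝ => f (x + t • v)) (inner ℝ (gradient f (x + t • v)) v) t := by
  have h1 : HasDerivAt (fun t : ℝ => x + t • v) v t := by
    simpa using ((hasDerivAt_id t).smul_const v).const_add x
  have h2 := (hf (x + t • v)).hasGradientAt.hasFDerivAt.comp_hasDerivAt t h1
  have h3 := h2
  rw [InnerProductSpace.toDual_apply_apply] at h3
  exact h3

/-- The first-order characterisation of convexity. -/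
theorem add_inner_gradient_le {d : ℕ} {f : E d → ℝ} (hc : ConvexOn ℝ Set.univ f)
    (hf : Differentiable ℝ f) (x y : E d) : f x + inner ℝ (gradient f x) (y - x) ≤ f y := by
  have hφ : ConvexOn ℝ Set.univ (fun t : ℝ => f (x + t • (y - x))) := by
    have := hc.comp_affineMap (AffineMap.lineMap x y : ℝ →ᵃ[ℝ] E d)
    simpa [Function.comp_def, AffineMap.lineMap_apply, add_comm] using this
  have h := hφ.le_slope_of_hasDerivAt (Set.mem_univ 0) (Set.mem_univ 1) one_pos
    (hasDerivAt_comp_line hf x (y - x) 0)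
  simp only [slope, zero_smul, add_zero, one_smul, add_sub_cancel, sub_zero, inv_one, one_mul,
    vsub_eq_sub, smul_eq_mul] at h
  linarith

/-- The quadratic upper bound for a smooth function. -/
theorem IsSmooth.le_add_sq {d : ℕ} {f : E d → ℝ} {β : ℝ} (hf : IsSmooth β f) (x v : E d) :
    f (x + v) ≤ f x + inner ℝ (gradient f x) v + β / 2 * ‖v‖ ^ 2 := by
  let φ : ℝ → ℝ := fun t =>
    f (x + t • v) - (t * inner ℝ (gradient f x) v + β / 2 * ‖v‖ ^ 2 * t ^ 2)
  have hφ : ∀ t, HasDerivAt φ (inner ℝ (gradient f (x + t • v)) v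
      - (inner ℝ (gradient f x) v + β * ‖v‖ ^ 2 * t)) t := fun t => by
    have h2 := ((hasDerivAt_id t).mul_const (inner ℝ (gradient f x) v)).add
      ((hasDerivAt_pow 2 t).const_mul (β / 2 * ‖v‖ ^ 2))
    have := (hasDerivAt_comp_line hf.1 x v t).sub h2
    convert! this using 1
    simp; ring
  have hanti : AntitoneOn φ (Set.Icc 0 1) := by
    refine antitoneOn_of_deriv_nonpos (convex_Icc 0 1)
      (fun t _ => (hφ t).continuousAt.continuousWithinAt)
      (fun t _ => (hφ t).differentiableAt.differentiableWithinAt) fun t ht => ?_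
    rw [interior_Icc] at ht
    rw [(hφ t).deriv]
    have h1 := real_inner_le_norm (gradient f (x + t • v) - gradient f x) v
    rw [inner_sub_left] at h1
    have h2 := hf.2 (x + t • v) x
    rw [add_sub_cancel_left, norm_smul, Real.norm_eq_abs, abs_of_pos ht.1] at h2
    nlinarith [mul_le_mul_of_nonneg_right h2 (norm_nonneg v)]
  have := hanti (Set.left_mem_Icc.2 zero_le_one) (Set.right_mem_Icc.2 zero_le_one) zero_le_one
  simp only [φ, zero_smul, add_zero, one_smul, zero_mul, one_mul, one_pow, mul_one, ne_eq,
    OfNat.ofNat_ne_zero, not_false_eq_true, zero_pow, mul_zero, sub_zero] at this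
  linarith

/-- Within distance `M` of `w`, a smooth function deviates from its linearisation at `w` by a
function with Lipschitz constant `β M`. -/
theorem IsSmooth.abs_sub_sub_inner_le {d : ℕ} {f : E d → ℝ} {β M : ℝ} (hβ : 0 ≤ β)
    (hf : IsSmooth β f) {w x y : E d} (hx : ‖x - w‖ ≤ M) (hy : ‖y - w‖ ≤ M) :
    |f y - f x - inner ℝ (gradient f w) (y - x)| ≤ β * M * ‖y - x‖ := by
  have h := (convex_closedBall w M).norm_image_sub_le_of_norm_hasFDerivWithin_le' (f := f)
    (f' := fun z => InnerProductSpace.toDual ℝ (E d) (gradient f z))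
    (φ := InnerProductSpace.toDual ℝ (E d) (gradient f w)) (C := β * M) (x := x) (y := y)
    (fun z _ => (hf.1 z).hasGradientAt.hasFDerivAt.hasFDerivWithinAt)
    (fun z hz => by
      rw [← map_sub, LinearIsometryEquiv.norm_map]
      exact (hf.2 z w).trans
        (mul_le_mul_of_nonneg_left (by simpa [dist_eq_norm] using hz) hβ))
    (by simpa [dist_eq_norm] using hx) (by simpa [dist_eq_norm] using hy)
  simpa using h

section Minimiser

variable {d : ℕ} {f : E d → ℝ} {β : ℝ} {xs : E d}

theorem gradient_eq_zero_of_forall_le (hmin : ∀ x, f xs ≤ f x) : gradient f xs = 0 := by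
  have h : IsLocalMin f xs := Filter.Eventually.of_forall hmin
  simp [gradient, h.fderiv_eq_zero]

theorem IsSmooth.sub_min_le (hf : IsSmooth β f) (hmin : ∀ x, f xs ≤ f x) (w : E d) :
    f w - f xs ≤ β / 2 * ‖w - xs‖ ^ 2 := by
  have h := hf.le_add_sq xs (w - xs)
  rw [gradient_eq_zero_of_forall_le hmin, inner_zero_left, add_sub_cancel] at h
  linarith

theorem sub_min_le_inner (hc : ConvexOn ℝ Set.univ f) (hf : Differentiable ℝ f) (w : E d) :
    f w - f xs ≤ inner ℝ (gradient f w) (w - xs) := by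
  have h := add_inner_gradient_le hc hf w xs
  rw [← neg_sub w xs, inner_neg_right] at h
  linarith

/-- The gain of a normalised gradient step: the sublevel set of `f` at level `f w` contains the
ball of radius `√(2 Δ / β)` around the minimiser, and the gradient at `w` supports it. -/
theorem IsSmooth.sqrt_le_inner (hc : ConvexOn ℝ Set.univ f) (hβ : 0 < β) (hf : IsSmooth β f)
    (hmin : ∀ x, f xs ≤ f x) (w : E d) (hG : gradient f w ≠ 0) :
    √(2 * (f w - f xs) / β) ≤ inner ℝ (‖gradient f w‖⁻¹ • gradient f w) (w - xs) := by
  set n := ‖gradient f w‖⁻¹ • gradient f w with hn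
  set s := √(2 * (f w - f xs) / β) with hs
  have hGn : 0 < ‖gradient f w‖ := norm_pos_iff.2 hG
  have hn1 : ‖n‖ = 1 := by simp [hn, norm_smul, hG]
  have hs2 : s ^ 2 = 2 * (f w - f xs) / β :=
    Real.sq_sqrt (div_nonneg (by linarith [hmin w]) hβ.le)
  have h1 := hf.sub_min_le hmin (xs + s • n)
  rw [add_sub_cancel_left, norm_smul, hn1, mul_one, Real.norm_eq_abs, sq_abs, hs2] at h1
  have h2 := add_inner_gradient_le hc hf.1 w (xs + s • n)
  have h3 : f (xs + s • n) ≤ f w := by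
    have : β / 2 * (2 * (f w - f xs) / β) = f w - f xs := by field_simp
    linarith
  have h4 : inner ℝ (gradient f w) (xs + s • n - w) ≤ 0 := by linarith
  have h5 : inner ℝ n (xs + s • n - w) ≤ 0 := by
    rw [hn, real_inner_smul_left]
    exact mul_nonpos_of_nonneg_of_nonpos (by positivity) h4
  have h6 : xs + s • n - w = s • n - (w - xs) := by abel
  rw [h6, inner_sub_right, inner_smul_right, real_inner_self_eq_norm_sq, hn1] at h5
  linarith

end Minimiser

section Projection

variable {d : ℕ} {K : Set (E d)}

theorem exists_forall_norm_sub_le (hK : IsClosed K) (hne : K.Nonempty) (x : E d) :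
    ∃ p ∈ K, ∀ y ∈ K, ‖p - x‖ ≤ ‖y - x‖ := by
  obtain ⟨p, hp, h⟩ := hK.exists_infDist_eq_dist hne x
  refine ⟨p, hp, fun y hy => ?_⟩
  rw [← dist_eq_norm, ← dist_eq_norm, dist_comm p, dist_comm y, ← h]
  exact Metric.infDist_le_dist_of_mem hy

theorem proj_spec (hK : IsClosed K) (hne : K.Nonempty) (x : E d) :
    proj K x ∈ K ∧ ∀ y ∈ K, ‖proj K x - x‖ ≤ ‖y - x‖ := by
  have h := exists_forall_norm_sub_le hK hne x
  rw [proj, dif_pos h]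
  exact h.choose_spec

theorem inner_sub_proj_le (hK : IsClosed K) (hc : Convex ℝ K) {y : E d} (hy : y ∈ K) (x : E d) :
    inner ℝ (x - proj K x) (y - proj K x) ≤ 0 := by
  obtain ⟨h1, h2⟩ := proj_spec hK ⟨y, hy⟩ x
  refine (norm_eq_iInf_iff_real_inner_le_zero hc h1).1 (le_antisymm ?_ ?_) y hy
  · have : Nonempty K := ⟨⟨y, hy⟩⟩
    exact le_ciInf fun z => by
      rw [norm_sub_rev x, norm_sub_rev x]; exact h2 z z.2
  · exact ciInf_le ⟨0, by rintro - ⟨z, rfl⟩; exact norm_nonneg _⟩ (⟨proj K x, h1⟩ : K)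

theorem norm_proj_sub_proj_le (hK : IsClosed K) (hc : Convex ℝ K) (hne : K.Nonempty) (x y : E d) :
    ‖proj K x - proj K y‖ ≤ ‖x - y‖ := by
  have hx := inner_sub_proj_le hK hc (proj_spec hK hne y).1 x
  have hy := inner_sub_proj_le hK hc (proj_spec hK hne x).1 y
  set p := proj K x
  set q := proj K y
  have h : ‖p - q‖ ^ 2 ≤ ‖x - y‖ * ‖p - q‖ := by
    refine le_trans ?_ (real_inner_le_norm (x - y) (p - q))
    rw [← real_inner_self_eq_norm_sq]
    have e1 : inner ℝ (x - p) (q - p) = -inner ℝ (x - p) (p - q) := by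
      rw [← neg_sub p q, inner_neg_right]
    have e2 : inner ℝ (x - y) (p - q)
        = inner ℝ (x - p) (p - q) + inner ℝ (p - q) (p - q) - inner ℝ (y - q) (p - q) := by
      rw [← inner_add_left, ← inner_sub_left]; congr 1; abel
    linarith
  rcases (norm_nonneg (p - q)).eq_or_lt with h0 | h0
  · rw [← h0]; exact norm_nonneg _
  · nlinarith

theorem proj_eq_self (hK : IsClosed K) {y : E d} (hy : y ∈ K) : proj K y = y := by
  have h := (proj_spec hK ⟨y, hy⟩ y).2 y hy
  rw [sub_self, norm_zero] at h
  exact sub_eq_zero.1 (norm_le_zero_iff.1 h)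

theorem norm_proj_sub_le (hK : IsClosed K) (hc : Convex ℝ K) {y : E d} (hy : y ∈ K) (x : E d) :
    ‖proj K x - y‖ ≤ ‖x - y‖ := by
  simpa [proj_eq_self hK hy] using norm_proj_sub_proj_le hK hc ⟨y, hy⟩ x y

theorem measurable_proj (hK : IsClosed K) (hc : Convex ℝ K) (hne : K.Nonempty) :
    Measurable (proj K) :=
  (LipschitzWith.of_dist_le_mul (K := 1) fun x y => by
    simpa [dist_eq_norm] using norm_proj_sub_proj_le hK hc hne x y).continuous.measurable

end Projection

/-! ### Oriented uniform directions -/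

/-- Fubini for independent random variables: the second one may be integrated out first, over an
independent copy of the sample space. -/
theorem _root_.ProbabilityTheory.IndepFun.integral_eq_integral_integral {Ω A B : Type*}
    [MeasurableSpace Ω] [MeasurableSpace A] [MeasurableSpace B] {P : Measure Ω}
    [IsProbabilityMeasure P] {X : Ω → A} {Y : Ω → B} (hXY : IndepFun X Y P) (hX : Measurable X)
    (hY : Measurable Y) {F : A → B → ℝ} (hF : Measurable (Function.uncurry F))
    (hI : Integrable (fun ω => F (X ω) (Y ω)) P) :
    ∫ ω, F (X ω) (Y ω) ∂P = ∫ ω, ∫ ω', F (X ω) (Y ω') ∂P ∂P := by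
  have hmap := hXY.map_prod_eq_prod_map_map hX.aemeasurable hY.aemeasurable
  have : IsProbabilityMeasure (P.map X) := Measure.isProbabilityMeasure_map hX.aemeasurable
  have : IsProbabilityMeasure (P.map Y) := Measure.isProbabilityMeasure_map hY.aemeasurable
  have hXYm : Measurable fun ω => (X ω, Y ω) := hX.prodMk hY
  have hI' : Integrable (Function.uncurry F) ((P.map X).prod (P.map Y)) := by
    rw [← hmap, integrable_map_measure hF.aestronglyMeasurable hXYm.aemeasurable]
    exact hI
  have h1 : ∫ ω, F (X ω) (Y ω) ∂P = ∫ p, Function.uncurry F p ∂((P.map X).prod (P.map Y)) := by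
    rw [← hmap, integral_map hXYm.aemeasurable hF.aestronglyMeasurable]
    rfl
  rw [h1, integral_prod _ hI', integral_map hX.aemeasurable
    hF.stronglyMeasurable.integral_prod_right'.aestronglyMeasurable]
  congr 1; ext ω
  exact integral_map hY.aemeasurable (hF.comp measurable_prodMk_left).aestronglyMeasurable

/-- The direction `± x` with nonnegative inner product with `n`. -/
noncomputable def orient {d : ℕ} (n : E d) (x : Sph d) : E d := sgn (inner ℝ (x : E d) n) • (x : E d)

theorem measurable_orient {d : ℕ} (n : E d) : Measurable (orient n) := by
  have := measurable_sgn
  unfold orient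
  fun_prop

theorem norm_orient {d : ℕ} (n : E d) (x : Sph d) : ‖orient n x‖ = 1 := by
  rw [orient, norm_smul, Real.norm_eq_abs, abs_sgn, x.norm_eq, one_mul]

theorem integral_inner_orient {d : ℕ} [NeZero d] {n : E d} (hn : ‖n‖ = 1) (b : E d) :
    ∫ x, inner ℝ b (orient n x) ∂sphereUnif d = cConst d / √d * inner ℝ n b := by
  rw [← integral_sgn_inner hn b]
  congr 1; ext x
  rw [orient, inner_smul_right, real_inner_comm b]

theorem integral_inner_orient_sq {d : ℕ} [NeZero d] (n : E d) (b : E d) :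
    ∫ x, (inner ℝ b (orient n x)) ^ 2 ∂sphereUnif d = ‖b‖ ^ 2 / d := by
  rw [← integral_inner_sq b]
  congr 1; ext x
  rw [orient, inner_smul_right, real_inner_comm b, mul_pow, ← sq_abs (sgn _), abs_sgn, one_pow,
    one_mul]

theorem integrable_inner_orient_pow {d : ℕ} [NeZero d] (n b : E d) (k : ℕ) :
    Integrable (fun x => (inner ℝ b (orient n x)) ^ k) (sphereUnif d) := by
  have := measurable_orient n
  refine integrable_of_bdd (by fun_prop) (‖b‖ ^ k) fun x => ?_
  rw [abs_pow]
  refine pow_le_pow_left₀ (abs_nonneg _) ?_ k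
  simpa [norm_orient] using abs_real_inner_le_norm b (orient n x)

theorem integrable_inner_orient {d : ℕ} [NeZero d] (n b : E d) :
    Integrable (fun x => inner ℝ b (orient n x)) (sphereUnif d) := by
  simpa using integrable_inner_orient_pow n b 1

theorem integral_inner_orient_le {d : ℕ} [NeZero d] {n : E d} (hn : ‖n‖ = 1) (p : E d) :
    ∫ x, inner ℝ p (orient n x) ∂sphereUnif d ≤ ‖p‖ / √d := by
  have hd : (0 : ℝ) < √d := Real.sqrt_pos.2 (by exact_mod_cast NeZero.pos d)
  rw [integral_inner_orient hn, div_mul_eq_mul_div]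
  gcongr
  have h1 := real_inner_le_norm n p
  rw [hn, one_mul] at h1
  nlinarith [cConst_le_one d, half_le_cConst d, norm_nonneg p]

/-- Young's inequality splits the drift `2 ‖p‖ / √d` of the squared norm into `‖p‖² / (2 d)`, harmless
over at most `d` steps, and a constant. -/
theorem integral_norm_add_orient_sq_le {d : ℕ} [NeZero d] {n : E d} (hn : ‖n‖ = 1) (p : E d) :
    ∫ x, ‖p + orient n x‖ ^ 2 ∂sphereUnif d ≤ (1 + 1 / (2 * d)) * ‖p‖ ^ 2 + 3 := by
  have hd : (0 : ℝ) < d := by exact_mod_cast NeZero.pos d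
  have h : ∀ x, ‖p + orient n x‖ ^ 2 = (‖p‖ ^ 2 + 1) + 2 * inner ℝ p (orient n x) := fun x => by
    rw [norm_add_sq_real, norm_orient]; ring
  simp only [h]
  rw [integral_add (integrable_const _) ((integrable_inner_orient n p).const_mul 2),
    integral_const_mul]
  have h1 := integral_inner_orient_le hn p
  simp only [integral_const, probReal_univ, smul_eq_mul, one_mul]
  have h2 : 2 * (‖p‖ / √d) ≤ ‖p‖ ^ 2 / (2 * d) + 2 := by
    have h3 : (‖p‖ / √d) ^ 2 = ‖p‖ ^ 2 / d := by rw [div_pow, Real.sq_sqrt hd.le]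
    have h4 : ‖p‖ ^ 2 / (2 * d) = (‖p‖ / √d) ^ 2 / 2 := by rw [h3]; field_simp
    rw [h4]
    nlinarith [sq_nonneg (‖p‖ / √d - 2)]
  calc _ ≤ ‖p‖ ^ 2 + 1 + (‖p‖ ^ 2 / (2 * d) + 2) := by linarith
    _ = _ := by ring

theorem integral_norm_add_orient_pow_four_le {d : ℕ} [NeZero d] {n : E d} (hn : ‖n‖ = 1)
    (p : E d) :
    ∫ x, ‖p + orient n x‖ ^ 4 ∂sphereUnif d ≤ (1 + 1 / d) * ‖p‖ ^ 4 + 11 * ‖p‖ ^ 2 + 5 := by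
  have hd : (1 : ℝ) ≤ d := by exact_mod_cast NeZero.one_le
  have h : ∀ x, ‖p + orient n x‖ ^ 4 = (‖p‖ ^ 2 + 1) ^ 2
      + 4 * (‖p‖ ^ 2 + 1) * inner ℝ p (orient n x) + 4 * (inner ℝ p (orient n x)) ^ 2 :=
    fun x => by
      rw [show ‖p + orient n x‖ ^ 4 = (‖p + orient n x‖ ^ 2) ^ 2 by ring, norm_add_sq_real,
        norm_orient]
      ring
  simp only [h]
  have i1 := (integrable_inner_orient n p).const_mul (4 * (‖p‖ ^ 2 + 1))
  have i2 := (integrable_inner_orient_pow n p 2).const_mul 4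
  have i3 : Integrable (fun x => (‖p‖ ^ 2 + 1) ^ 2 + 4 * (‖p‖ ^ 2 + 1) * inner ℝ p (orient n x))
    (sphereUnif d) := (integrable_const _).add i1
  rw [integral_add i3 i2, integral_add (integrable_const _) i1,
    integral_const_mul, integral_const_mul, integral_inner_orient_sq]
  have h1 := integral_inner_orient_le hn p
  simp only [integral_const, probReal_univ, smul_eq_mul, one_mul]
  set y := ‖p‖ / √d with hy
  have hy2 : ‖p‖ ^ 2 / d = y ^ 2 := by rw [hy, div_pow, Real.sq_sqrt (by linarith)]
  have hyp : y ^ 2 ≤ ‖p‖ ^ 2 := by rw [← hy2]; exact div_le_self (by positivity) hd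
  have h4 : (1 + 1 / (d : ℝ)) * ‖p‖ ^ 4 = ‖p‖ ^ 4 + ‖p‖ ^ 2 * y ^ 2 := by rw [← hy2]; ring
  have h5 : 4 * (‖p‖ ^ 2 + 1) * ∫ x, inner ℝ p (orient n x) ∂sphereUnif d
      ≤ 4 * (‖p‖ ^ 2 + 1) * y := by gcongr
  rw [hy2, h4]
  nlinarith [mul_nonneg (sq_nonneg ‖p‖) (sq_nonneg (y - 2)), sq_nonneg (y - 2)]

/-- The directions of one round, as points of the unit sphere. -/
abbrev Dirs (d ℓ : ℕ) : Type := Fin ℓ → Sph d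

/-- The law of `ℓ` independent uniform directions. -/
noncomputable def dirMeas (d ℓ : ℕ) : Measure (Dirs d ℓ) := Measure.pi fun _ => sphereUnif d

instance (d ℓ : ℕ) [NeZero d] : IsProbabilityMeasure (dirMeas d ℓ) := by
  unfold dirMeas; infer_instance

theorem integral_dirMeas_eval {d ℓ : ℕ} [NeZero d] (i : Fin ℓ) {F : Sph d → ℝ}
    (hF : Measurable F) : ∫ U, F (U i) ∂dirMeas d ℓ = ∫ x, F x ∂sphereUnif d :=
  integral_comp_eval (μ := fun _ : Fin ℓ => sphereUnif d) hF.aestronglyMeasurable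

theorem iIndepFun_dirMeas {d ℓ : ℕ} [NeZero d] {A : Type*} [MeasurableSpace A] {φ : Sph d → A}
    (hφ : Measurable φ) : iIndepFun (fun i U => φ (U i)) (dirMeas d ℓ) :=
  iIndepFun_pi fun _ => hφ.aemeasurable

theorem integral_inner_orient_orient {d ℓ : ℕ} [NeZero d] {n : E d} (hn : ‖n‖ = 1)
    {i j : Fin ℓ} (hij : i ≠ j) :
    ∫ U, inner ℝ (orient n (U i)) (orient n (U j)) ∂dirMeas d ℓ = cConst d ^ 2 / d := by
  have ho := measurable_orient n
  have hd : (0 : ℝ) < d := by exact_mod_cast NeZero.pos d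
  have hind := (iIndepFun_dirMeas (ℓ := ℓ) ho).indepFun hij
  rw [hind.integral_eq_integral_integral (F := fun a b => inner ℝ a b) (by fun_prop) (by fun_prop)
    (by fun_prop)]
  · have h1 : ∀ U : Dirs d ℓ, ∫ U', inner ℝ (orient n (U i)) (orient n (U' j)) ∂dirMeas d ℓ
        = cConst d / √d * inner ℝ n (orient n (U i)) := fun U => by
      rw [integral_dirMeas_eval j (F := fun x => inner ℝ (orient n (U i)) (orient n x))
        (by fun_prop), integral_inner_orient hn]
    simp only [h1]
    rw [integral_const_mul, integral_dirMeas_eval i (F := fun x => inner ℝ n (orient n x))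
      (by fun_prop), integral_inner_orient hn, real_inner_self_eq_norm_sq, hn]
    rw [one_pow, mul_one, div_mul_div_comm, Real.mul_self_sqrt hd.le, sq]
  · refine integrable_of_bdd (by fun_prop) 1 fun U => ?_
    simpa [norm_orient] using abs_real_inner_le_norm (orient n (U i)) (orient n (U j))

theorem norm_sum_orient_le {d ℓ : ℕ} (n : E d) (s : Finset (Fin ℓ)) (U : Dirs d ℓ) :
    ‖∑ j ∈ s, orient n (U j)‖ ≤ s.card := by
  refine (norm_sum_le _ _).trans ?_
  simp [norm_orient]

theorem integrable_norm_sum_orient_pow {d ℓ : ℕ} [NeZero d] (n : E d) (s : Finset (Fin ℓ)) (k : ℕ) :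
    Integrable (fun U : Dirs d ℓ => ‖∑ j ∈ s, orient n (U j)‖ ^ k) (dirMeas d ℓ) := by
  have ho := measurable_orient n
  refine integrable_of_bdd (by fun_prop) ((s.card : ℝ) ^ k) fun U => ?_
  rw [abs_of_nonneg (by positivity)]
  exact pow_le_pow_left₀ (norm_nonneg _) (norm_sum_orient_le n s U) k

/-- Adding one more independent oriented direction to a partial sum. -/
theorem integral_norm_sum_insert {d ℓ : ℕ} [NeZero d] (n : E d) {s : Finset (Fin ℓ)} {i : Fin ℓ}
    (hi : i ∉ s) (k : ℕ) :
    ∫ U, ‖∑ j ∈ insert i s, orient n (U j)‖ ^ k ∂dirMeas d ℓ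
      = ∫ U, ∫ x, ‖(∑ j ∈ s, orient n (U j)) + orient n x‖ ^ k ∂sphereUnif d ∂dirMeas d ℓ := by
  have ho := measurable_orient n
  have hind := (iIndepFun_dirMeas (ℓ := ℓ) ho).indepFun_finsetSum_of_notMem
    (fun i => by fun_prop) hi
  have hs : (∑ j ∈ s, fun U : Dirs d ℓ => orient n (U j)) = fun U => ∑ j ∈ s, orient n (U j) := by
    ext1 U; simp
  rw [hs] at hind
  have h0 : ∀ U : Dirs d ℓ, ∑ j ∈ insert i s, orient n (U j)
      = (∑ j ∈ s, orient n (U j)) + orient n (U i) := fun U => by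
    rw [Finset.sum_insert hi, add_comm]
  have hI := integrable_norm_sum_orient_pow n (insert i s) k
  simp only [h0] at hI ⊢
  rw [hind.integral_eq_integral_integral (F := fun a b => ‖a + b‖ ^ k) (by fun_prop) (by fun_prop)
    (by fun_prop) hI]
  congr 1; ext U
  exact integral_dirMeas_eval i (F := fun x => ‖(∑ j ∈ s, orient n (U j)) + orient n x‖ ^ k)
    (by fun_prop)

theorem integrable_integral_norm_sum_add {d ℓ : ℕ} [NeZero d] (n : E d) (s : Finset (Fin ℓ))
    (k : ℕ) : Integrable (fun U : Dirs d ℓ =>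
      ∫ x, ‖(∑ j ∈ s, orient n (U j)) + orient n x‖ ^ k ∂sphereUnif d) (dirMeas d ℓ) := by
  have ho := measurable_orient n
  have hm : Measurable (fun p : Dirs d ℓ × Sph d =>
    ‖(∑ j ∈ s, orient n (p.1 j)) + orient n p.2‖ ^ k) := by fun_prop
  have hb : ∀ (U : Dirs d ℓ) (x : Sph d),
      ‖‖(∑ j ∈ s, orient n (U j)) + orient n x‖ ^ k‖ ≤ ((s.card : ℝ) + 1) ^ k := fun U x => by
    rw [norm_pow, norm_norm]
    refine pow_le_pow_left₀ (norm_nonneg _) ((norm_add_le _ _).trans ?_) k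
    rw [norm_orient]
    linarith [norm_sum_orient_le n s U]
  refine Integrable.of_bound hm.stronglyMeasurable.integral_prod_right'.aestronglyMeasurable
    (((s.card : ℝ) + 1) ^ k) (Filter.Eventually.of_forall fun U => ?_)
  refine (norm_integral_le_of_norm_le_const (Filter.Eventually.of_forall (hb U))).trans ?_
  simp

theorem integral_norm_sum_orient_sq_le {d ℓ : ℕ} [NeZero d] (hℓ : ℓ ≤ d) {n : E d} (hn : ‖n‖ = 1)
    (s : Finset (Fin ℓ)) :
    ∫ U, ‖∑ j ∈ s, orient n (U j)‖ ^ 2 ∂dirMeas d ℓ ≤ 6 * s.card := by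
  have hd : (0 : ℝ) < d := by exact_mod_cast NeZero.pos d
  induction s using Finset.induction with
  | empty => simp
  | insert i s hi ih =>
    have hI := integrable_norm_sum_orient_pow n s 2
    rw [integral_norm_sum_insert n hi]
    refine (integral_mono (integrable_integral_norm_sum_add n s 2)
      ((hI.const_mul _).add (integrable_const _))
      fun U => integral_norm_add_orient_sq_le hn _).trans ?_
    rw [integral_add' (hI.const_mul _) (integrable_const _), integral_const_mul,
      Finset.card_insert_of_notMem hi]
    have hs : (s.card : ℝ) ≤ d := by
      exact_mod_cast ((Finset.card_le_univ s).trans (by simp)).trans hℓ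
    simp only [integral_const, probReal_univ, smul_eq_mul, one_mul, Nat.cast_add, Nat.cast_one]
    have : (1 + 1 / (2 * (d : ℝ))) * (6 * s.card) ≤ 6 * s.card + 3 := by
      have : 1 / (2 * (d : ℝ)) * (6 * s.card) ≤ 3 := by
        rw [one_div_mul_eq_div, div_le_iff₀ (by positivity)]; linarith
      linarith
    have h2 := mul_le_mul_of_nonneg_left ih (show 0 ≤ 1 + 1 / (2 * (d : ℝ)) by positivity)
    linarith

/-- The fourth moment of a sum of at most `d` independent oriented directions is of the order it
would have without drift, as the drift of each summand is at most `1 / √d`. -/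
theorem integral_norm_sum_orient_pow_four_le {d ℓ : ℕ} [NeZero d] (hℓ : ℓ ≤ d) {n : E d}
    (hn : ‖n‖ = 1) (s : Finset (Fin ℓ)) :
    ∫ U, ‖∑ j ∈ s, orient n (U j)‖ ^ 4 ∂dirMeas d ℓ ≤ 72 * (s.card : ℝ) ^ 2 := by
  have hd : (0 : ℝ) < d := by exact_mod_cast NeZero.pos d
  induction s using Finset.induction with
  | empty => simp
  | insert i s hi ih =>
    have hI := integrable_norm_sum_orient_pow n s 2
    have hI4 := integrable_norm_sum_orient_pow n s 4
    rw [integral_norm_sum_insert n hi]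
    refine (integral_mono (integrable_integral_norm_sum_add n s 4)
      (((hI4.const_mul _).add (hI.const_mul _)).add (integrable_const _))
      fun U => integral_norm_add_orient_pow_four_le hn _).trans ?_
    have h6 := integral_norm_sum_orient_sq_le hℓ hn s
    rw [integral_add' ((hI4.const_mul _).add (hI.const_mul _)) (integrable_const _),
      integral_add' (hI4.const_mul _) (hI.const_mul _), integral_const_mul, integral_const_mul,
      Finset.card_insert_of_notMem hi]
    have hs : (s.card : ℝ) ≤ d := by
      exact_mod_cast ((Finset.card_le_univ s).trans (by simp)).trans hℓ
    simp only [integral_const, probReal_univ, smul_eq_mul, one_mul, Nat.cast_add, Nat.cast_one]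
    have h1 : 1 / (d : ℝ) * (72 * (s.card : ℝ) ^ 2) ≤ 72 * s.card := by
      rw [one_div_mul_eq_div, div_le_iff₀ hd]
      nlinarith [Nat.cast_nonneg (α := ℝ) s.card]
    have h2 := mul_le_mul_of_nonneg_left ih (show 0 ≤ 1 + 1 / (d : ℝ) by positivity)
    nlinarith [Nat.cast_nonneg (α := ℝ) s.card]

/-! ### The gradient estimates of one round -/

theorem coord_eq_or {ℓ : ℕ} (v : Cube ℓ) (i : Fin ℓ) : coord v i = 1 ∨ coord v i = -1 := by
  rcases Int.units_eq_one_or (v i) with h | h <;> simp [coord, h]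

theorem abs_coord {ℓ : ℕ} (v : Cube ℓ) (i : Fin ℓ) : |coord v i| = 1 := by
  rcases coord_eq_or v i with h | h <;> simp [h]

theorem sgn_eq_or (x : ℝ) : sgn x = 1 ∨ sgn x = -1 := by
  unfold sgn; split_ifs <;> simp

theorem querySet_sub_flipSign {d ℓ : ℕ} (γ : ℝ) (w : E d) (a : Fin ℓ → E d) (v : Cube ℓ)
    (i : Fin ℓ) :
    querySet γ w a v - querySet γ w a (flipSign v i) = (2 * γ * coord v i) • a i := by
  have h : ∑ j, coord v j • a j - ∑ j, coord (flipSign v i) j • a j = (2 * coord v i) • a i := by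
    rw [← Finset.sum_sub_distrib, Finset.sum_eq_single i]
    · rw [← sub_smul]; congr 1; simp [coord, flipSign]; ring
    · intro j _ hj
      simp [coord, flipSign, hj]
    · simp
  rw [querySet, querySet, add_sub_add_left_eq_sub, ← smul_sub, h, smul_smul]
  congr 1; ring

/-- The queried directions: unit directions rescaled to length `1 / √ℓ`. -/
noncomputable def scaledDirs {d ℓ : ℕ} (U : Dirs d ℓ) (i : Fin ℓ) : E d :=
  (1 / √(ℓ : ℝ)) • (U i : E d)

/-- The `i`-th gradient estimate of a round with centre `w` and unit directions `U`. -/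
noncomputable def est {d ℓ : ℕ} (win : (Cube ℓ → E d) → Cube ℓ) (γ : ℝ) (w : E d) (U : Dirs d ℓ)
    (i : Fin ℓ) : E d :=
  gradEst (scaledDirs U) (win (querySet γ w (scaledDirs U))) i

/-- The averaged gradient estimate of a round. -/
noncomputable def estMean {d ℓ : ℕ} (win : (Cube ℓ → E d) → Cube ℓ) (γ : ℝ) (w : E d)
    (U : Dirs d ℓ) : E d :=
  (1 / (ℓ : ℝ)) • ∑ i, est win γ w U i

section Algebra

variable {d ℓ : ℕ} [NeZero ℓ] (win : (Cube ℓ → E d) → Cube ℓ) (γ : ℝ) (w : E d) (U : Dirs d ℓ)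

theorem sqrt_natCast_pos : 0 < √(ℓ : ℝ) := Real.sqrt_pos.2 (by exact_mod_cast NeZero.pos ℓ)

theorem est_eq (i : Fin ℓ) :
    est win γ w U i = -(coord (win (querySet γ w (scaledDirs U))) i • (U i : E d)) := by
  have h := (sqrt_natCast_pos (ℓ := ℓ)).ne'
  rw [est, gradEst, scaledDirs, smul_smul (√(ℓ : ℝ)), mul_one_div_cancel h, one_smul]

theorem norm_est (i : Fin ℓ) : ‖est win γ w U i‖ = 1 := by
  rw [est_eq, norm_neg, norm_smul, Real.norm_eq_abs, abs_coord, Sph.norm_eq, one_mul]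

theorem norm_estMean_le : ‖estMean win γ w U‖ ≤ 1 := by
  have hℓ : (0 : ℝ) < ℓ := by exact_mod_cast NeZero.pos ℓ
  rw [estMean, norm_smul, Real.norm_eq_abs, abs_of_pos (by positivity), one_div,
    inv_mul_le_iff₀ hℓ]
  refine (norm_sum_le _ _).trans ?_
  simp [norm_est]

theorem norm_querySet_sub_le (hγ : 0 ≤ γ) (v : Cube ℓ) :
    ‖querySet γ w (scaledDirs U) v - w‖ ≤ γ * √(ℓ : ℝ) := by
  have hs := sqrt_natCast_pos (ℓ := ℓ)
  rw [querySet, add_sub_cancel_left, norm_smul, Real.norm_eq_abs, abs_of_nonneg hγ]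
  gcongr
  refine (norm_sum_le _ _).trans ?_
  have : ∀ i, ‖coord v i • scaledDirs U i‖ = 1 / √(ℓ : ℝ) := fun i => by
    rw [scaledDirs, norm_smul, norm_smul, Real.norm_eq_abs, abs_coord, Sph.norm_eq, Real.norm_eq_abs,
      abs_of_pos (by positivity)]
    ring
  simp only [this, Finset.sum_const, Finset.card_univ, Fintype.card_fin, nsmul_eq_mul]
  rw [mul_one_div, Real.div_sqrt]

variable {win γ w U}

/-- An estimate with the wrong sign forces its direction to be almost orthogonal to the gradient:
the comparison of the two neighbouring query points differs from the sign of the directional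
derivative only if the latter is dominated by the curvature. -/
theorem abs_inner_le_of_est_ne {f : E d → ℝ} {β : ℝ} (hβ : 0 ≤ β) (hf : IsSmooth β f)
    (hwin : IsWinnerOracle f win) (hγ : 0 < γ) (hG : gradient f w ≠ 0) {i : Fin ℓ}
    (hne : est win γ w U i ≠ orient (‖gradient f w‖⁻¹ • gradient f w) (U i)) :
    |inner ℝ (U i : E d) (‖gradient f w‖⁻¹ • gradient f w)|
      ≤ β * γ * √(ℓ : ℝ) / ‖gradient f w‖ := by
  have hs := sqrt_natCast_pos (ℓ := ℓ)
  have hGn : 0 < ‖gradient f w‖ := norm_pos_iff.2 hG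
  set n := ‖gradient f w‖⁻¹ • gradient f w with hn
  set X := querySet γ w (scaledDirs U) with hX
  set v := win X with hv
  have hest := est_eq win γ w U i
  rw [← hX, ← hv] at hest
  have hco : coord v i = sgn (inner ℝ (U i : E d) n) := by
    rcases coord_eq_or v i with h1 | h1 <;>
      rcases sgn_eq_or (inner ℝ (U i : E d) n) with h2 | h2 <;>
      first
      | exact h1.trans h2.symm
      | exact absurd (by rw [hest, orient, h1, h2]; simp) hne
  have hmin := hwin.isMin X (flipSign v i)
  have hdiff : X (flipSign v i) - X v = -((2 * γ * coord v i / √(ℓ : ℝ)) • (U i : E d)) := by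
    rw [← neg_sub, hX, querySet_sub_flipSign, scaledDirs, smul_smul, mul_one_div]
  have hnorm : ‖X (flipSign v i) - X v‖ = 2 * γ / √(ℓ : ℝ) := by
    rw [hdiff, norm_neg, norm_smul, Sph.norm_eq, mul_one, Real.norm_eq_abs, abs_div, abs_mul,
      abs_coord, abs_of_pos hs, abs_of_pos (by positivity), mul_one]
  have h := (abs_le.1 (hf.abs_sub_sub_inner_le hβ
    (norm_querySet_sub_le γ w U hγ.le v) (norm_querySet_sub_le γ w U hγ.le (flipSign v i)))).2
  rw [← hX, hnorm, hdiff, inner_neg_right, inner_smul_right] at h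
  have hGi : inner ℝ (gradient f w) (U i : E d)
      = ‖gradient f w‖ * inner ℝ (U i : E d) n := by
    rw [hn, inner_smul_right, real_inner_comm, mul_inv_cancel_left₀ hGn.ne']
  have habs := sgn_mul_self (inner ℝ (U i : E d) n)
  rw [← hco] at habs
  have e1 : 2 * γ * coord v i / √(ℓ : ℝ) * inner ℝ (gradient f w) (U i : E d)
      = 2 * γ * ‖gradient f w‖ / √(ℓ : ℝ) * |inner ℝ (U i : E d) n| := by
    rw [hGi, ← habs]; ring
  have e2 : β * (γ * √(ℓ : ℝ)) * (2 * γ / √(ℓ : ℝ)) = 2 * γ * (β * γ) := by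
    field_simp
  rw [e1, e2] at h
  have h3 : 2 * γ * ‖gradient f w‖ / √(ℓ : ℝ) * |inner ℝ (U i : E d) n| ≤ 2 * γ * (β * γ) := by
    linarith
  have e3 : 2 * γ * ‖gradient f w‖ / √(ℓ : ℝ) * |inner ℝ (U i : E d) n|
      = 2 * γ * (‖gradient f w‖ / √(ℓ : ℝ) * |inner ℝ (U i : E d) n|) := by ring
  rw [e3] at h3
  have h4 := le_of_mul_le_mul_left h3 (by positivity)
  rw [le_div_iff₀ hGn]
  rw [div_mul_eq_mul_div, div_le_iff₀ hs] at h4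
  linarith

end Algebra

section Measurability

variable {d ℓ : ℕ} {f : E d → ℝ} {win : (Cube ℓ → E d) → Cube ℓ}

/-- A winner oracle may be used in a measurable construction. -/
theorem IsWinnerOracle.measurable_comp (hwin : IsWinnerOracle f win) {A B : Type*}
    [MeasurableSpace A] [MeasurableSpace B] {X : A → Cube ℓ → E d} (hX : Measurable X)
    {G : Cube ℓ → A → B} (hG : ∀ v, Measurable (G v)) : Measurable fun a => G (win (X a)) a := by
  intro s hs
  have : (fun a => G (win (X a)) a) ⁻¹' s
      = ⋃ v : Cube ℓ, (X ⁻¹' {Y | win Y = v}) ∩ (G v ⁻¹' s) := by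
    ext a; simp
  rw [this]
  exact MeasurableSet.iUnion fun v => (hX (hwin.measurableSet v)).inter (hG v hs)

theorem measurable_scaledDirs : Measurable (scaledDirs : Dirs d ℓ → Fin ℓ → E d) := by
  unfold scaledDirs; fun_prop

theorem IsWinnerOracle.measurable_est (hwin : IsWinnerOracle f win) (γ : ℝ) (i : Fin ℓ) :
    Measurable fun p : E d × Dirs d ℓ => est win γ p.1 p.2 i := by
  have hs := measurable_scaledDirs (d := d) (ℓ := ℓ)
  have hs' : ∀ j, Measurable fun U : Dirs d ℓ => scaledDirs U j := fun j =>
    (measurable_pi_apply j).comp hs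
  refine hwin.measurable_comp (X := fun p : E d × Dirs d ℓ => querySet γ p.1 (scaledDirs p.2))
    (G := fun v p => gradEst (scaledDirs p.2) v i) ?_ fun v => ?_
  · unfold querySet
    refine measurable_pi_lambda _ fun v => ?_
    fun_prop
  · unfold gradEst
    fun_prop

theorem IsWinnerOracle.measurable_est_right (hwin : IsWinnerOracle f win) (γ : ℝ) (w : E d)
    (i : Fin ℓ) : Measurable fun U : Dirs d ℓ => est win γ w U i :=
  Measurable.comp (g := fun p : E d × Dirs d ℓ => est win γ p.1 p.2 i) (hwin.measurable_est γ i)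
    (f := fun U => (w, U)) measurable_prodMk_left

theorem IsWinnerOracle.measurable_estMean (hwin : IsWinnerOracle f win) (γ : ℝ) :
    Measurable fun p : E d × Dirs d ℓ => estMean win γ p.1 p.2 := by
  have := hwin.measurable_est γ
  unfold estMean
  fun_prop

theorem IsWinnerOracle.measurable_estMean_right (hwin : IsWinnerOracle f win) (γ : ℝ) (w : E d) :
    Measurable fun U : Dirs d ℓ => estMean win γ w U :=
  Measurable.comp (g := fun p : E d × Dirs d ℓ => estMean win γ p.1 p.2)
    (hwin.measurable_estMean γ) (f := fun U => (w, U)) measurable_prodMk_left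

end Measurability

section Moments

variable {d ℓ : ℕ} [NeZero d] [NeZero ℓ] {f : E d → ℝ} {win : (Cube ℓ → E d) → Cube ℓ} {β γ : ℝ}
  {w : E d}

theorem integrable_norm_est_sub_orient (hwin : IsWinnerOracle f win) (n : E d) (i : Fin ℓ) :
    Integrable (fun U => ‖est win γ w U i - orient n (U i)‖) (dirMeas d ℓ) := by
  have h1 := hwin.measurable_est_right γ w i
  have h2 := measurable_orient n
  refine integrable_of_bdd (by fun_prop) 2 fun U => ?_
  rw [abs_of_nonneg (norm_nonneg _)]
  refine (norm_sub_le _ _).trans ?_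
  rw [norm_est, norm_orient]; norm_num

/-- The expected deviation of an estimate from the ideal one, by anti-concentration. -/
theorem integral_norm_est_sub_orient_le (hβ : 0 ≤ β) (hf : IsSmooth β f)
    (hwin : IsWinnerOracle f win) (hγ : 0 < γ) (hG : gradient f w ≠ 0) (i : Fin ℓ) :
    ∫ U, ‖est win γ w U i - orient (‖gradient f w‖⁻¹ • gradient f w) (U i)‖ ∂dirMeas d ℓ
      ≤ 2 * (β * γ * √((d : ℝ) * ℓ) / ‖gradient f w‖) := by
  set n := ‖gradient f w‖⁻¹ • gradient f w with hn
  have hGn : 0 < ‖gradient f w‖ := norm_pos_iff.2 hG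
  have hn1 : ‖n‖ = 1 := by simp [hn, norm_smul, hG]
  have hd : 0 < √(d : ℝ) := Real.sqrt_pos.2 (by exact_mod_cast NeZero.pos d)
  set r := β * γ * √((d : ℝ) * ℓ) / ‖gradient f w‖ with hr
  have hr0 : 0 ≤ r := by positivity
  have hrd : β * γ * √(ℓ : ℝ) / ‖gradient f w‖ = r / √(d : ℝ) := by
    rw [hr, Real.sqrt_mul (by positivity)]; field_simp
  let A : Set (Sph d) := {x | |inner ℝ (x : E d) n| ≤ r / √(d : ℝ)}
  have hA : MeasurableSet A := measurableSet_le (by fun_prop) measurable_const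
  have hind : Measurable (A.indicator (1 : Sph d → ℝ)) := measurable_one.indicator hA
  have hle : ∀ U : Dirs d ℓ, ‖est win γ w U i - orient n (U i)‖
      ≤ 2 * A.indicator (1 : Sph d → ℝ) (U i) := fun U => by
    by_cases h : est win γ w U i = orient n (U i)
    · rw [h, sub_self, norm_zero]
      exact mul_nonneg zero_le_two (Set.indicator_nonneg (fun _ _ => zero_le_one) _)
    · have : U i ∈ A := by
        have := abs_inner_le_of_est_ne hβ hf hwin hγ hG h
        rwa [hrd] at this
      rw [Set.indicator_of_mem this]
      refine (norm_sub_le _ _).trans ?_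
      rw [norm_est, norm_orient, Pi.one_apply]; norm_num
  have hI : Integrable (fun U : Dirs d ℓ => 2 * A.indicator (1 : Sph d → ℝ) (U i))
      (dirMeas d ℓ) := by
    refine integrable_of_bdd (by fun_prop) 2 fun U => ?_
    by_cases h : U i ∈ A <;> simp [h]
  refine (integral_mono (integrable_norm_est_sub_orient hwin n i) hI hle).trans ?_
  rw [integral_const_mul, integral_dirMeas_eval i hind, integral_indicator_one hA]
  gcongr
  exact sphereUnif_slab hn1 hr0

/-- The mean of a single estimate. -/
theorem abs_integral_inner_est_sub_le (hβ : 0 ≤ β) (hf : IsSmooth β f)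
    (hwin : IsWinnerOracle f win) (hγ : 0 < γ) (hG : gradient f w ≠ 0) (i : Fin ℓ) (b : E d) :
    |∫ U, inner ℝ (est win γ w U i) b ∂dirMeas d ℓ
        - cConst d / √d * inner ℝ (‖gradient f w‖⁻¹ • gradient f w) b|
      ≤ 2 * (β * γ * √((d : ℝ) * ℓ) / ‖gradient f w‖) * ‖b‖ := by
  set n := ‖gradient f w‖⁻¹ • gradient f w with hn
  have hn1 : ‖n‖ = 1 := by simp [hn, norm_smul, hG]
  have h1 := hwin.measurable_est_right γ w i
  have h2 := measurable_orient n
  have hIe : Integrable (fun U => inner ℝ (est win γ w U i) b) (dirMeas d ℓ) :=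
    integrable_of_bdd (by fun_prop) ‖b‖ fun U => by
      simpa [norm_est] using abs_real_inner_le_norm (est win γ w U i) b
  have hIo : Integrable (fun U : Dirs d ℓ => inner ℝ (orient n (U i)) b) (dirMeas d ℓ) :=
    integrable_of_bdd (by fun_prop) ‖b‖ fun U => by
      simpa [norm_orient] using abs_real_inner_le_norm (orient n (U i)) b
  have hideal : cConst d / √d * inner ℝ n b
      = ∫ U : Dirs d ℓ, inner ℝ (orient n (U i)) b ∂dirMeas d ℓ := by
    rw [integral_dirMeas_eval i (F := fun x => inner ℝ (orient n x) b) (by fun_prop),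
      ← integral_inner_orient hn1 b]
    simp only [real_inner_comm]
  rw [hideal, ← integral_sub hIe hIo]
  refine abs_integral_le_integral_abs.trans ?_
  have hI := integrable_norm_est_sub_orient (γ := γ) (w := w) hwin n i
  refine (integral_mono (hIe.sub hIo).abs (hI.mul_const ‖b‖) fun U => ?_).trans ?_
  · dsimp only
    simp only [Pi.sub_apply]
    rw [← inner_sub_left]
    exact abs_real_inner_le_norm _ _
  · rw [integral_mul_const]
    gcongr
    exact integral_norm_est_sub_orient_le hβ hf hwin hγ hG i

theorem integrable_inner_est_est (hwin : IsWinnerOracle f win) (i j : Fin ℓ) :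
    Integrable (fun U => inner ℝ (est win γ w U i) (est win γ w U j)) (dirMeas d ℓ) := by
  have h1 := hwin.measurable_est_right γ w
  refine integrable_of_bdd (by fun_prop) 1 fun U => ?_
  simpa [norm_est] using abs_real_inner_le_norm (est win γ w U i) (est win γ w U j)

/-- The correlation of two different estimates. -/
theorem abs_integral_inner_est_est_sub_le (hβ : 0 ≤ β) (hf : IsSmooth β f)
    (hwin : IsWinnerOracle f win) (hγ : 0 < γ) (hG : gradient f w ≠ 0) {i j : Fin ℓ}
    (hij : i ≠ j) :
    |∫ U, inner ℝ (est win γ w U i) (est win γ w U j) ∂dirMeas d ℓ - cConst d ^ 2 / d|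
      ≤ 4 * (β * γ * √((d : ℝ) * ℓ) / ‖gradient f w‖) := by
  set n := ‖gradient f w‖⁻¹ • gradient f w with hn
  have hn1 : ‖n‖ = 1 := by simp [hn, norm_smul, hG]
  have h2 := measurable_orient n
  have hIe := integrable_inner_est_est (γ := γ) (w := w) hwin i j
  have hIo : Integrable (fun U : Dirs d ℓ => inner ℝ (orient n (U i)) (orient n (U j)))
      (dirMeas d ℓ) :=
    integrable_of_bdd (by fun_prop) 1 fun U => by
      simpa [norm_orient] using abs_real_inner_le_norm (orient n (U i)) (orient n (U j))
  rw [← integral_inner_orient_orient hn1 hij, ← integral_sub hIe hIo]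
  refine abs_integral_le_integral_abs.trans ?_
  have hi := integrable_norm_est_sub_orient (γ := γ) (w := w) hwin n i
  have hj := integrable_norm_est_sub_orient (γ := γ) (w := w) hwin n j
  refine (integral_mono (hIe.sub hIo).abs (hi.add hj) fun U => ?_).trans ?_
  · simp only [Pi.sub_apply, Pi.add_apply]
    have e : inner ℝ (est win γ w U i) (est win γ w U j)
        - inner ℝ (orient n (U i)) (orient n (U j))
        = inner ℝ (est win γ w U i - orient n (U i)) (est win γ w U j)
          + inner ℝ (orient n (U i)) (est win γ w U j - orient n (U j)) := by
      rw [inner_sub_left, inner_sub_right]; ring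
    rw [e]
    refine (abs_add_le _ _).trans (add_le_add ?_ ?_)
    · simpa [norm_est] using abs_real_inner_le_norm (est win γ w U i - orient n (U i))
        (est win γ w U j)
    · simpa [norm_orient] using abs_real_inner_le_norm (orient n (U i))
        (est win γ w U j - orient n (U j))
  · rw [integral_add' hi hj]
    linarith [integral_norm_est_sub_orient_le hβ hf hwin hγ hG i,
      integral_norm_est_sub_orient_le hβ hf hwin hγ hG j]

theorem integrable_inner_estMean (hwin : IsWinnerOracle f win) (b : E d) :
    Integrable (fun U => inner ℝ (estMean win γ w U) b) (dirMeas d ℓ) := by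
  have := hwin.measurable_estMean_right γ w
  refine integrable_of_bdd (by fun_prop) ‖b‖ fun U => ?_
  refine (abs_real_inner_le_norm _ _).trans ?_
  nlinarith [norm_estMean_le win γ w U, norm_nonneg b]

theorem integrable_norm_estMean_pow (hwin : IsWinnerOracle f win) (k : ℕ) :
    Integrable (fun U => ‖estMean win γ w U‖ ^ k) (dirMeas d ℓ) := by
  have := hwin.measurable_estMean_right γ w
  refine integrable_of_bdd (by fun_prop) 1 fun U => ?_
  rw [abs_of_nonneg (by positivity)]
  exact pow_le_one₀ (norm_nonneg _) (norm_estMean_le win γ w U)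

theorem le_integral_inner_estMean (hβ : 0 ≤ β) (hf : IsSmooth β f)
    (hwin : IsWinnerOracle f win) (hγ : 0 < γ) (hG : gradient f w ≠ 0) (b : E d) :
    cConst d / √d * inner ℝ (‖gradient f w‖⁻¹ • gradient f w) b
        - 2 * (β * γ * √((d : ℝ) * ℓ) / ‖gradient f w‖) * ‖b‖
      ≤ ∫ U, inner ℝ (estMean win γ w U) b ∂dirMeas d ℓ := by
  have hℓ : (0 : ℝ) < ℓ := by exact_mod_cast NeZero.pos ℓ
  have h1 := hwin.measurable_est_right γ w
  have hIe : ∀ i, Integrable (fun U => inner ℝ (est win γ w U i) b) (dirMeas d ℓ) := fun i =>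
    integrable_of_bdd (by fun_prop) ‖b‖ fun U => by
      simpa [norm_est] using abs_real_inner_le_norm (est win γ w U i) b
  simp only [estMean, real_inner_smul_left, sum_inner]
  rw [integral_const_mul, integral_finsetSum _ fun i _ => hIe i, one_div, le_inv_mul_iff₀ hℓ]
  calc _ = ∑ _i : Fin ℓ, (cConst d / √d * inner ℝ (‖gradient f w‖⁻¹ • gradient f w) b
        - 2 * (β * γ * √((d : ℝ) * ℓ) / ‖gradient f w‖) * ‖b‖) := by
        rw [Finset.sum_const, Finset.card_univ, Fintype.card_fin, nsmul_eq_mul,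
          real_inner_smul_left]
    _ ≤ _ := Finset.sum_le_sum fun i _ => by
      have := (abs_le.1 (abs_integral_inner_est_sub_le hβ hf hwin hγ hG i b)).1
      linarith

theorem integral_norm_estMean_sq_le (hℓd : ℓ ≤ d) (hβ : 0 ≤ β) (hf : IsSmooth β f)
    (hwin : IsWinnerOracle f win) (hγ : 0 < γ) (hG : gradient f w ≠ 0) :
    ∫ U, ‖estMean win γ w U‖ ^ 2 ∂dirMeas d ℓ
      ≤ 2 / ℓ + 4 * (β * γ * √((d : ℝ) * ℓ) / ‖gradient f w‖) := by
  have hℓ : (0 : ℝ) < ℓ := by exact_mod_cast NeZero.pos ℓ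
  have hd : (0 : ℝ) < d := by exact_mod_cast NeZero.pos d
  have hℓd' : (ℓ : ℝ) ≤ d := by exact_mod_cast hℓd
  set r := β * γ * √((d : ℝ) * ℓ) / ‖gradient f w‖ with hr
  have hr0 : 0 ≤ r := by positivity
  have h1 : ∀ U, ‖estMean win γ w U‖ ^ 2
      = (1 / (ℓ : ℝ)) ^ 2 * ∑ i, ∑ j, inner ℝ (est win γ w U i) (est win γ w U j) := fun U => by
    rw [estMean, norm_smul, mul_pow, ← real_inner_self_eq_norm_sq (∑ i, _), sum_inner]
    simp only [inner_sum, Real.norm_eq_abs, sq_abs]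
  have hI := integrable_inner_est_est (γ := γ) (w := w) hwin
  simp only [h1]
  rw [integral_const_mul, integral_finsetSum _ fun i _ => integrable_finsetSum _ fun j _ => hI i j]
  simp_rw [integral_finsetSum Finset.univ fun j _ => hI _ j]
  have hle : ∀ i j, ∫ U, inner ℝ (est win γ w U i) (est win γ w U j) ∂dirMeas d ℓ
      ≤ (if i = j then 1 else 0) + (1 / d + 4 * r) := by
    intro i j
    split_ifs with hij
    · subst hij
      have : 0 ≤ 1 / (d : ℝ) + 4 * r := by positivity
      simp only [real_inner_self_eq_norm_sq, norm_est]
      simpa using this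
    · have h2 := (abs_le.1 (abs_integral_inner_est_est_sub_le hβ hf hwin hγ hG hij)).2
      have h3 : cConst d ^ 2 / d ≤ 1 / d := by
        gcongr
        exact pow_le_one₀ (by linarith [half_le_cConst d]) (cConst_le_one d)
      linarith
  calc _ ≤ (1 / (ℓ : ℝ)) ^ 2 * ∑ i : Fin ℓ, ∑ j : Fin ℓ,
        ((if i = j then (1 : ℝ) else 0) + (1 / d + 4 * r)) := by
        gcongr with i _ j _
        exact hle i j
    _ = 1 / ℓ + 1 / d + 4 * r := by
        simp only [Finset.sum_add_distrib, Finset.sum_ite_eq, Finset.mem_univ, if_true,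
          Finset.sum_const, Finset.card_univ, Fintype.card_fin, nsmul_eq_mul]
        field_simp
        ring
    _ ≤ _ := by
        have : 1 / (d : ℝ) ≤ 1 / ℓ := one_div_le_one_div_of_le hℓ hℓd'
        have : 2 / (ℓ : ℝ) = 1 / ℓ + 1 / ℓ := by ring
        linarith

theorem integral_norm_estMean_pow_four_le (hℓd : ℓ ≤ d) (hβ : 0 ≤ β) (hf : IsSmooth β f)
    (hwin : IsWinnerOracle f win) (hγ : 0 < γ) (hG : gradient f w ≠ 0) :
    ∫ U, ‖estMean win γ w U‖ ^ 4 ∂dirMeas d ℓ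
      ≤ 576 / (ℓ : ℝ) ^ 2 + 128 * (β * γ * √((d : ℝ) * ℓ) / ‖gradient f w‖) := by
  have hℓ : (0 : ℝ) < ℓ := by exact_mod_cast NeZero.pos ℓ
  set n := ‖gradient f w‖⁻¹ • gradient f w with hn
  have hn1 : ‖n‖ = 1 := by simp [hn, norm_smul, hG]
  set r := β * γ * √((d : ℝ) * ℓ) / ‖gradient f w‖ with hr
  have hI4 := (integrable_norm_sum_orient_pow n (Finset.univ : Finset (Fin ℓ)) 4).const_mul
    (8 / (ℓ : ℝ) ^ 4)
  have hIs : Integrable (fun U : Dirs d ℓ => 64 / (ℓ : ℝ) * ∑ i, ‖est win γ w U i - orient n (U i)‖)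
      (dirMeas d ℓ) := (integrable_finsetSum _ fun i _ =>
        integrable_norm_est_sub_orient hwin n i).const_mul _
  have hle : ∀ U : Dirs d ℓ, ‖estMean win γ w U‖ ^ 4
      ≤ 8 / (ℓ : ℝ) ^ 4 * ‖∑ i, orient n (U i)‖ ^ 4
        + 64 / (ℓ : ℝ) * ∑ i, ‖est win γ w U i - orient n (U i)‖ := fun U => by
    have hs : estMean win γ w U = (1 / (ℓ : ℝ)) • ∑ i, orient n (U i)
        + (1 / (ℓ : ℝ)) • ∑ i, (est win γ w U i - orient n (U i)) := by
      rw [estMean, ← smul_add, ← Finset.sum_add_distrib]; simp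
    set x := ‖(1 / (ℓ : ℝ)) • ∑ i, orient n (U i)‖ with hx
    set y := ‖(1 / (ℓ : ℝ)) • ∑ i, (est win γ w U i - orient n (U i))‖ with hy
    have hx0 : 0 ≤ x := norm_nonneg _
    have hy0 : 0 ≤ y := norm_nonneg _
    have hxy : ‖estMean win γ w U‖ ≤ x + y := by rw [hs]; exact norm_add_le _ _
    have hxe : x ^ 4 = 1 / (ℓ : ℝ) ^ 4 * ‖∑ i, orient n (U i)‖ ^ 4 := by
      rw [hx, norm_smul, mul_pow, Real.norm_eq_abs, abs_of_pos (by positivity), one_div_pow]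
    have hyl : y ≤ 1 / (ℓ : ℝ) * ∑ i, ‖est win γ w U i - orient n (U i)‖ := by
      rw [hy, norm_smul, Real.norm_eq_abs, abs_of_pos (by positivity)]
      gcongr
      exact norm_sum_le _ _
    have hy2 : y ≤ 2 := by
      refine hyl.trans ?_
      rw [one_div, inv_mul_le_iff₀ hℓ]
      calc _ ≤ ∑ _i : Fin ℓ, (2 : ℝ) := Finset.sum_le_sum fun i _ => by
            refine (norm_sub_le _ _).trans ?_
            rw [norm_est, norm_orient]; norm_num
        _ = _ := by simp
    have h4 : (x + y) ^ 4 ≤ 8 * x ^ 4 + 8 * y ^ 4 := by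
      nlinarith [sq_nonneg (x - y), sq_nonneg (x ^ 2 - y ^ 2), mul_nonneg hx0 hy0,
        sq_nonneg (x + y), mul_nonneg (sq_nonneg (x - y)) (sq_nonneg (x + y)),
        mul_nonneg (sq_nonneg (x - y)) (add_nonneg (sq_nonneg x) (sq_nonneg y))]
    have hy4 : y ^ 4 ≤ 8 * y := by
      have : y ^ 3 ≤ 2 ^ 3 := pow_le_pow_left₀ hy0 hy2 3
      calc y ^ 4 = y ^ 3 * y := by ring
        _ ≤ 2 ^ 3 * y := by gcongr
        _ = 8 * y := by norm_num
    calc ‖estMean win γ w U‖ ^ 4 ≤ (x + y) ^ 4 := pow_le_pow_left₀ (norm_nonneg _) hxy 4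
      _ ≤ 8 * x ^ 4 + 64 * (1 / (ℓ : ℝ) * ∑ i, ‖est win γ w U i - orient n (U i)‖) := by linarith
      _ = _ := by rw [hxe]; ring
  refine (integral_mono (integrable_norm_estMean_pow hwin 4) (hI4.add hIs) hle).trans ?_
  rw [integral_add' hI4 hIs, integral_const_mul, integral_const_mul,
    integral_finsetSum _ fun i _ => integrable_norm_est_sub_orient hwin n i]
  have h1 := integral_norm_sum_orient_pow_four_le hℓd hn1 (Finset.univ : Finset (Fin ℓ))
  rw [Finset.card_univ, Fintype.card_fin] at h1
  have h2 : ∑ i, ∫ U, ‖est win γ w U i - orient n (U i)‖ ∂dirMeas d ℓ ≤ ℓ * (2 * r) := by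
    refine (Finset.sum_le_sum fun i _ =>
      integral_norm_est_sub_orient_le hβ hf hwin hγ hG i).trans ?_
    simp [hr]
  calc _ ≤ 8 / (ℓ : ℝ) ^ 4 * (72 * (ℓ : ℝ) ^ 2) + 64 / (ℓ : ℝ) * (ℓ * (2 * r)) := by gcongr
    _ = _ := by field_simp; ring

end Moments

/-! ### Numerical inequalities for one round -/

theorem sqrt_two_le : √(2 : ℝ) ≤ 1.415 := by
  rw [Real.sqrt_le_left (by norm_num)]; norm_num

theorem le_sqrt_two : 1.414 ≤ √(2 : ℝ) := Real.le_sqrt_of_sq_le (by norm_num)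

/-- The drift estimate of one round, as an inequality between real numbers: `q` and `V` stand for
the mean of `⟨g, w - x*⟩` and of `‖g‖²`, `h` for the distance to the minimiser, and `y`, `z` for
`√(Δ / β)`, `√(ε / β)`. -/
theorem drift_real {d ℓ σ z y h r D c q V η : ℝ} (hσ : 1 ≤ σ) (hσd : σ ^ 2 = d) (hℓ : 1 ≤ ℓ)
    (hD : 0 < D) (hz : 0 < z) (hη : η = ℓ * z / (20 * σ))
    (hr : r ≤ √2 * z * h / (960 * d * ℓ * D)) (hzh : z ≤ h) (hzy : z ≤ √2 * y) (hc : 1 / 2 ≤ c)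
    (hq : c / σ * (√2 * y) - 2 * r * h ≤ q) (hV : V ≤ 2 / ℓ + 4 * r) :
    -2 * η * q + η ^ 2 * V + η * y / σ ≤ η * z / (160 * d * D) * h ^ 2 := by
  have hσ0 : 0 < σ := by linarith
  have hℓ0 : 0 < ℓ := by linarith
  have hd : 1 ≤ d := by nlinarith
  have hη0 : 0 < η := by rw [hη]; positivity
  have s1 := sqrt_two_le
  have s2 := le_sqrt_two
  have hy : 0 < y := by
    by_contra hy
    nlinarith [mul_nonneg (Real.sqrt_nonneg 2) (neg_nonneg.2 (not_lt.1 hy))]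
  have hh : 0 < h := hz.trans_le hzh
  -- the error terms
  have e1 : 4 * r * h ≤ √2 * z * h ^ 2 / (240 * d * ℓ * D) := by
    calc 4 * r * h ≤ 4 * (√2 * z * h / (960 * d * ℓ * D)) * h := by gcongr
      _ = _ := by field_simp; norm_num
  have e1' : √2 * z * h ^ 2 / (240 * d * ℓ * D) ≤ √2 * z * h ^ 2 / (240 * d * D) := by
    have : √2 * z * h ^ 2 / (240 * d * ℓ * D) = √2 * z * h ^ 2 / (240 * d * D) / ℓ := by
      field_simp
    rw [this]
    exact div_le_self (by positivity) hℓ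
  have e2 : η * (4 * r) ≤ √2 * z * h ^ 2 / (4800 * d * D) := by
    calc η * (4 * r) ≤ η * (4 * (√2 * z * h / (960 * d * ℓ * D))) := by gcongr
      _ = (z * (√2 * z * h)) / (4800 * σ * d * D) := by rw [hη]; field_simp; norm_num
      _ ≤ (h * (√2 * z * h)) / (4800 * 1 * d * D) := by gcongr
      _ = _ := by ring
  have e3 : η * (2 / ℓ) ≤ √2 * y / (10 * σ) := by
    calc η * (2 / ℓ) = z / (10 * σ) := by rw [hη]; field_simp; norm_num
      _ ≤ _ := by gcongr
  have e4 : √2 * y / (2 * σ) - 2 * r * h ≤ q := by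
    refine le_trans ?_ hq
    have : √2 * y / (2 * σ) = 1 / 2 / σ * (√2 * y) := by ring
    rw [this]
    gcongr
  have e5 : √2 * z * h ^ 2 / (240 * d * D) + √2 * z * h ^ 2 / (4800 * d * D)
      ≤ z / (160 * d * D) * h ^ 2 := by
    have : √2 * z * h ^ 2 / (240 * d * D) + √2 * z * h ^ 2 / (4800 * d * D)
        = (√2 * 21 / 4800) * (z * h ^ 2 / (d * D)) := by field_simp; ring
    rw [this]
    have : z / (160 * d * D) * h ^ 2 = 1 / 160 * (z * h ^ 2 / (d * D)) := by field_simp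
    rw [this]
    have h0 : 0 ≤ z * h ^ 2 / (d * D) := by positivity
    exact mul_le_mul_of_nonneg_right (by linarith) h0
  have e6 : y / σ + √2 * y / (10 * σ) ≤ 2 * (√2 * y / (2 * σ)) := by
    have h0 : 0 ≤ y / σ := by positivity
    have t1 : √2 * y / (10 * σ) = √2 / 10 * (y / σ) := by field_simp
    have t2 : 2 * (√2 * y / (2 * σ)) = √2 * (y / σ) := by field_simp
    rw [t1, t2]; nlinarith
  have e7 : -2 * q + η * V + y / σ ≤ z / (160 * d * D) * h ^ 2 := by
    have := mul_le_mul_of_nonneg_left hV hη0.le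
    rw [mul_add] at this
    linarith
  calc -2 * η * q + η ^ 2 * V + η * y / σ = η * (-2 * q + η * V + y / σ) := by ring
    _ ≤ η * (z / (160 * d * D) * h ^ 2) := by gcongr
    _ = _ := by ring

/-- The fluctuation estimate of one round, in the notation of `drift_real`; `M` stands for the
mean of `‖g‖⁴`. -/
theorem fluctuation_real {d ℓ σ z y h r D V M η : ℝ} (hσ : 1 ≤ σ) (hσd : σ ^ 2 = d) (hℓ : 1 ≤ ℓ)
    (hℓd : ℓ ≤ d) (hD : 0 < D) (hz : 0 < z) (hη : η = ℓ * z / (20 * σ))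
    (hr : r ≤ √2 * z * h / (960 * d * ℓ * D)) (hzh : z ≤ h) (hyh : 2 * y ^ 2 ≤ h ^ 2)
    (hV : V ≤ 2 / ℓ + 4 * r) (hM : M ≤ 576 / ℓ ^ 2 + 128 * r) :
    12 * η ^ 2 * h ^ 2 * V + 3 * η ^ 4 * M + 3 * (η * y / σ) ^ 2
      ≤ 32 * η ^ 2 / ℓ * h ^ 2 + η ^ 2 / (10 * ℓ * D) * h ^ 4 := by
  have hσ0 : 0 < σ := by linarith
  have hℓ0 : 0 < ℓ := by linarith
  have hd : 1 ≤ d := by nlinarith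
  have hd0 : 0 < d := by linarith
  have hη0 : 0 < η := by rw [hη]; positivity
  have s1 := sqrt_two_le
  have hh : 0 < h := hz.trans_le hzh
  have hr' : r ≤ √2 * h ^ 2 / (960 * d * ℓ * D) := by
    refine hr.trans ?_
    have : √2 * h ^ 2 = √2 * h * h := by ring
    rw [this]
    gcongr
  have hη2 : η ^ 2 ≤ ℓ ^ 2 * h ^ 2 / (400 * d) := by
    have : η ^ 2 = ℓ ^ 2 * z ^ 2 / (400 * d) := by rw [hη, ← hσd]; field_simp; norm_num
    rw [this]; gcongr
  have a1 : 12 * h ^ 2 * V ≤ 24 / ℓ * h ^ 2 + (√2 * 48 / 960) * (h ^ 4 / (ℓ * D)) := by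
    calc 12 * h ^ 2 * V ≤ 12 * h ^ 2 * (2 / ℓ + 4 * (√2 * h ^ 2 / (960 * d * ℓ * D))) := by
          gcongr; linarith
      _ = 24 / ℓ * h ^ 2 + (√2 * 48 / 960) * (h ^ 4 / (d * ℓ * D)) := by field_simp; ring
      _ ≤ _ := by
          gcongr
          nlinarith [mul_pos hℓ0 hD]
  have a2 : 3 * η ^ 2 * M ≤ 4.32 / ℓ * h ^ 2 + (√2 / 1000) * (h ^ 4 / (ℓ * D)) := by
    have hM' : M ≤ 576 / ℓ ^ 2 + 128 * (√2 * h ^ 2 / (960 * d * ℓ * D)) := by linarith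
    calc 3 * η ^ 2 * M ≤ 3 * η ^ 2 * (576 / ℓ ^ 2 + 128 * (√2 * h ^ 2 / (960 * d * ℓ * D))) := by
          gcongr
      _ ≤ 3 * (ℓ ^ 2 * h ^ 2 / (400 * d))
            * (576 / ℓ ^ 2 + 128 * (√2 * h ^ 2 / (960 * d * ℓ * D))) := by gcongr
      _ = 4.32 / d * h ^ 2 + (√2 / 1000) * (h ^ 4 * (ℓ * (1 / d) * (1 / d)) / D) := by
          field_simp; ring
      _ ≤ 4.32 / ℓ * h ^ 2 + (√2 / 1000) * (h ^ 4 * (ℓ * (1 / ℓ) * (1 / ℓ)) / D) := by gcongr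
      _ = _ := by field_simp
  have a3 : 3 * (y / σ) ^ 2 ≤ 1.5 / ℓ * h ^ 2 := by
    rw [div_pow, hσd]
    calc 3 * (y ^ 2 / d) ≤ 3 * ((h ^ 2 / 2) / ℓ) := by gcongr; linarith
      _ = _ := by ring
  have h0 : 0 ≤ h ^ 4 / (ℓ * D) := by positivity
  have h1 : 0 ≤ h ^ 2 / ℓ := by positivity
  have a4 : 12 * h ^ 2 * V + 3 * η ^ 2 * M + 3 * (y / σ) ^ 2
      ≤ 32 / ℓ * h ^ 2 + 1 / (10 * ℓ * D) * h ^ 4 := by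
    have t1 : 1 / (10 * ℓ * D) * h ^ 4 = 1 / 10 * (h ^ 4 / (ℓ * D)) := by field_simp
    have t2 : 32 / ℓ * h ^ 2 = 32 * (h ^ 2 / ℓ) := by ring
    have t3 : 24 / ℓ * h ^ 2 = 24 * (h ^ 2 / ℓ) := by ring
    have t4 : 4.32 / ℓ * h ^ 2 = 4.32 * (h ^ 2 / ℓ) := by ring
    have t5 : 1.5 / ℓ * h ^ 2 = 1.5 * (h ^ 2 / ℓ) := by ring
    rw [t3] at a1
    rw [t4] at a2
    rw [t5] at a3
    rw [t1, t2]
    nlinarith [mul_le_mul_of_nonneg_right s1 h0]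
  calc _ = η ^ 2 * (12 * h ^ 2 * V + 3 * η ^ 2 * M + 3 * (y / σ) ^ 2) := by ring
    _ ≤ η ^ 2 * (32 / ℓ * h ^ 2 + 1 / (10 * ℓ * D) * h ^ 4) := by gcongr
    _ = _ := by ring

/-- The prescribed radius makes the error level at most `√(2 ε / β) ‖w - x*‖ / (960 d ℓ D)` as
long as the gap exceeds `ε / 2`. -/
theorem errLevel_real {d ℓ β γ ε D G h Δ : ℝ} (hd : 0 < d) (hℓ : 0 < ℓ) (hβ : 0 < β) (hD : 0 < D)
    (hε : 0 < ε) (hG : 0 < G)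
    (hγ : γ ≤ ε ^ (3 / 2 : ℝ) / (960 * β * d * ℓ * √(d * ℓ) * D * √(Real.log 480)) * √(2 / β))
    (hΔ : ε / 2 < Δ) (hΔG : Δ ≤ G * h) :
    β * γ * √(d * ℓ) / G ≤ √2 * √(ε / β) * h / (960 * d * ℓ * D) := by
  have hh : 0 < h := by
    by_contra hh
    nlinarith [mul_nonneg hG.le (neg_nonneg.2 (not_lt.1 hh))]
  have hs : 0 < √(d * ℓ) := by positivity
  have hlog : 2 ≤ √(Real.log 480) := by
    apply Real.le_sqrt_of_sq_le
    rw [Real.le_log_iff_exp_le (by norm_num)]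
    have h1 : Real.exp 1 < 2.7182818286 := Real.exp_one_lt_d9
    calc Real.exp (2 ^ 2) = Real.exp 1 ^ 4 := by rw [← Real.exp_nat_mul]; norm_num
      _ ≤ 2.7182818286 ^ 4 := by gcongr
      _ ≤ 480 := by norm_num
  have he : ε ^ (3 / 2 : ℝ) * √(2 / β) = ε * (√2 * √(ε / β)) := by
    rw [show (3 / 2 : ℝ) = 1 + 1 / 2 by norm_num, Real.rpow_add hε, Real.rpow_one,
      ← Real.sqrt_eq_rpow, mul_assoc, ← Real.sqrt_mul hε.le, ← Real.sqrt_mul zero_le_two]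
    congr 2; ring
  have h1 : β * γ * √(d * ℓ) ≤ ε * (√2 * √(ε / β)) / (1920 * d * ℓ * D) := by
    calc β * γ * √(d * ℓ)
        ≤ β * (ε ^ (3 / 2 : ℝ) / (960 * β * d * ℓ * √(d * ℓ) * D * √(Real.log 480))
          * √(2 / β)) * √(d * ℓ) := by gcongr
      _ = (ε ^ (3 / 2 : ℝ) * √(2 / β)) / (960 * d * ℓ * D * √(Real.log 480)) := by field_simp
      _ ≤ (ε ^ (3 / 2 : ℝ) * √(2 / β)) / (960 * d * ℓ * D * 2) := by gcongr
      _ = _ := by rw [he]; ring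
  rw [div_le_iff₀ hG]
  refine h1.trans ?_
  calc ε * (√2 * √(ε / β)) / (1920 * d * ℓ * D)
      ≤ (2 * (G * h)) * (√2 * √(ε / β)) / (1920 * d * ℓ * D) := by gcongr; linarith
    _ = _ := by ring

/-! ### Trajectories and their distance to the minimiser -/

theorem one_le_natCast (k : ℕ) [NeZero k] : (1 : ℝ) ≤ k := by exact_mod_cast NeZero.one_le

theorem one_le_sqrt_natCast (k : ℕ) [NeZero k] : 1 ≤ √(k : ℝ) :=
  Real.one_le_sqrt.2 (one_le_natCast k)

/-- The change of the squared distance to `xs` caused by one unprojected step from `w`. -/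
noncomputable def distChange {d ℓ : ℕ} (win : (Cube ℓ → E d) → Cube ℓ) (η γ : ℝ) (xs w : E d)
    (U : Dirs d ℓ) : ℝ :=
  -2 * η * inner ℝ (estMean win γ w U) (w - xs) + η ^ 2 * ‖estMean win γ w U‖ ^ 2

/-- The standing assumptions of the convergence analysis: a convex `β`-smooth function with
minimiser `xs`, a winner oracle for it, and the prescribed step size and radius. -/
structure Setting {d ℓ : ℕ} (f : E d → ℝ) (win : (Cube ℓ → E d) → Cube ℓ) (xs : E d)
    (β D ε η γ : ℝ) : Prop where
  le_dim : ℓ ≤ d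
  β_pos : 0 < β
  D_pos : 0 < D
  ε_pos : 0 < ε
  γ_pos : 0 < γ
  convex : ConvexOn ℝ Set.univ f
  smooth : IsSmooth β f
  oracle : IsWinnerOracle f win
  isMin : ∀ x, f xs ≤ f x
  η_eq : η = ℓ * √ε / (20 * √(d * β))
  γ_le : γ ≤ ε ^ (3 / 2 : ℝ) /
      (960 * β * d * ℓ * √((d : ℝ) * ℓ) * D * √(Real.log 480)) * √(2 / β)

/-- The rate at which the squared distance decreases per unit of `√(f w - f xs)`. -/
noncomputable def driftRate (d : ℕ) (β η : ℝ) : ℝ := η / √(d * β)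

/-- The relative growth of the squared distance that wrong signs can cause. -/
noncomputable def growthRate (d : ℕ) (β D ε η : ℝ) : ℝ := η * √(ε / β) / (160 * d * D)

section Round

variable {d ℓ : ℕ} {f : E d → ℝ} {win : (Cube ℓ → E d) → Cube ℓ} {xs w : E d}
  {β D ε η γ : ℝ}

theorem IsWinnerOracle.measurable_distChange (hwin : IsWinnerOracle f win) :
    Measurable fun p : E d × Dirs d ℓ => distChange win η γ xs p.1 p.2 := by
  have := hwin.measurable_estMean γ
  unfold distChange
  fun_prop

theorem abs_distChange_le [NeZero ℓ] (w : E d) (U : Dirs d ℓ) :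
    |distChange win η γ xs w U| ≤ 2 * |η| * ‖w - xs‖ + η ^ 2 := by
  have h1 := norm_estMean_le win γ w U
  have h2 := abs_real_inner_le_norm (estMean win γ w U) (w - xs)
  have h3 : ‖estMean win γ w U‖ ^ 2 ≤ 1 := pow_le_one₀ (norm_nonneg _) h1
  refine (abs_add_le _ _).trans (add_le_add ?_ ?_)
  · rw [abs_mul, abs_mul, abs_neg, abs_two]
    gcongr
    nlinarith [norm_nonneg (w - xs)]
  · rw [abs_of_nonneg (by positivity)]
    nlinarith [sq_nonneg η]

namespace Setting

variable (S : Setting f win xs β D ε η γ)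
include S

theorem η_eq' : η = ℓ * √(ε / β) / (20 * √(d : ℝ)) := by
  rw [S.η_eq, Real.sqrt_mul (by positivity), Real.sqrt_div S.ε_pos.le]
  have := S.β_pos
  field_simp

theorem gap_nonneg (w : E d) : 0 ≤ f w - f xs := by linarith [S.isMin w]

theorem driftRate_mul_sqrt (w : E d) :
    driftRate d β η * √(f w - f xs) = η * √((f w - f xs) / β) / √(d : ℝ) := by
  rw [driftRate, Real.sqrt_mul (by positivity), Real.sqrt_div (S.gap_nonneg w)]
  ring

theorem gradient_ne_zero (hw : ε / 2 < f w - f xs) : gradient f w ≠ 0 := by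
  intro h
  have h1 := sub_min_le_inner (xs := xs) S.convex S.smooth.1 w
  rw [h, inner_zero_left] at h1
  linarith [S.ε_pos]

theorem two_mul_gap_div_le (w : E d) : 2 * √((f w - f xs) / β) ^ 2 ≤ ‖w - xs‖ ^ 2 := by
  have hβ := S.β_pos
  rw [Real.sq_sqrt (div_nonneg (S.gap_nonneg w) hβ.le), ← mul_div_assoc, div_le_iff₀ hβ]
  linarith [S.smooth.sub_min_le S.isMin w]

theorem sqrt_le_sqrt_two_mul (hw : ε / 2 < f w - f xs) :
    √(ε / β) ≤ √2 * √((f w - f xs) / β) := by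
  have hβ := S.β_pos
  rw [← Real.sqrt_mul zero_le_two]
  apply Real.sqrt_le_sqrt
  rw [← mul_div_assoc]
  gcongr
  linarith

theorem sqrt_le_norm (hw : ε / 2 < f w - f xs) : √(ε / β) ≤ ‖w - xs‖ := by
  refine (S.sqrt_le_sqrt_two_mul hw).trans ?_
  refine le_of_sq_le_sq ?_ (norm_nonneg _)
  rw [mul_pow, Real.sq_sqrt zero_le_two]
  exact S.two_mul_gap_div_le w

variable [NeZero d] [NeZero ℓ]

theorem η_pos : 0 < η := by
  have h1 := (one_le_sqrt_natCast d)
  have h2 := (one_le_natCast ℓ)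
  have := Real.sqrt_pos.2 (div_pos S.ε_pos S.β_pos)
  rw [S.η_eq']
  positivity

theorem driftRate_pos : 0 < driftRate d β η := by
  have := S.η_pos
  have := S.β_pos
  have : (0 : ℝ) < d := by exact_mod_cast NeZero.pos d
  unfold driftRate; positivity

theorem growthRate_nonneg : 0 ≤ growthRate d β D ε η := by
  have := S.η_pos
  have := S.D_pos
  unfold growthRate; positivity

theorem errLevel_le (hw : ε / 2 < f w - f xs) :
    β * γ * √((d : ℝ) * ℓ) / ‖gradient f w‖
      ≤ √2 * √(ε / β) * ‖w - xs‖ / (960 * d * ℓ * D) := by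
  have hd : (0 : ℝ) < d := by exact_mod_cast NeZero.pos d
  refine errLevel_real hd (by linarith [(one_le_natCast ℓ)]) S.β_pos S.D_pos S.ε_pos
    (norm_pos_iff.2 (S.gradient_ne_zero hw)) S.γ_le hw ?_
  exact (sub_min_le_inner S.convex S.smooth.1 w).trans (real_inner_le_norm _ _)

theorem integrable_distChange (w : E d) (k : ℕ) :
    Integrable (fun U => distChange win η γ xs w U ^ k) (dirMeas d ℓ) := by
  have hm : Measurable fun U : Dirs d ℓ => distChange win η γ xs w U :=
    Measurable.comp (g := fun p : E d × Dirs d ℓ => distChange win η γ xs p.1 p.2)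
      S.oracle.measurable_distChange (f := fun U => (w, U)) measurable_prodMk_left
  refine integrable_of_bdd (hm.pow_const k) ((2 * |η| * ‖w - xs‖ + η ^ 2) ^ k) fun U => ?_
  rw [abs_pow]
  exact pow_le_pow_left₀ (abs_nonneg _) (abs_distChange_le w U) k

/-- The expected decrease of the squared distance in one round. -/
theorem integral_distChange_le (hw : ε / 2 < f w - f xs) :
    ∫ U, distChange win η γ xs w U ∂dirMeas d ℓ + driftRate d β η * √(f w - f xs)
      ≤ growthRate d β D ε η * ‖w - xs‖ ^ 2 := by
  have hd : (0 : ℝ) < d := by exact_mod_cast NeZero.pos d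
  have hβ := S.β_pos
  have hG := S.gradient_ne_zero hw
  have h1 := (integrable_inner_estMean (γ := γ) (w := w) S.oracle (w - xs)).const_mul (-2 * η)
  have h2 := (integrable_norm_estMean_pow (γ := γ) (w := w) S.oracle 2).const_mul (η ^ 2)
  simp only [distChange]
  rw [integral_add h1 h2, integral_const_mul, integral_const_mul, S.driftRate_mul_sqrt, growthRate]
  have hq := le_integral_inner_estMean hβ.le S.smooth S.oracle S.γ_pos hG (w - xs)
  have hV := integral_norm_estMean_sq_le S.le_dim hβ.le S.smooth S.oracle S.γ_pos hG
  refine drift_real (one_le_sqrt_natCast d) (Real.sq_sqrt hd.le) (one_le_natCast ℓ) S.D_pos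
    (Real.sqrt_pos.2 (div_pos S.ε_pos hβ)) S.η_eq' (S.errLevel_le hw) (S.sqrt_le_norm hw)
    (S.sqrt_le_sqrt_two_mul hw) (half_le_cConst d) (le_trans ?_ hq) hV
  gcongr
  · exact div_nonneg (by linarith [half_le_cConst d]) (Real.sqrt_nonneg _)
  · rw [← Real.sqrt_mul zero_le_two, ← mul_div_assoc]
    exact S.smooth.sqrt_le_inner S.convex hβ S.isMin w hG

/-- The second moment of the compensated change of the squared distance in one round. -/
theorem integral_distChange_add_sq_le (hw : ε / 2 < f w - f xs) :
    ∫ U, (distChange win η γ xs w U + driftRate d β η * √(f w - f xs)) ^ 2 ∂dirMeas d ℓ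
      ≤ 32 * η ^ 2 / ℓ * ‖w - xs‖ ^ 2 + η ^ 2 / (10 * ℓ * D) * ‖w - xs‖ ^ 4 := by
  have hd : (0 : ℝ) < d := by exact_mod_cast NeZero.pos d
  have hβ := S.β_pos
  have hG := S.gradient_ne_zero hw
  have hV := integral_norm_estMean_sq_le S.le_dim hβ.le S.smooth S.oracle S.γ_pos hG
  have hM := integral_norm_estMean_pow_four_le S.le_dim hβ.le S.smooth S.oracle S.γ_pos hG
  refine le_trans ?_ (fluctuation_real (one_le_sqrt_natCast d) (Real.sq_sqrt hd.le) (one_le_natCast ℓ)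
    (by exact_mod_cast S.le_dim) S.D_pos (Real.sqrt_pos.2 (div_pos S.ε_pos hβ)) S.η_eq'
    (S.errLevel_le hw) (S.sqrt_le_norm hw) (S.two_mul_gap_div_le w) hV hM)
  have h2 := (integrable_norm_estMean_pow (γ := γ) (w := w) S.oracle 2).const_mul
    (12 * η ^ 2 * ‖w - xs‖ ^ 2)
  have h4 := (integrable_norm_estMean_pow (γ := γ) (w := w) S.oracle 4).const_mul (3 * η ^ 4)
  rw [S.driftRate_mul_sqrt]
  set p := η * √((f w - f xs) / β) / √(d : ℝ) with hp
  have hI : Integrable (fun U => (distChange win η γ xs w U + p) ^ 2) (dirMeas d ℓ) := by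
    have e : ∀ U, (distChange win η γ xs w U + p) ^ 2 = distChange win η γ xs w U ^ 2
        + 2 * p * distChange win η γ xs w U ^ 1 + p ^ 2 := fun U => by ring
    simp only [e]
    exact ((S.integrable_distChange w 2).add
      ((S.integrable_distChange w 1).const_mul _)).add (integrable_const _)
  refine (integral_mono hI ((h2.add h4).add (integrable_const (3 * p ^ 2))) fun U => ?_).trans ?_
  · simp only [Pi.add_apply, distChange]
    set g := estMean win γ w U
    have hi : (inner ℝ g (w - xs)) ^ 2 ≤ ‖g‖ ^ 2 * ‖w - xs‖ ^ 2 := by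
      rw [← mul_pow, ← sq_abs (inner ℝ g (w - xs))]
      exact pow_le_pow_left₀ (abs_nonneg _) (abs_real_inner_le_norm _ _) 2
    have h3 : ∀ x y z : ℝ, (x + y + z) ^ 2 ≤ 3 * x ^ 2 + 3 * y ^ 2 + 3 * z ^ 2 := fun x y z => by
      nlinarith [sq_nonneg (x - y), sq_nonneg (y - z), sq_nonneg (x - z)]
    refine (h3 _ _ _).trans ?_
    nlinarith [mul_le_mul_of_nonneg_left hi (sq_nonneg η)]
  · rw [integral_add' (h2.add h4) (integrable_const _), integral_add' h2 h4, integral_const_mul,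
      integral_const_mul]
    simp

end Setting

end Round

section Trajectory

variable {d ℓ : ℕ} (f : E d → ℝ) (win : (Cube ℓ → E d) → Cube ℓ) (K : Set (E d)) (η γ : ℝ)
  (w₁ : E d)

/-- The state after `t` rounds with unit directions `u`. -/
noncomputable def traj (u : ℕ → Dirs d ℓ) (t : ℕ) : State d :=
  run f win K η γ w₁ (fun s => scaledDirs (u s)) t

variable {f win K η γ w₁} {u u' : ℕ → Dirs d ℓ} {t : ℕ}

theorem traj_zero : traj f win K η γ w₁ u 0 = { point := w₁, best := w₁, queries := 0 } := rfl

theorem traj_point_succ : (traj f win K η γ w₁ u (t + 1)).point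
    = proj K ((traj f win K η γ w₁ u t).point
        - η • estMean win γ (traj f win K η γ w₁ u t).point (u t)) := rfl

theorem traj_best_succ : (traj f win K η γ w₁ u (t + 1)).best
    = if sgn (f (traj f win K η γ w₁ u t).best - f (traj f win K η γ w₁ u (t + 1)).point) < 0
      then (traj f win K η γ w₁ u t).best else (traj f win K η γ w₁ u (t + 1)).point := rfl

theorem run_queries (a : ℕ → Fin ℓ → E d) (t : ℕ) : (run f win K η γ w₁ a t).queries = 2 * t := by
  induction t with
  | zero => rfl
  | succ t ih =>
    change (run f win K η γ w₁ a t).queries + 1 + 1 = _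
    rw [ih]; ring

/-- The state after `t` rounds depends on the directions of these rounds only. -/
theorem traj_congr (h : ∀ s < t, u s = u' s) :
    traj f win K η γ w₁ u t = traj f win K η γ w₁ u' t := by
  induction t with
  | zero => rfl
  | succ t ih =>
    have h1 := ih fun s hs => h s (hs.trans t.lt_succ_self)
    change step f win K η γ (traj f win K η γ w₁ u t) (scaledDirs (u t))
      = step f win K η γ (traj f win K η γ w₁ u' t) (scaledDirs (u' t))
    rw [h1, h t t.lt_succ_self]

theorem best_succ_le : f (traj f win K η γ w₁ u (t + 1)).best
      ≤ f (traj f win K η γ w₁ u t).best ∧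
    f (traj f win K η γ w₁ u (t + 1)).best ≤ f (traj f win K η γ w₁ u (t + 1)).point := by
  rw [traj_best_succ]
  unfold sgn
  split_ifs with h1 h2 h2
  · norm_num at h2
  · exact ⟨by linarith, le_rfl⟩
  · exact ⟨le_rfl, by linarith⟩
  · norm_num at h2

theorem best_antitone : Antitone fun t => f (traj f win K η γ w₁ u t).best :=
  antitone_nat_of_succ_le fun _ => best_succ_le.1

theorem best_le_point {s : ℕ} (hs : s ≤ t) :
    f (traj f win K η γ w₁ u t).best ≤ f (traj f win K η γ w₁ u s).point := by
  refine (best_antitone hs).trans ?_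
  cases s with
  | zero => exact le_rfl
  | succ s => exact best_succ_le.2

variable {xs : E d}

theorem sq_norm_point_succ_le (hK : IsClosed K) (hKc : Convex ℝ K) (hxs : xs ∈ K) :
    ‖(traj f win K η γ w₁ u (t + 1)).point - xs‖ ^ 2
      ≤ ‖(traj f win K η γ w₁ u t).point - xs‖ ^ 2
        + distChange win η γ xs (traj f win K η γ w₁ u t).point (u t) := by
  rw [traj_point_succ]
  set w := (traj f win K η γ w₁ u t).point
  refine (pow_le_pow_left₀ (norm_nonneg _) (norm_proj_sub_le hK hKc hxs _) 2).trans ?_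
  rw [sub_right_comm, norm_sub_sq_real, inner_smul_right, norm_smul, mul_pow, Real.norm_eq_abs,
    sq_abs, distChange, real_inner_comm]
  apply le_of_eq; ring

theorem norm_point_sub_le [NeZero ℓ] (hK : IsClosed K) (hKc : Convex ℝ K) (hxs : xs ∈ K) (t : ℕ) :
    ‖(traj f win K η γ w₁ u t).point - xs‖ ≤ ‖w₁ - xs‖ + t * |η| := by
  induction t with
  | zero => simp [traj_zero]
  | succ t ih =>
    rw [traj_point_succ]
    set w := (traj f win K η γ w₁ u t).point
    refine (norm_proj_sub_le hK hKc hxs _).trans ?_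
    rw [sub_right_comm]
    refine (norm_sub_le _ _).trans ?_
    rw [norm_smul, Real.norm_eq_abs]
    have h1 := norm_estMean_le win γ w (u t)
    push_cast
    nlinarith [abs_nonneg η]

theorem measurable_point (hwin : IsWinnerOracle f win) (hK : IsClosed K) (hKc : Convex ℝ K)
    (hne : K.Nonempty) (t : ℕ) :
    Measurable fun u : ℕ → Dirs d ℓ => (traj f win K η γ w₁ u t).point := by
  induction t with
  | zero => exact measurable_const
  | succ t ih =>
    simp only [traj_point_succ]
    have h1 : Measurable fun u : ℕ → Dirs d ℓ =>
        estMean win γ (traj f win K η γ w₁ u t).point (u t) :=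
      Measurable.comp (g := fun p : E d × Dirs d ℓ => estMean win γ p.1 p.2)
        (hwin.measurable_estMean γ)
        (f := fun u : ℕ → Dirs d ℓ => ((traj f win K η γ w₁ u t).point, u t))
        (ih.prodMk (measurable_pi_apply t))
    exact (measurable_proj hK hKc hne).comp (ih.sub (h1.const_smul η))

theorem measurable_best (hf : Measurable f) (hwin : IsWinnerOracle f win) (hK : IsClosed K)
    (hKc : Convex ℝ K) (hne : K.Nonempty) (t : ℕ) :
    Measurable fun u : ℕ → Dirs d ℓ => (traj f win K η γ w₁ u t).best := by
  induction t with
  | zero => exact measurable_const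
  | succ t ih =>
    simp only [traj_best_succ]
    have hp := measurable_point (f := f) (η := η) (γ := γ) (w₁ := w₁) hwin hK hKc hne (t + 1)
    refine Measurable.ite ?_ ih hp
    exact measurableSet_lt (measurable_sgn.comp ((hf.comp ih).sub (hf.comp hp))) measurable_const

end Trajectory

section Independence

variable {d ℓ : ℕ} {Ω : Type*} [MeasurableSpace Ω] {P : Measure Ω}
  [IsProbabilityMeasure P] {U : ℕ → Fin ℓ → Ω → Sph d}

theorem map_round_eq (hU : ∀ t i, Measurable (U t i))
    (hlaw : ∀ t i, P.map (U t i) = sphereUnif d)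
    (hind : iIndepFun (fun p : ℕ × Fin ℓ => U p.1 p.2) P) (t : ℕ) :
    P.map (fun ω i => U t i ω) = dirMeas d ℓ := by
  have h := hind.precomp (g := fun i : Fin ℓ => (t, i)) fun i j h => by simpa using h
  rw [(iIndepFun_iff_map_fun_eq_pi_map fun i => (hU t i).aemeasurable).1 h]
  simp only [hlaw]; rfl

/-- The directions of round `t` may be integrated out first, with those of the earlier rounds
frozen. -/
theorem integral_past_present [NeZero d] (hU : ∀ t i, Measurable (U t i))
    (hlaw : ∀ t i, P.map (U t i) = sphereUnif d)
    (hind : iIndepFun (fun p : ℕ × Fin ℓ => U p.1 p.2) P) {t : ℕ}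
    {ψ : (ℕ → Dirs d ℓ) → Dirs d ℓ → ℝ} (hψ : Measurable (Function.uncurry ψ))
    (hloc : ∀ u u' V, (∀ s < t, u s = u' s) → ψ u V = ψ u' V)
    (hI : Integrable (fun ω => ψ (fun s i => U s i ω) (fun i => U t i ω)) P) :
    ∫ ω, ψ (fun s i => U s i ω) (fun i => U t i ω) ∂P
      = ∫ ω, ∫ V, ψ (fun s i => U s i ω) V ∂dirMeas d ℓ ∂P := by
  classical
  let x₀ : Sph d := Classical.arbitrary _
  let I : Finset (ℕ × Fin ℓ) := Finset.range t ×ˢ Finset.univ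
  let J : Finset (ℕ × Fin ℓ) := {t} ×ˢ Finset.univ
  have hIJ : Disjoint I J := by
    rw [Finset.disjoint_left]
    rintro ⟨a, b⟩ h1 h2
    simp only [I, J, Finset.mem_product, Finset.mem_range, Finset.mem_singleton] at h1 h2
    omega
  have hpair := hind.indepFun_finset I J hIJ fun p => hU p.1 p.2
  -- the earlier directions, completed to a sequence by an arbitrary point of the sphere
  let ext : (I → Sph d) → ℕ → Dirs d ℓ := fun h s i =>
    if hs : (s, i) ∈ I then h ⟨(s, i), hs⟩ else x₀
  let cur : (J → Sph d) → Dirs d ℓ := fun h i => h ⟨(t, i), by simp [J]⟩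
  have hext : Measurable ext := by
    refine measurable_pi_lambda _ fun s => measurable_pi_lambda _ fun i => ?_
    by_cases hs : (s, i) ∈ I
    · simp only [ext, dif_pos hs]; exact measurable_pi_apply _
    · simp only [ext, dif_neg hs]; exact measurable_const
  have hcur : Measurable cur := measurable_pi_lambda _ fun i => measurable_pi_apply _
  have hXY := hpair.comp hext hcur
  have hmX : Measurable (ext ∘ fun ω (p : I) => U p.1.1 p.1.2 ω) :=
    hext.comp (measurable_pi_lambda _ fun p => hU _ _)
  have hmY : Measurable (cur ∘ fun ω (p : J) => U p.1.1 p.1.2 ω) :=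
    hcur.comp (measurable_pi_lambda _ fun p => hU _ _)
  have hpast : ∀ ω V, ψ ((ext ∘ fun ω (p : I) => U p.1.1 p.1.2 ω) ω) V
      = ψ (fun s i => U s i ω) V := fun ω V => hloc _ _ V fun s hs => by
    funext i
    have : (s, i) ∈ I := by simp [I, hs]
    simp [ext, this]
  have key := hXY.integral_eq_integral_integral hmX hmY hψ (by simp only [hpast]; exact hI)
  simp only [hpast] at key
  refine key.trans ?_
  congr 1; ext ω
  rw [← map_round_eq hU hlaw hind t]
  have hr : Measurable fun ω i => U t i ω := measurable_pi_lambda _ fun i => hU t i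
  exact (integral_map hr.aemeasurable
    (hψ.comp measurable_prodMk_left).aestronglyMeasurable).symm

end Independence

/-! ### The stopped potential and its second moment -/

/-- Bounded measurable real functions. -/
def BddMeas {α : Type*} [MeasurableSpace α] (F : α → ℝ) : Prop :=
  Measurable F ∧ ∃ C, ∀ x, |F x| ≤ C

namespace BddMeas

variable {α α' : Type*} [MeasurableSpace α] [MeasurableSpace α'] {F G : α → ℝ}

theorem integrable (hF : BddMeas F) (μ : Measure α) [IsFiniteMeasure μ] : Integrable F μ := by
  obtain ⟨hm, C, hC⟩ := hF
  exact integrable_of_bdd hm C hC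

theorem const (c : ℝ) : BddMeas fun _ : α => c := ⟨measurable_const, |c|, fun _ => le_rfl⟩

theorem add (hF : BddMeas F) (hG : BddMeas G) : BddMeas fun x => F x + G x := by
  obtain ⟨hm, C, hC⟩ := hF
  obtain ⟨hm', C', hC'⟩ := hG
  exact ⟨hm.add hm', C + C', fun x => (abs_add_le _ _).trans (add_le_add (hC x) (hC' x))⟩

theorem mul (hF : BddMeas F) (hG : BddMeas G) : BddMeas fun x => F x * G x := by
  obtain ⟨hm, C, hC⟩ := hF
  obtain ⟨hm', C', hC'⟩ := hG
  refine ⟨hm.mul hm', C * C', fun x => ?_⟩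
  rw [abs_mul]
  exact mul_le_mul (hC x) (hC' x) (abs_nonneg _) ((abs_nonneg _).trans (hC x))

theorem pow (hF : BddMeas F) (k : ℕ) : BddMeas fun x => F x ^ k := by
  obtain ⟨hm, C, hC⟩ := hF
  refine ⟨hm.pow_const k, C ^ k, fun x => ?_⟩
  rw [abs_pow]
  exact pow_le_pow_left₀ (abs_nonneg _) (hC x) k

theorem sqrt (hF : BddMeas F) : BddMeas fun x => √(F x) := by
  obtain ⟨hm, C, hC⟩ := hF
  refine ⟨hm.sqrt, √C, fun x => ?_⟩
  rw [abs_of_nonneg (Real.sqrt_nonneg _)]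
  exact Real.sqrt_le_sqrt ((le_abs_self _).trans (hC x))

theorem sum {ι : Type*} {F : ι → α → ℝ} (s : Finset ι) (hF : ∀ i ∈ s, BddMeas (F i)) :
    BddMeas fun x => ∑ i ∈ s, F i x := by
  classical
  induction s using Finset.induction with
  | empty => simpa using const 0
  | insert i s hi ih =>
    simp only [Finset.sum_insert hi]
    exact (hF i (Finset.mem_insert_self i s)).add
      (ih fun j hj => hF j (Finset.mem_insert_of_mem hj))

theorem prod {ι : Type*} {F : ι → α → ℝ} (s : Finset ι) (hF : ∀ i ∈ s, BddMeas (F i)) :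
    BddMeas fun x => ∏ i ∈ s, F i x := by
  classical
  induction s using Finset.induction with
  | empty => simpa using const 1
  | insert i s hi ih =>
    simp only [Finset.prod_insert hi]
    exact (hF i (Finset.mem_insert_self i s)).mul
      (ih fun j hj => hF j (Finset.mem_insert_of_mem hj))

theorem comp (hF : BddMeas F) {φ : α' → α} (hφ : Measurable φ) : BddMeas fun x => F (φ x) := by
  obtain ⟨hm, C, hC⟩ := hF
  exact ⟨hm.comp hφ, C, fun x => hC _⟩

theorem integral_right {F : α → α' → ℝ} (hF : BddMeas (Function.uncurry F)) (μ : Measure α')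
    [IsProbabilityMeasure μ] : BddMeas fun x => ∫ y, F x y ∂μ := by
  obtain ⟨hm, C, hC⟩ := hF
  refine ⟨hm.stronglyMeasurable.integral_prod_right'.measurable, C, fun x => ?_⟩
  refine (norm_integral_le_of_norm_le_const (f := F x) (C := C)
    (Filter.Eventually.of_forall fun y => hC (x, y))).trans ?_
  simp

end BddMeas

/-- The indicator that the gaps at the times before `t` all exceed `ε / 2`. -/
noncomputable def alive {d : ℕ} (f : E d → ℝ) (xs : E d) (ε : ℝ) (p : ℕ → E d) (t : ℕ) : ℝ :=
  ∏ s ∈ Finset.range t, if ε / 2 < f (p s) - f xs then 1 else 0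

/-- The squared distance to `xs` at time `t`, plus the decrease that was to be expected from the
gaps at the earlier times. -/
noncomputable def potential {d : ℕ} (f : E d → ℝ) (xs : E d) (μ : ℝ) (p : ℕ → E d) (t : ℕ) : ℝ :=
  ‖p t - xs‖ ^ 2 + μ * ∑ s ∈ Finset.range t, √(f (p s) - f xs)

section Path

variable {d : ℕ} {f : E d → ℝ} {xs : E d} {ε μ : ℝ} {p q : ℕ → E d} {t : ℕ}

theorem alive_succ : alive f xs ε p (t + 1)
    = alive f xs ε p t * if ε / 2 < f (p t) - f xs then 1 else 0 := Finset.prod_range_succ _ _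

theorem alive_eq_zero_or_one (f : E d → ℝ) (xs : E d) (ε : ℝ) (p : ℕ → E d) (t : ℕ) :
    alive f xs ε p t = 0 ∨ alive f xs ε p t = 1 := by
  induction t with
  | zero => right; simp [alive]
  | succ t ih =>
    rw [alive_succ]
    rcases ih with h | h <;> rw [h] <;> split_ifs <;> simp

theorem alive_nonneg : 0 ≤ alive f xs ε p t := by
  rcases alive_eq_zero_or_one f xs ε p t with h | h <;> simp [h]

theorem gap_of_alive {s : ℕ} (h : alive f xs ε p t ≠ 0) (hs : s < t) :
    ε / 2 < f (p s) - f xs := by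
  by_contra hc
  exact h (Finset.prod_eq_zero (Finset.mem_range.2 hs) (if_neg hc))

theorem exists_of_alive_eq_zero (h : alive f xs ε p t = 0) : ∃ s < t, f (p s) - f xs ≤ ε / 2 := by
  obtain ⟨s, hs, h0⟩ := Finset.prod_eq_zero_iff.1 h
  refine ⟨s, Finset.mem_range.1 hs, ?_⟩
  by_contra hc
  rw [if_pos (not_le.1 hc)] at h0
  exact one_ne_zero h0

theorem alive_congr (h : ∀ s < t, p s = q s) : alive f xs ε p t = alive f xs ε q t :=
  Finset.prod_congr rfl fun s hs => by rw [h s (Finset.mem_range.1 hs)]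

theorem potential_congr (h : ∀ s ≤ t, p s = q s) : potential f xs μ p t = potential f xs μ q t := by
  unfold potential
  rw [h t le_rfl, Finset.sum_congr rfl fun s hs => by rw [h s (Finset.mem_range.1 hs).le]]

theorem potential_succ : potential f xs μ p (t + 1)
    = potential f xs μ p t - ‖p t - xs‖ ^ 2 + ‖p (t + 1) - xs‖ ^ 2 + μ * √(f (p t) - f xs) := by
  rw [potential, potential, Finset.sum_range_succ]; ring

theorem sq_norm_le_potential (hμ : 0 ≤ μ) : ‖p t - xs‖ ^ 2 ≤ potential f xs μ p t :=
  le_add_of_nonneg_right (mul_nonneg hμ (Finset.sum_nonneg fun _ _ => Real.sqrt_nonneg _))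

theorem potential_nonneg (hμ : 0 ≤ μ) : 0 ≤ potential f xs μ p t :=
  (sq_nonneg _).trans (sq_norm_le_potential hμ)

end Path

/-- The points visited by the algorithm run with the unit directions `u`. -/
noncomputable def path {d ℓ : ℕ} (f : E d → ℝ) (win : (Cube ℓ → E d) → Cube ℓ) (K : Set (E d))
    (η γ : ℝ) (w₁ : E d) (u : ℕ → Dirs d ℓ) (t : ℕ) : E d := (traj f win K η γ w₁ u t).point

theorem path_congr {d ℓ : ℕ} {f : E d → ℝ} {win : (Cube ℓ → E d) → Cube ℓ} {K : Set (E d)}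
    {η γ : ℝ} {w₁ : E d} {u u' : ℕ → Dirs d ℓ} {t : ℕ} (h : ∀ s < t, u s = u' s) {s : ℕ}
    (hs : s ≤ t) : path f win K η γ w₁ u s = path f win K η γ w₁ u' s := by
  rw [path, path, traj_congr fun r hr => h r (hr.trans_le hs)]

section Expectation

variable {d ℓ : ℕ} {Ω : Type*} [MeasurableSpace Ω] {P : Measure Ω}
  [IsProbabilityMeasure P] {U : ℕ → Fin ℓ → Ω → Sph d}

theorem measurable_seq (hU : ∀ t i, Measurable (U t i)) :
    Measurable fun ω : Ω => (fun s i => U s i ω : ℕ → Dirs d ℓ) :=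
  measurable_pi_lambda _ fun s => measurable_pi_lambda _ fun i => hU s i

/-- A pathwise bound `Φ u ≤ ψ u (u t)` together with a bound on the mean of `ψ u` over the
directions of round `t` gives a bound in expectation. -/
theorem integral_le_of_round [NeZero d] (hU : ∀ t i, Measurable (U t i))
    (hlaw : ∀ t i, P.map (U t i) = sphereUnif d)
    (hind : iIndepFun (fun p : ℕ × Fin ℓ => U p.1 p.2) P) {t : ℕ}
    {ψ : (ℕ → Dirs d ℓ) → Dirs d ℓ → ℝ} (hψ : BddMeas (Function.uncurry ψ))
    (hloc : ∀ u u' V, (∀ s < t, u s = u' s) → ψ u V = ψ u' V)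
    {Φ G : (ℕ → Dirs d ℓ) → ℝ} (hΦ : BddMeas Φ) (hG : BddMeas G)
    (h1 : ∀ u, Φ u ≤ ψ u (u t)) (h2 : ∀ u, ∫ V, ψ u V ∂dirMeas d ℓ ≤ G u) :
    ∫ ω, Φ (fun s i => U s i ω) ∂P ≤ ∫ ω, G (fun s i => U s i ω) ∂P := by
  have hs := measurable_seq hU
  have hI : Integrable (fun ω => ψ (fun s i => U s i ω) (fun i => U t i ω)) P :=
    (hψ.comp (hs.prodMk (measurable_pi_lambda _ fun i => hU t i))).integrable P
  refine (integral_mono ((hΦ.comp hs).integrable P) hI fun ω => h1 _).trans ?_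
  rw [integral_past_present hU hlaw hind hψ.1 hloc hI]
  exact integral_mono (((hψ.integral_right _).comp hs).integrable P)
    ((hG.comp hs).integrable P) fun ω => h2 _

end Expectation

section Convergence

variable {d ℓ : ℕ} [NeZero ℓ] {f : E d → ℝ} {win : (Cube ℓ → E d) → Cube ℓ}
  {xs w₁ : E d} {K : Set (E d)} {β D ε η γ : ℝ}

theorem bddMeas_norm_path (hwin : IsWinnerOracle f win) (hK : IsClosed K) (hKc : Convex ℝ K)
    (hxs : xs ∈ K) (t : ℕ) :
    BddMeas fun u : ℕ → Dirs d ℓ => ‖path f win K η γ w₁ u t - xs‖ := by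
  refine ⟨((measurable_point hwin hK hKc ⟨xs, hxs⟩ t).sub_const xs).norm,
    ‖w₁ - xs‖ + t * |η|, fun u => ?_⟩
  rw [abs_of_nonneg (norm_nonneg _)]
  exact norm_point_sub_le hK hKc hxs t

theorem bddMeas_distChange (hwin : IsWinnerOracle f win) (hK : IsClosed K) (hKc : Convex ℝ K)
    (hxs : xs ∈ K) (t : ℕ) :
    BddMeas fun p : (ℕ → Dirs d ℓ) × Dirs d ℓ =>
      distChange win η γ xs (path f win K η γ w₁ p.1 t) p.2 := by
  have hp : Measurable fun u : ℕ → Dirs d ℓ => path f win K η γ w₁ u t :=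
    measurable_point hwin hK hKc ⟨xs, hxs⟩ t
  refine ⟨Measurable.comp (g := fun p : E d × Dirs d ℓ => distChange win η γ xs p.1 p.2)
    hwin.measurable_distChange
    (f := fun p : (ℕ → Dirs d ℓ) × Dirs d ℓ => (path f win K η γ w₁ p.1 t, p.2))
    ((hp.comp measurable_fst).prodMk measurable_snd), ?_⟩
  refine ⟨2 * |η| * (‖w₁ - xs‖ + t * |η|) + η ^ 2, fun p => (abs_distChange_le _ _).trans ?_⟩
  gcongr
  exact norm_point_sub_le hK hKc hxs t

namespace Setting

variable (S : Setting f win xs β D ε η γ)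
include S

theorem bddMeas_gap (hK : IsClosed K) (hKc : Convex ℝ K) (hxs : xs ∈ K) (t : ℕ) :
    BddMeas fun u : ℕ → Dirs d ℓ => f (path f win K η γ w₁ u t) - f xs := by
  obtain ⟨-, C, hC⟩ := bddMeas_norm_path (η := η) (γ := γ) (w₁ := w₁) S.oracle hK hKc hxs t
  have hp : Measurable fun u : ℕ → Dirs d ℓ => path f win K η γ w₁ u t :=
    measurable_point S.oracle hK hKc ⟨xs, hxs⟩ t
  have hβ := S.β_pos
  refine ⟨(S.smooth.1.continuous.measurable.comp hp).sub_const _, β / 2 * C ^ 2, fun u => ?_⟩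
  rw [abs_of_nonneg (S.gap_nonneg _)]
  refine (S.smooth.sub_min_le S.isMin _).trans ?_
  gcongr
  exact (le_abs_self _).trans (hC u)

theorem bddMeas_alive (hK : IsClosed K) (hKc : Convex ℝ K) (hxs : xs ∈ K) (t : ℕ) :
    BddMeas fun u : ℕ → Dirs d ℓ => alive f xs ε (path f win K η γ w₁ u) t := by
  refine BddMeas.prod _ fun s _ => ⟨Measurable.ite
    (measurableSet_lt measurable_const (S.bddMeas_gap hK hKc hxs s).1) measurable_const
    measurable_const, 1, fun u => ?_⟩
  dsimp only
  split_ifs <;> simp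

theorem bddMeas_potential (hK : IsClosed K) (hKc : Convex ℝ K) (hxs : xs ∈ K) (μ : ℝ) (t : ℕ) :
    BddMeas fun u : ℕ → Dirs d ℓ => potential f xs μ (path f win K η γ w₁ u) t :=
  ((bddMeas_norm_path S.oracle hK hKc hxs t).pow 2).add
    ((BddMeas.const μ).mul (BddMeas.sum _ fun s _ => (S.bddMeas_gap hK hKc hxs s).sqrt))

variable [NeZero d] {Ω : Type*} [MeasurableSpace Ω] {P : Measure Ω} [IsProbabilityMeasure P]
  {U : ℕ → Fin ℓ → Ω → Sph d}

/-- As long as the gap is large, the mean squared distance grows only by the error of the signs. -/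
theorem integral_sq_norm_succ_le (hK : IsClosed K) (hKc : Convex ℝ K) (hxs : xs ∈ K)
    (hU : ∀ t i, Measurable (U t i)) (hlaw : ∀ t i, P.map (U t i) = sphereUnif d)
    (hind : iIndepFun (fun p : ℕ × Fin ℓ => U p.1 p.2) P) (t : ℕ) :
    ∫ ω, alive f xs ε (path f win K η γ w₁ fun s i => U s i ω) (t + 1)
        * ‖path f win K η γ w₁ (fun s i => U s i ω) (t + 1) - xs‖ ^ 2 ∂P
      ≤ (1 + growthRate d β D ε η) *
        ∫ ω, alive f xs ε (path f win K η γ w₁ fun s i => U s i ω) t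
          * ‖path f win K η γ w₁ (fun s i => U s i ω) t - xs‖ ^ 2 ∂P := by
  have hal := S.bddMeas_alive (w₁ := w₁) hK hKc hxs
  have hno := bddMeas_norm_path (η := η) (γ := γ) (w₁ := w₁) S.oracle hK hKc hxs
  have hdc := bddMeas_distChange (η := η) (γ := γ) (w₁ := w₁) S.oracle hK hKc hxs t
  rw [← integral_const_mul]
  refine integral_le_of_round hU hlaw hind (t := t)
    (ψ := fun u V => alive f xs ε (path f win K η γ w₁ u) (t + 1)
      * (‖path f win K η γ w₁ u t - xs‖ ^ 2
        + distChange win η γ xs (path f win K η γ w₁ u t) V))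
    (Φ := fun u => alive f xs ε (path f win K η γ w₁ u) (t + 1)
      * ‖path f win K η γ w₁ u (t + 1) - xs‖ ^ 2)
    (G := fun u => (1 + growthRate d β D ε η) * (alive f xs ε (path f win K η γ w₁ u) t
      * ‖path f win K η γ w₁ u t - xs‖ ^ 2)) ?_ ?_ ?_ ?_ ?_ ?_
  · exact ((hal (t + 1)).comp measurable_fst).mul
      ((((hno t).pow 2).comp measurable_fst).add hdc)
  · intro u u' V h
    rw [alive_congr (q := path f win K η γ w₁ u') fun s hs => path_congr h (Nat.lt_succ_iff.1 hs),
      path_congr h le_rfl]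
  · exact (hal (t + 1)).mul ((hno (t + 1)).pow 2)
  · exact (BddMeas.const _).mul ((hal t).mul ((hno t).pow 2))
  · exact fun u => mul_le_mul_of_nonneg_left (sq_norm_point_succ_le hK hKc hxs) alive_nonneg
  · intro u
    have hI : Integrable (fun V => distChange win η γ xs (path f win K η γ w₁ u t) V)
        (dirMeas d ℓ) := by simpa using S.integrable_distChange (path f win K η γ w₁ u t) 1
    rw [integral_const_mul, integral_add (integrable_const _) hI]
    simp only [integral_const, probReal_univ, smul_eq_mul, one_mul]
    have hg := S.growthRate_nonneg
    rcases alive_eq_zero_or_one f xs ε (path f win K η γ w₁ u) (t + 1) with h0 | h1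
    · rw [h0, zero_mul]
      have := alive_nonneg (f := f) (xs := xs) (ε := ε) (p := path f win K η γ w₁ u) (t := t)
      positivity
    · have hw := gap_of_alive (by rw [h1]; exact one_ne_zero) t.lt_succ_self
      have h1' : alive f xs ε (path f win K η γ w₁ u) t = 1 := by
        rcases alive_eq_zero_or_one f xs ε (path f win K η γ w₁ u) t with h | h
        · rw [alive_succ, h, zero_mul] at h1; exact absurd h1 zero_ne_one
        · exact h
      have hd := S.integral_distChange_le hw
      have : 0 ≤ driftRate d β η * √(f (path f win K η γ w₁ u t) - f xs) :=
        mul_nonneg S.driftRate_pos.le (Real.sqrt_nonneg _)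
      rw [h1, h1']
      linarith

/-- As long as the gap is large, the second moment of the potential grows only by the error of the
signs and by the variance of the round. -/
theorem integral_potential_sq_succ_le (hK : IsClosed K) (hKc : Convex ℝ K) (hxs : xs ∈ K)
    (hU : ∀ t i, Measurable (U t i)) (hlaw : ∀ t i, P.map (U t i) = sphereUnif d)
    (hind : iIndepFun (fun p : ℕ × Fin ℓ => U p.1 p.2) P) (t : ℕ) :
    ∫ ω, alive f xs ε (path f win K η γ w₁ fun s i => U s i ω) (t + 1)
        * potential f xs (driftRate d β η) (path f win K η γ w₁ fun s i => U s i ω) (t + 1) ^ 2 ∂P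
      ≤ (1 + (2 * growthRate d β D ε η + η ^ 2 / (10 * ℓ * D))) *
        ∫ ω, alive f xs ε (path f win K η γ w₁ fun s i => U s i ω) t
          * potential f xs (driftRate d β η) (path f win K η γ w₁ fun s i => U s i ω) t ^ 2 ∂P
        + 32 * η ^ 2 / ℓ *
          ∫ ω, alive f xs ε (path f win K η γ w₁ fun s i => U s i ω) t
            * ‖path f win K η γ w₁ (fun s i => U s i ω) t - xs‖ ^ 2 ∂P := by
  have hal := S.bddMeas_alive (w₁ := w₁) hK hKc hxs
  have hno := bddMeas_norm_path (η := η) (γ := γ) (w₁ := w₁) S.oracle hK hKc hxs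
  have hdc := bddMeas_distChange (η := η) (γ := γ) (w₁ := w₁) S.oracle hK hKc hxs t
  have hpo := S.bddMeas_potential (w₁ := w₁) hK hKc hxs (driftRate d β η)
  have hga := (S.bddMeas_gap (w₁ := w₁) hK hKc hxs t).sqrt
  have hs := measurable_seq hU
  have hμ := S.driftRate_pos
  rw [← integral_const_mul, ← integral_const_mul, ← integral_add]
  rotate_left
  · exact (((BddMeas.const _).mul ((hal t).mul ((hpo t).pow 2))).comp hs).integrable P
  · exact (((BddMeas.const _).mul ((hal t).mul ((hno t).pow 2))).comp hs).integrable P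
  refine integral_le_of_round hU hlaw hind (t := t)
    (ψ := fun u V => alive f xs ε (path f win K η γ w₁ u) (t + 1)
      * (potential f xs (driftRate d β η) (path f win K η γ w₁ u) t
        + (distChange win η γ xs (path f win K η γ w₁ u t) V
          + driftRate d β η * √(f (path f win K η γ w₁ u t) - f xs))) ^ 2)
    (Φ := fun u => alive f xs ε (path f win K η γ w₁ u) (t + 1)
      * potential f xs (driftRate d β η) (path f win K η γ w₁ u) (t + 1) ^ 2)
    (G := fun u => (1 + (2 * growthRate d β D ε η + η ^ 2 / (10 * ℓ * D)))
        * (alive f xs ε (path f win K η γ w₁ u) t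
          * potential f xs (driftRate d β η) (path f win K η γ w₁ u) t ^ 2)
      + 32 * η ^ 2 / ℓ * (alive f xs ε (path f win K η γ w₁ u) t
          * ‖path f win K η γ w₁ u t - xs‖ ^ 2)) ?_ ?_ ?_ ?_ ?_ ?_
  · exact ((hal (t + 1)).comp measurable_fst).mul ((((hpo t).comp measurable_fst).add
      (hdc.add (((BddMeas.const _).mul hga).comp measurable_fst))).pow 2)
  · intro u u' V h
    rw [alive_congr (q := path f win K η γ w₁ u') fun s hs => path_congr h (Nat.lt_succ_iff.1 hs),
      potential_congr (q := path f win K η γ w₁ u') fun s hs => path_congr h hs,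
      path_congr h le_rfl]
  · exact (hal (t + 1)).mul ((hpo (t + 1)).pow 2)
  · exact ((BddMeas.const _).mul ((hal t).mul ((hpo t).pow 2))).add
      ((BddMeas.const _).mul ((hal t).mul ((hno t).pow 2)))
  · intro u
    refine mul_le_mul_of_nonneg_left ?_ alive_nonneg
    refine pow_le_pow_left₀ (potential_nonneg hμ.le) ?_ 2
    rw [potential_succ]
    have : ‖path f win K η γ w₁ u (t + 1) - xs‖ ^ 2 ≤ ‖path f win K η γ w₁ u t - xs‖ ^ 2
        + distChange win η γ xs (path f win K η γ w₁ u t) (u t) :=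
      sq_norm_point_succ_le hK hKc hxs
    linarith
  · intro u
    set w := path f win K η γ w₁ u t with hwdef
    set Z := potential f xs (driftRate d β η) (path f win K η γ w₁ u) t with hZ
    set b := driftRate d β η * √(f w - f xs) with hb
    have hg := S.growthRate_nonneg
    have hD := S.D_pos
    have hZ0 : 0 ≤ Z := potential_nonneg hμ.le
    have hZa : ‖w - xs‖ ^ 2 ≤ Z := sq_norm_le_potential hμ.le
    have hal0 := alive_nonneg (f := f) (xs := xs) (ε := ε) (p := path f win K η γ w₁ u) (t := t)
    rcases alive_eq_zero_or_one f xs ε (path f win K η γ w₁ u) (t + 1) with h0 | h1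
    · simp only [h0, zero_mul, integral_zero]
      positivity
    · have hw : ε / 2 < f w - f xs :=
        gap_of_alive (by rw [h1]; exact one_ne_zero) t.lt_succ_self
      have h1' : alive f xs ε (path f win K η γ w₁ u) t = 1 := by
        rcases alive_eq_zero_or_one f xs ε (path f win K η γ w₁ u) t with h | h
        · rw [alive_succ, h, zero_mul] at h1; exact absurd h1 zero_ne_one
        · exact h
      have hd := S.integral_distChange_le hw
      have hd2 := S.integral_distChange_add_sq_le hw
      rw [← hb] at hd hd2
      have i1 : Integrable (fun V => distChange win η γ xs w V) (dirMeas d ℓ) := by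
        simpa using S.integrable_distChange w 1
      have i2 : Integrable (fun V => (distChange win η γ xs w V + b) ^ 2) (dirMeas d ℓ) := by
        have e : ∀ V, (distChange win η γ xs w V + b) ^ 2 = distChange win η γ xs w V ^ 2
          + 2 * b * distChange win η γ xs w V + b ^ 2 := fun V => by ring
        simp only [e]
        exact ((S.integrable_distChange w 2).add (i1.const_mul _)).add (integrable_const _)
      have e : ∀ V, (Z + (distChange win η γ xs w V + b)) ^ 2 = (Z ^ 2 + 2 * Z * b)
          + 2 * Z * distChange win η γ xs w V + (distChange win η γ xs w V + b) ^ 2 :=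
        fun V => by ring
      simp only [h1, h1', one_mul, e]
      have i3 : Integrable (fun V => (Z ^ 2 + 2 * Z * b) + 2 * Z * distChange win η γ xs w V)
        (dirMeas d ℓ) := (integrable_const _).add (i1.const_mul _)
      rw [integral_add i3 i2, integral_add (integrable_const _) (i1.const_mul _),
        integral_const_mul]
      simp only [integral_const, probReal_univ, smul_eq_mul, one_mul]
      have t1 : 2 * Z * (∫ V, distChange win η γ xs w V ∂dirMeas d ℓ + b)
          ≤ 2 * Z * (growthRate d β D ε η * Z) := by
        gcongr
        exact hd.trans (by gcongr)
      have t2 : η ^ 2 / (10 * ℓ * D) * ‖w - xs‖ ^ 4 ≤ η ^ 2 / (10 * ℓ * D) * Z ^ 2 := by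
        gcongr
        calc ‖w - xs‖ ^ 4 = (‖w - xs‖ ^ 2) ^ 2 := by ring
          _ ≤ Z ^ 2 := by gcongr
      linarith

end Setting

end Convergence

/-! ### The gap of the returned point -/

/-- The coupled recursions for the squared distance and the squared potential stay bounded as long
as the accumulated growth rates do: `A` grows to at most `5 D / 4`, and then `B`, as long as it is at
most `80 D²`, to at most `(1 + 28 + 40) D²`. -/
theorem recursion_bound {A B : ℕ → ℝ} {ρ θ κ D : ℝ} {T : ℕ} (hD : 0 < D) (hρ : 0 ≤ ρ) (hθ : 0 ≤ θ)
    (hκ : 0 ≤ κ) (hA0 : A 0 ≤ D) (hB0 : B 0 ≤ D ^ 2) (hA : ∀ t, A (t + 1) ≤ (1 + ρ) * A t)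
    (hB : ∀ t, B (t + 1) ≤ (1 + (2 * ρ + θ)) * B t + κ * A t) (hρT : T * ρ ≤ 1 / 8)
    (hθT : T * θ ≤ 1 / 10) (hκT : T * κ ≤ 32 * D) : B T ≤ 80 * D ^ 2 := by
  have hmono : ∀ t ≤ T, ∀ x : ℝ, 0 ≤ x → (t : ℝ) * x ≤ T * x := fun t ht x hx => by
    gcongr
  have hA' : ∀ t ≤ T, A t ≤ D + t * (2 * ρ * D) := by
    intro t
    induction t with
    | zero => intro _; simpa using hA0
    | succ t ih =>
      intro ht
      have h1 := ih (by omega)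
      have h2 := hmono t (by omega) (ρ * D) (by positivity)
      have h3 : T * (ρ * D) ≤ 1 / 8 * D := by
        rw [← mul_assoc]; exact mul_le_mul_of_nonneg_right hρT hD.le
      have h4 : A t ≤ 2 * D := by nlinarith
      have h5 := mul_le_mul_of_nonneg_left h4 hρ
      push_cast
      linarith [hA t]
  have hA2 : ∀ t ≤ T, A t ≤ 5 / 4 * D := fun t ht => by
    have h1 := hA' t ht
    have h2 := hmono t ht (ρ * D) (by positivity)
    have h3 : T * (ρ * D) ≤ 1 / 8 * D := by
      rw [← mul_assoc]; exact mul_le_mul_of_nonneg_right hρT hD.le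
    nlinarith
  have hB' : ∀ t ≤ T, B t ≤ D ^ 2 + t * ((2 * ρ + θ) * (80 * D ^ 2) + κ * (5 / 4 * D)) := by
    intro t
    induction t with
    | zero => intro _; simpa using hB0
    | succ t ih =>
      intro ht
      have h1 := ih (by omega)
      have h2 := hmono t (by omega) ((2 * ρ + θ) * (80 * D ^ 2) + κ * (5 / 4 * D)) (by positivity)
      have h3 : T * ((2 * ρ + θ) * (80 * D ^ 2) + κ * (5 / 4 * D))
          ≤ (2 * (1 / 8) + 1 / 10) * (80 * D ^ 2) + 32 * D * (5 / 4 * D) := by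
        calc _ = (2 * (T * ρ) + T * θ) * (80 * D ^ 2) + T * κ * (5 / 4 * D) := by ring
          _ ≤ _ := by gcongr
      have h4 : B t ≤ 80 * D ^ 2 := by nlinarith [sq_nonneg D]
      have h5 := mul_le_mul_of_nonneg_left h4 (show 0 ≤ 2 * ρ + θ by positivity)
      have h6 := mul_le_mul_of_nonneg_left (hA2 t (by omega)) hκ
      push_cast
      linarith [hB t]
  have h1 := hB' T le_rfl
  have h3 : T * ((2 * ρ + θ) * (80 * D ^ 2) + κ * (5 / 4 * D))
      ≤ (2 * (1 / 8) + 1 / 10) * (80 * D ^ 2) + 32 * D * (5 / 4 * D) := by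
    calc _ = (2 * (T * ρ) + T * θ) * (80 * D ^ 2) + T * κ * (5 / 4 * D) := by ring
      _ ≤ _ := by gcongr
  nlinarith [sq_nonneg D]

namespace Setting

variable {d ℓ : ℕ} {f : E d → ℝ} {win : (Cube ℓ → E d) → Cube ℓ}
  {xs w₁ : E d} {K : Set (E d)} {β D ε η γ : ℝ} (S : Setting f win xs β D ε η γ)
include S

theorem η_sq : η ^ 2 = ℓ ^ 2 * ε / (400 * (d * β)) := by
  have hβ := S.β_pos
  rw [S.η_eq, div_pow, mul_pow, mul_pow, Real.sq_sqrt S.ε_pos.le, Real.sq_sqrt (by positivity)]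
  norm_num

theorem bddMeas_gap_best (hK : IsClosed K) (hKc : Convex ℝ K) (hxs : xs ∈ K) (T : ℕ) :
    BddMeas fun u : ℕ → Dirs d ℓ => f (traj f win K η γ w₁ u T).best - f xs := by
  have hf := S.smooth.1.continuous.measurable
  refine ⟨(hf.comp (measurable_best hf S.oracle hK hKc ⟨xs, hxs⟩ T)).sub_const _, f w₁ - f xs,
    fun u => ?_⟩
  rw [abs_of_nonneg (S.gap_nonneg _)]
  have : f (traj f win K η γ w₁ u T).best ≤ f w₁ := best_le_point (s := 0) T.zero_le
  linarith

variable [NeZero d] [NeZero ℓ]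

/-- The accumulated growth rates over `T ≤ 400 d β D / (ε ℓ)` rounds. -/
theorem accumulated_rates {T : ℕ} (hT : (T : ℝ) ≤ 400 * (d * β * D / (ε * ℓ))) :
    T * η ^ 2 ≤ ℓ * D ∧ T * growthRate d β D ε η ≤ 1 / 8 := by
  have hβ := S.β_pos
  have hε := S.ε_pos
  have hD := S.D_pos
  have hη := S.η_pos
  have hd : (0 : ℝ) < d := by exact_mod_cast NeZero.pos d
  have hℓ : (0 : ℝ) < ℓ := by exact_mod_cast NeZero.pos ℓ
  constructor
  · calc T * η ^ 2 ≤ 400 * (d * β * D / (ε * ℓ)) * η ^ 2 := by gcongr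
      _ = ℓ * D := by rw [S.η_sq]; field_simp
  · have hg := S.growthRate_nonneg
    have hσ := one_le_sqrt_natCast d
    calc T * growthRate d β D ε η ≤ 400 * (d * β * D / (ε * ℓ)) * growthRate d β D ε η := by
          gcongr
      _ = 400 * (d * β * D / (ε * ℓ)) * (ℓ * √(ε / β) ^ 2 / (20 * √d * (160 * d * D))) := by
          rw [growthRate, S.η_eq']; ring
      _ = 1 / (8 * √d) := by
          rw [Real.sq_sqrt (by positivity)]; field_simp; norm_num
      _ ≤ 1 / (8 * 1) := by gcongr
      _ = 1 / 8 := by norm_num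

/-- The accumulated drift over the prescribed number of rounds, unless the initial point is
already good enough. -/
theorem accumulated_drift (hεD : ε < β / 2 * D) {T : ℕ}
    (hT : T = ⌊400 * (d * β * D / (ε * ℓ))⌋₊) :
    324 * D ^ 2 / ε ≤ (driftRate d β η * T) ^ 2 := by
  have hβ := S.β_pos
  have hε := S.ε_pos
  have hD := S.D_pos
  have hd : (0 : ℝ) < d := by exact_mod_cast NeZero.pos d
  have hℓ : (0 : ℝ) < ℓ := by exact_mod_cast NeZero.pos ℓ
  have hℓd : (ℓ : ℝ) ≤ d := by exact_mod_cast S.le_dim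
  set X := 400 * (d * β * D / (ε * ℓ)) with hX
  have hX0 : 0 ≤ X := by positivity
  have hX1 : 800 ≤ X := by
    have : 2 ≤ d * β * D / (ε * ℓ) := by
      rw [le_div_iff₀ (by positivity)]
      nlinarith [mul_le_mul_of_nonneg_left hℓd hε.le, mul_le_mul_of_nonneg_left hεD.le hd.le]
    linarith
  have hT1 : 0.9 * X ≤ T := by
    have := Nat.lt_floor_add_one X
    rw [← hT] at this
    linarith
  calc 324 * D ^ 2 / ε = η ^ 2 / (d * β) * (0.9 * X) ^ 2 := by
        rw [S.η_sq, hX]; field_simp; norm_num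
    _ ≤ η ^ 2 / (d * β) * T ^ 2 := by gcongr
    _ = (driftRate d β η * T) ^ 2 := by
        rw [driftRate, mul_pow, div_pow, Real.sq_sqrt (by positivity)]

/-- The gap of the returned point is small, or it is controlled by the potential: if all gaps are
large, each of them contributes at least the root of the smallest one. -/
theorem gap_best_le (u : ℕ → Dirs d ℓ) {T : ℕ} (hT : 0 < driftRate d β η * T) :
    f (traj f win K η γ w₁ u T).best - f xs ≤ ε / 2
      + alive f xs ε (path f win K η γ w₁ u) T
        * potential f xs (driftRate d β η) (path f win K η γ w₁ u) T ^ 2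
          / (driftRate d β η * T) ^ 2 := by
  have hμ := S.driftRate_pos
  rcases alive_eq_zero_or_one f xs ε (path f win K η γ w₁ u) T with h0 | h1
  · obtain ⟨s, hs, hle⟩ := exists_of_alive_eq_zero h0
    rw [h0, zero_mul, zero_div, add_zero]
    have : f (traj f win K η γ w₁ u T).best ≤ f (path f win K η γ w₁ u s) := best_le_point hs.le
    linarith
  · rw [h1, one_mul]
    set Z := potential f xs (driftRate d β η) (path f win K η γ w₁ u) T with hZ
    have hg := S.gap_nonneg (traj f win K η γ w₁ u T).best
    have h2 : T * √(f (traj f win K η γ w₁ u T).best - f xs)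
        ≤ ∑ s ∈ Finset.range T, √(f (path f win K η γ w₁ u s) - f xs) := by
      have := Finset.card_nsmul_le_sum (Finset.range T)
        (fun s => √(f (path f win K η γ w₁ u s) - f xs))
        (√(f (traj f win K η γ w₁ u T).best - f xs)) fun s hs => by
          apply Real.sqrt_le_sqrt
          have : f (traj f win K η γ w₁ u T).best ≤ f (path f win K η γ w₁ u s) :=
            best_le_point (Finset.mem_range.1 hs).le
          linarith
      simpa using this
    have h3 : driftRate d β η * T * √(f (traj f win K η γ w₁ u T).best - f xs) ≤ Z := by
      rw [hZ, potential, mul_assoc]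
      have := mul_le_mul_of_nonneg_left h2 hμ.le
      nlinarith [sq_nonneg ‖path f win K η γ w₁ u T - xs‖]
    have h4 := pow_le_pow_left₀ (by positivity) h3 2
    rw [mul_pow, Real.sq_sqrt hg] at h4
    have h5 : f (traj f win K η γ w₁ u T).best - f xs ≤ Z ^ 2 / (driftRate d β η * T) ^ 2 := by
      rw [le_div_iff₀ (by positivity)]; linarith
    linarith [S.ε_pos]

variable {Ω : Type*} [MeasurableSpace Ω] {P : Measure Ω} [IsProbabilityMeasure P]
  {U : ℕ → Fin ℓ → Ω → Sph d}

/-- The expected gap of the returned point after the prescribed number of rounds, or more. -/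
theorem integral_gap_best_le (hK : IsClosed K) (hKc : Convex ℝ K) (hxs : xs ∈ K)
    (hU : ∀ t i, Measurable (U t i)) (hlaw : ∀ t i, P.map (U t i) = sphereUnif d)
    (hind : iIndepFun (fun p : ℕ × Fin ℓ => U p.1 p.2) P) (hw₁ : ‖w₁ - xs‖ ^ 2 ≤ D) {T : ℕ}
    (hT : ⌊400 * (d * β * D / (ε * ℓ))⌋₊ ≤ T) :
    ∫ ω, (f (traj f win K η γ w₁ (fun s i => U s i ω) T).best - f xs) ∂P ≤ ε := by
  have hβ := S.β_pos
  have hε := S.ε_pos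
  have hD := S.D_pos
  have hℓ : (0 : ℝ) < ℓ := by exact_mod_cast NeZero.pos ℓ
  have hs := measurable_seq hU
  have hbest : ∀ T, BddMeas fun u : ℕ → Dirs d ℓ => f (traj f win K η γ w₁ u T).best - f xs :=
    S.bddMeas_gap_best hK hKc hxs
  rcases le_or_gt (β / 2 * D) ε with hεD | hεD
  -- smoothness bounds the initial gap by `β D / 2`
  · have : ∀ ω, f (traj f win K η γ w₁ (fun s i => U s i ω) T).best - f xs ≤ ε := fun ω => by
      have h1 : f (traj f win K η γ w₁ (fun s i => U s i ω) T).best ≤ f w₁ :=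
        best_le_point (s := 0) T.zero_le
      have h2 := S.smooth.sub_min_le S.isMin w₁
      have h3 : β / 2 * ‖w₁ - xs‖ ^ 2 ≤ β / 2 * D := by gcongr
      linarith
    refine (integral_mono (((hbest T).comp hs).integrable P) (integrable_const ε) this).trans ?_
    simp
  set T₀ := ⌊400 * (d * β * D / (ε * ℓ))⌋₊ with hT₀
  have hdrift := S.accumulated_drift hεD hT₀
  obtain ⟨hr1, hr2⟩ := S.accumulated_rates (T := T₀) (Nat.floor_le (by positivity))
  have hpos : 0 < driftRate d β η * T₀ := by
    refine lt_of_le_of_ne (mul_nonneg S.driftRate_pos.le (Nat.cast_nonneg _)) fun h => ?_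
    rw [← h] at hdrift
    have : 0 < 324 * D ^ 2 / ε := by positivity
    linarith
  have hB := recursion_bound
    (A := fun t => ∫ ω, alive f xs ε (path f win K η γ w₁ fun s i => U s i ω) t
      * ‖path f win K η γ w₁ (fun s i => U s i ω) t - xs‖ ^ 2 ∂P)
    (B := fun t => ∫ ω, alive f xs ε (path f win K η γ w₁ fun s i => U s i ω) t
      * potential f xs (driftRate d β η) (path f win K η γ w₁ fun s i => U s i ω) t ^ 2 ∂P)
    (T := T₀) hD S.growthRate_nonneg (θ := η ^ 2 / (10 * ℓ * D)) (by positivity)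
    (κ := 32 * η ^ 2 / ℓ) (by positivity)
    (by simpa [alive, path, traj_zero] using hw₁)
    (by
      have := pow_le_pow_left₀ (sq_nonneg _) hw₁ 2
      simpa [alive, potential, path, traj_zero] using this)
    (S.integral_sq_norm_succ_le hK hKc hxs hU hlaw hind)
    (S.integral_potential_sq_succ_le hK hKc hxs hU hlaw hind) hr2
    (by
      rw [← mul_div_assoc, div_le_iff₀ (by positivity)]
      linarith)
    (by
      rw [← mul_div_assoc, div_le_iff₀ hℓ]
      linarith)
  have hap : BddMeas fun u : ℕ → Dirs d ℓ => alive f xs ε (path f win K η γ w₁ u) T₀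
      * potential f xs (driftRate d β η) (path f win K η γ w₁ u) T₀ ^ 2 :=
    (S.bddMeas_alive hK hKc hxs T₀).mul ((S.bddMeas_potential hK hKc hxs _ T₀).pow 2)
  have hle : ∀ ω, f (traj f win K η γ w₁ (fun s i => U s i ω) T).best - f xs
      ≤ ε / 2 + alive f xs ε (path f win K η γ w₁ fun s i => U s i ω) T₀
        * potential f xs (driftRate d β η) (path f win K η γ w₁ fun s i => U s i ω) T₀ ^ 2
          / (driftRate d β η * T₀) ^ 2 := fun ω => by
    have h1 : f (traj f win K η γ w₁ (fun s i => U s i ω) T).best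
      ≤ f (traj f win K η γ w₁ (fun s i => U s i ω) T₀).best := best_antitone hT
    have h2 := S.gap_best_le (K := K) (w₁ := w₁) (fun s i => U s i ω) hpos
    linarith
  have hI := ((hap.comp hs).integrable P).div_const ((driftRate d β η * T₀) ^ 2)
  refine (integral_mono (((hbest T).comp hs).integrable P)
    ((integrable_const (ε / 2)).add hI) hle).trans ?_
  rw [integral_add' (integrable_const _) hI]
  simp only [integral_const, probReal_univ, smul_eq_mul, one_mul]
  rw [integral_div]
  have h3 : (∫ ω, alive f xs ε (path f win K η γ w₁ fun s i => U s i ω) T₀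
      * potential f xs (driftRate d β η) (path f win K η γ w₁ fun s i => U s i ω) T₀ ^ 2 ∂P)
        / (driftRate d β η * T₀) ^ 2 ≤ ε / 2 := by
    rw [div_le_iff₀ (by positivity)]
    refine hB.trans ?_
    calc 80 * D ^ 2 ≤ ε / 2 * (324 * D ^ 2 / ε) := by
          have : ε / 2 * (324 * D ^ 2 / ε) = 162 * D ^ 2 := by field_simp; norm_num
          rw [this]; nlinarith [sq_nonneg D]
      _ ≤ _ := by gcongr
  linarith

end Setting

section Lift

variable {d : ℕ}

/-- The radial projection onto the unit sphere, with an arbitrary value `x₀` at the origin. -/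
noncomputable def radial (x₀ : Sph d) (x : E d) : Sph d :=
  if h : x = 0 then x₀ else ⟨‖x‖⁻¹ • x, by simp [norm_smul, h]⟩

theorem measurable_radial (x₀ : Sph d) : Measurable (radial x₀) := by
  refine Measurable.subtype_mk (f := fun x : E d => ((radial x₀ x : Sph d) : E d)) ?_
  have : (fun x : E d => ((radial x₀ x : Sph d) : E d))
      = fun x => if x = 0 then (x₀ : E d) else ‖x‖⁻¹ • x := by
    funext x; unfold radial; split_ifs <;> rfl
  rw [this]
  exact Measurable.ite (measurableSet_singleton 0) measurable_const (by fun_prop)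

theorem radial_smul (x₀ : Sph d) {r : ℝ} (hr : 0 < r) (x : Sph d) :
    radial x₀ (r • (x : E d)) = x := by
  have hx : (x : E d) ≠ 0 := fun h => by simpa [h] using x.norm_eq
  apply Subtype.ext
  rw [radial, dif_neg (smul_ne_zero hr.ne' hx)]
  simp [norm_smul, abs_of_pos hr, smul_smul, hr.ne']

theorem measurable_smul_sph (r : ℝ) : Measurable fun x : Sph d => r • (x : E d) := by fun_prop

theorem map_radial_uniformSphere (x₀ : Sph d) {r : ℝ} (hr : 0 < r) :
    (uniformSphere d r).map (radial x₀) = sphereUnif d := by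
  rw [uniformSphere_eq_map, Measure.map_map (measurable_radial x₀) (measurable_smul_sph r)]
  have : radial x₀ ∘ (fun x : Sph d => r • (x : E d)) = id := funext fun x => radial_smul x₀ hr x
  rw [this, Measure.map_id]

theorem ae_uniformSphere (x₀ : Sph d) {r : ℝ} (hr : 0 < r) :
    ∀ᵐ x ∂uniformSphere d r, x = r • (radial x₀ x : E d) := by
  have := measurable_radial x₀
  rw [uniformSphere_eq_map, ae_map_iff (measurable_smul_sph r).aemeasurable
    (measurableSet_eq_fun (by fun_prop) (by fun_prop))]
  exact Filter.Eventually.of_forall fun x => by rw [radial_smul x₀ hr]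

/-- Independent uniform vectors on a sphere are almost surely multiples of independent uniform
points of the unit sphere. -/
theorem exists_sph_lift [NeZero d] {ι Ω : Type*} [MeasurableSpace Ω] {P : Measure Ω}
    [IsProbabilityMeasure P] {r : ℝ} (hr : 0 < r) {u : ι → Ω → E d}
    (hlaw : ∀ p, HasLaw (u p) (uniformSphere d r) P) (hind : iIndepFun u P) :
    ∃ U : ι → Ω → Sph d, (∀ p, Measurable (U p)) ∧ (∀ p, P.map (U p) = sphereUnif d) ∧
      iIndepFun U P ∧ ∀ p, ∀ᵐ ω ∂P, u p ω = r • (U p ω : E d) := by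
  let x₀ : Sph d := Classical.arbitrary _
  have hm := measurable_radial x₀
  let v : ι → Ω → E d := fun p => (hlaw p).aemeasurable.mk (u p)
  have hv : ∀ p, Measurable (v p) := fun p => (hlaw p).aemeasurable.measurable_mk
  have huv : ∀ p, u p =ᵐ[P] v p := fun p => (hlaw p).aemeasurable.ae_eq_mk
  have hvlaw : ∀ p, P.map (v p) = uniformSphere d r := fun p => by
    rw [← Measure.map_congr (huv p), (hlaw p).map_eq]
  refine ⟨fun p => radial x₀ ∘ v p, fun p => hm.comp (hv p), fun p => ?_,
    (hind.congr huv).comp _ fun _ => hm, fun p => ?_⟩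
  · rw [← Measure.map_map hm (hv p), hvlaw, map_radial_uniformSphere x₀ hr]
  · have h := ae_uniformSphere x₀ hr
    rw [← hvlaw p] at h
    filter_upwards [huv p, ae_of_ae_map (hv p).aemeasurable h] with ω h1 h2
    rw [h1]; exact h2

end Lift

theorem le_errLevel {β γ G : ℝ} {d ℓ : ℕ} (hβ : 0 ≤ β) (hγ : 0 ≤ γ) (hG : 0 ≤ G) :
    β * γ * √((d : ℝ) * ℓ) / G ≤ errLevel β γ d ℓ G := by
  have := Real.sqrt_nonneg (Real.log (G / (β * γ * √((d : ℝ) * ℓ))))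
  exact le_mul_of_one_le_right (by positivity) (by linarith)

end BattlingNGD

/-! ### Assembling the statement -/

open BattlingNGD in
theorem mainTheorem3 :
    ∃ C : ℝ, 0 < C ∧ ∃ c : ℕ → ℝ, (∀ d : ℕ, 1 ≤ d → 1 / 20 ≤ c d ∧ c d ≤ 1) ∧
      ∀ (d m ℓ : ℕ), 2 ≤ m → ℓ = Nat.log 2 m → ℓ ≤ d →
      ∀ (K : Set (BattlingNGD.E d)), IsClosed K → Convex ℝ K →
      ∀ (f : BattlingNGD.E d → ℝ) (β : ℝ), 0 < β →
        ConvexOn ℝ Set.univ f → BattlingNGD.IsSmooth β f →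
      ∀ (win : (BattlingNGD.Cube ℓ → BattlingNGD.E d) → BattlingNGD.Cube ℓ),
        BattlingNGD.IsWinnerOracle f win →
      ∀ (Ω : Type*) [MeasurableSpace Ω] (P : Measure Ω) [IsProbabilityMeasure P]
        (u : ℕ → Fin ℓ → Ω → BattlingNGD.E d),
        (∀ t i, HasLaw (u t i) (BattlingNGD.uniformSphere d (1 / √(ℓ : ℝ))) P) →
        iIndepFun (fun p : ℕ × Fin ℓ => u p.1 p.2) P →
      -- a multiwise query uses `2 ^ ℓ ≤ m` points
      (Fintype.card (BattlingNGD.Cube ℓ) = 2 ^ ℓ ∧ 2 ^ ℓ ≤ m) ∧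
      -- the winner yields `ℓ` sign comparisons, one along each sampled direction
      (∀ (γ : ℝ) (w : BattlingNGD.E d) (a : Fin ℓ → BattlingNGD.E d) (i : Fin ℓ),
        let X := BattlingNGD.querySet γ w a
        let v := win X
        X v - X (BattlingNGD.flipSign v i) = (2 * γ * BattlingNGD.coord v i) • a i ∧
        BattlingNGD.sgn (f (X (BattlingNGD.flipSign v i)) - f (X v)) = 1) ∧
      -- the resulting estimates point along the gradient on average and are nearly uncorrelated
      (∀ (γ : ℝ), 0 < γ → ∀ (w : BattlingNGD.E d), gradient f w ≠ 0 → ∀ t : ℕ,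
        let lam := BattlingNGD.errLevel β γ d ℓ ‖gradient f w‖
        let g : Fin ℓ → Ω → BattlingNGD.E d := fun i ω =>
          BattlingNGD.gradEst (fun j => u t j ω)
            (win (BattlingNGD.querySet γ w (fun j => u t j ω))) i
        (∀ (i : Fin ℓ) (b : BattlingNGD.E d), ‖b‖ = 1 →
          |∫ ω, inner ℝ (g i ω) b ∂P
            - c d / √(d : ℝ) * (inner ℝ (gradient f w) b / ‖gradient f w‖)| ≤ 2 * lam) ∧
        (∀ i j : Fin ℓ, i ≠ j →
          |∫ ω, inner ℝ (g i ω) (g j ω) ∂P - (c d) ^ 2 / d| ≤ 4 * lam)) ∧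
      -- convergence
      (∀ (xs w₁ : BattlingNGD.E d) (D ε : ℝ), xs ∈ K → w₁ ∈ K → (∀ x, f xs ≤ f x) →
        0 < D → ‖w₁ - xs‖ ^ 2 ≤ D → 0 < ε →
        ∀ (η γ : ℝ), η = ℓ * √ε / (20 * √(d * β)) → 0 < γ →
          γ ≤ ε ^ (3 / 2 : ℝ) /
              (960 * β * d * ℓ * √((d : ℝ) * ℓ) * D * √(Real.log 480)) * √(2 / β) →
          ∀ T : ℕ, ⌊C * (d * β * D / (ε * ℓ))⌋₊ ≤ T →
            let r := fun ω => BattlingNGD.run f win K η γ w₁ (fun t i => u t i ω) T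
            (∀ ω, (r ω).queries = 2 * T) ∧
            Integrable (fun ω => f (r ω).best) P ∧
            ∫ ω, f (r ω).best ∂P - f xs ≤ ε) := by
  refine ⟨400, by norm_num, cConst, fun d hd => ?_, ?_⟩
  · have : NeZero d := ⟨by omega⟩
    exact ⟨by linarith [half_le_cConst d], cConst_le_one d⟩
  intro d m ℓ hm hℓ hℓd K hK hKc f β hβ hc hf win hwin Ω _ P _ u hlaw hind
  have hℓ1 : 1 ≤ ℓ := by rw [hℓ]; exact Nat.log_pos (by norm_num) hm
  have : NeZero ℓ := ⟨by omega⟩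
  have : NeZero d := ⟨by omega⟩
  obtain ⟨U', hU', hlaw', hind', hae'⟩ := exists_sph_lift (u := fun p : ℕ × Fin ℓ => u p.1 p.2)
    (one_div_pos.2 (sqrt_natCast_pos (ℓ := ℓ))) (fun p => hlaw p.1 p.2) hind
  set U : ℕ → Fin ℓ → Ω → Sph d := fun t i => U' (t, i) with hUdef
  have hU : ∀ t i, Measurable (U t i) := fun t i => hU' (t, i)
  have hUlaw : ∀ t i, P.map (U t i) = sphereUnif d := fun t i => hlaw' (t, i)
  have hUind : iIndepFun (fun p : ℕ × Fin ℓ => U p.1 p.2) P := hind'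
  have hae : ∀ᵐ ω ∂P, (fun t i => u t i ω) = fun t => scaledDirs fun i => U t i ω := by
    filter_upwards [ae_all_iff.2 hae'] with ω hω
    funext t i
    exact hω (t, i)
  refine ⟨⟨by simp, ?_⟩, ?_, ?_, ?_⟩
  · rw [hℓ]; exact Nat.pow_log_le_self 2 (by omega)
  · intro γ w a i
    refine ⟨querySet_sub_flipSign γ w a _ i, ?_⟩
    have := hwin.isMin (querySet γ w a) (flipSign (win (querySet γ w a)) i)
    exact if_pos (by linarith)
  · intro γ hγ w hG t
    -- both expectations are integrals over the law of one round of unit directions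
    have hround : ∀ F : (Fin ℓ → E d) → ℝ, Measurable (fun V : Dirs d ℓ => F (scaledDirs V)) →
        ∫ ω, F (fun j => u t j ω) ∂P = ∫ V, F (scaledDirs V) ∂dirMeas d ℓ := by
      intro F hF
      have hr : Measurable fun ω i => U t i ω := measurable_pi_lambda _ fun i => hU t i
      rw [← map_round_eq hU hUlaw hUind t, integral_map hr.aemeasurable hF.aestronglyMeasurable]
      refine integral_congr_ae ?_
      filter_upwards [hae] with ω hω
      have := congrFun hω t
      rw [this]
    have hmeas := hwin.measurable_est_right γ w
    have hlam := le_errLevel (d := d) (ℓ := ℓ) hβ.le hγ.le (norm_nonneg (gradient f w))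
    refine ⟨fun i b hb => ?_, fun i j hij => ?_⟩
    · have h := abs_integral_inner_est_sub_le hβ.le hf hwin hγ hG i b
      rw [hb, mul_one, real_inner_smul_left, inv_mul_eq_div] at h
      rw [hround (fun a => inner ℝ (gradEst a (win (querySet γ w a)) i) b)
        ((hmeas i).inner measurable_const)]
      exact h.trans (by linarith)
    · have h := abs_integral_inner_est_est_sub_le hβ.le hf hwin hγ hG hij
      rw [hround (fun a => inner ℝ (gradEst a (win (querySet γ w a)) i)
        (gradEst a (win (querySet γ w a)) j)) ((hmeas i).inner (hmeas j))]
      exact h.trans (by linarith)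
  · intro xs w₁ D ε hxs _ hmin hD hw₁ hε η γ hη hγ hγle T hT
    have S : Setting f win xs β D ε η γ :=
      ⟨hℓd, hβ, hD, hε, hγ, hc, hf, hwin, hmin, hη, hγle⟩
    have hrun : ∀ᵐ ω ∂P, f (run f win K η γ w₁ (fun t i => u t i ω) T).best
        = (f (traj f win K η γ w₁ (fun s i => U s i ω) T).best - f xs) + f xs := by
      filter_upwards [hae] with ω hω
      rw [hω, sub_add_cancel]; rfl
    have hI : Integrable
        (fun ω => f (traj f win K η γ w₁ (fun s i => U s i ω) T).best - f xs) P :=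
      ((S.bddMeas_gap_best hK hKc hxs T).comp (measurable_seq hU)).integrable P
    refine ⟨fun ω => run_queries _ T, ?_, ?_⟩
    · exact (hI.add (integrable_const (f xs))).congr (hrun.mono fun ω h => h.symm)
    · rw [integral_congr_ae hrun, integral_add hI (integrable_const _)]
      simp only [integral_const, probReal_univ, smul_eq_mul, one_mul, add_sub_cancel_right]
      exact S.integral_gap_best_le hK hKc hxs hU hUlaw hUind hw₁ hT
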